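/- **Setting.** Let $G$ be a connected $3$-dimensional Lie group, $\{e_i\}_{i=1}^{3}$ a basis of its Lie algebra (viewed as left invariant vector fields) with dual basis $\{\xi^i\}$, and $I=(t_-,t_+)$ an open interval. Let $M=G\times I$ carry the metric $g=-dt\otimes dt+a_{ij}(t)\,\xi^i\otimes\xi^j$, where $a_{ij}\in C^\infty(I)$ and $a(t)=(a_{ij}(t))$ is symmetric and positive definite for all $t\in I$ (a Bianchi spacetime). Let $a^{ij}$ be the components of $a^{-1}$, $\bar k_{ij}$ the components of the second fundamental form of $G\times\{t\}$, $\theta=a^{ij}\bar k_{ij}$ the mean curvature, $\bar S$ the scalar curvature of $G\times\{t\}$ and $\Sigma_{ij}=(\bar k_{ij}-\tfrac13\theta a_{ij})/\theta$. Assume that $t_-$ is a monotone volume singularity: there is a $t_0\in I$ such that $\theta>0$ on $(t_-,t_0)$, and $\tau:=\tfrac13\ln\sqrt{\det a}\to-\infty$ as $t\to t_-$. Assume also, as can be achieved by rescaling the frame, that $\tau(t_0)>0$. Then $\tau$ is a diffeomorphism from $(t_-,t_0)$ onto $(-\infty,\tau(t_0))$ and is used as a time coordinate. Let $\sigma$ be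 the time coordinate with $d\sigma/dt=\tfrac13(\det a)^{-1/2}$ and $\sigma=0$ where $\tau=0$. Assume that Einstein's equations $\mathrm{Ric}-\tfrac12 Sg+\Lambda g=T$ hold on $M$ with $\Lambda\ge0$, and that $\rho:=T(\partial_t,\partial_t)$ and $\bar p:=\tfrac13a^{ij}T(e_i,e_j)$ satisfy $\rho\ge\bar p$ and $\rho\ge0$. Put $$q:=3\Sigma^{ij}\Sigma_{ij}+\tfrac12\Big(\frac{3\rho}{\theta^2}+3\cdot\frac{3\bar p}{\theta^2}-2\cdot\frac{3\Lambda}{\theta^2}\Big),\qquad \gamma_{\bar S}:=\frac{\max\{0,\bar S\}}{\theta^2},\qquad \hat a_{ij}:=\frac{\theta^2a_{ij}}{9},$$ and let $\hat a^{ij}$ be the components of $\hat a^{-1}$. Let $\varphi_0\in C^\infty(I)$ (a function of $t$ only) and $\hat\varphi_0:=9\theta^{-2}\varphi_0$. Let $\mathfrak f\in C^1((-\infty,0])$ be such that $\mathfrak f>0$, $\mathfrak f'\ge0$, $\mathfrak f\in L^1(-\infty,0]$ and $\mathfrak f'/\mathfrak f$ is bounded. A vector field multiindex is a finite sequence $K=((i_1,j_1),\dots,(i_k,j_k))$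 with $i_m\in\{1,2,3\}$ and integers $j_m\ge1$ (the empty sequence is denoted $0$); $|K|:=j_1+\dots+j_k$ and $e_K:=e_{i_1}^{j_1}\cdots e_{i_k}^{j_k}$, with $e_0=\mathrm{id}$. Let $h:=\delta_{ij}\,\xi^i\otimes\xi^j$, with volume measure $\mu_h$ on $G$, and, for integers $l\ge0$, $$\mathcal E_l[u]:=\frac12\int_G\sum_{|K|\le l}\Big([e_K(u)]_\tau^2+\hat a^{ij}\,e_i[e_K(u)]\,e_j[e_K(u)]+\mathfrak f^2[e_K(u)]^2\Big)\mu_h .$$ **Theorem.** Assume that $\gamma_{\bar S}$, as a function of $\tau$, belongs to $L^1(-\infty,0]$, and that $|\hat\varphi_0|+\|\hat a^{-1}\|\le\mathfrak f^2$ for all $\tau\le0$, where $\|\cdot\|$ is the operator norm of matrices. Then, for every $l\ge0$, there is a constant $C_l$ such that for every smooth solution $u$ of $\Box_gu+\varphi_0u=0$ on $G\times(t_-,t_0)$ for which $u$ and $u_\tau$ are compactly supported on $G$ at $\tau=0$, the energies $\mathcal E_l[u](\tau)$, $\tau\le 0$, are finite and $$\mathcal E_l[u](\tau)\le C_l\,\mathcal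 E_l[u](0)\,\exp\Big(2\int_\tau^0[2-q(\tau')]\,d\tau'\Big)\qquad\text{for all }\tau\le0,$$ and moreover $$\int_G\sum_{|K|\le l}[e_K(u_\sigma)]^2\,\mu_h\le C_l\,\mathcal E_l[u](0)\qquad\text{for all }\sigma\le0 .$$ -/

import Mathlib

open Set Filter Topology MeasureTheory Module
open scoped Manifold ContDiff

noncomputable section

namespace Bianchi

/-! ### Geometry in a frame

The next definitions describe the Levi-Civita connection and the curvature of a metric in a frame
`{e_i}` indexed by `ι`. Here `c i j k` is the `k`-th component of `[e_i, e_j]` (the `c i j k` are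
constants), `g t i j = g(e_i, e_j)` is the matrix of components of the metric, which are functions
of one real variable `t` only, and `D i` is the derivation by which `e_i` acts on such functions. -/

section Frame

variable {ι : Type} [Fintype ι] [DecidableEq ι]

/-- `g(∇_{e_i} e_j, e_k)`, given by the Koszul formula. -/
def koszul (D : ι → (ℝ → ℝ) → ℝ → ℝ) (c : ι → ι → ι → ℝ) (g : ℝ → Matrix ι ι ℝ)
    (i j k : ι) (t : ℝ) : ℝ :=
  (1 / 2) * (D i (fun s => g s j k) t + D j (fun s => g s k i) t - D k (fun s => g s i j) t
    + ∑ m, (c i j m * g t m k - c j k m * g t m i + c k i m * g t m j))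

/-- The connection coefficient `Γ^k_{ij}`, where `∇_{e_i} e_j = Γ^k_{ij} e_k`. -/
def christoffel (D : ι → (ℝ → ℝ) → ℝ → ℝ) (c : ι → ι → ι → ℝ) (g : ℝ → Matrix ι ι ℝ)
    (k i j : ι) (t : ℝ) : ℝ :=
  ∑ m, (g t)⁻¹ k m * koszul D c g i j m t

/-- The `l`-th component of
`R(e_i, e_j) e_k = ∇_{e_i} ∇_{e_j} e_k - ∇_{e_j} ∇_{e_i} e_k - ∇_{[e_i, e_j]} e_k`. -/
def riemann (D : ι → (ℝ → ℝ) → ℝ → ℝ) (c : ι → ι → ι → ℝ) (g : ℝ → Matrix ι ι ℝ)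
    (l i j k : ι) (t : ℝ) : ℝ :=
  D i (fun s => christoffel D c g l j k s) t - D j (fun s => christoffel D c g l i k s) t
    + ∑ m, (christoffel D c g m j k t * christoffel D c g l i m t
        - christoffel D c g m i k t * christoffel D c g l j m t
        - c i j m * christoffel D c g l m k t)

/-- `Ric(e_j, e_k)`, the trace of `X ↦ R(X, e_j) e_k`. -/
def ricci (D : ι → (ℝ → ℝ) → ℝ → ℝ) (c : ι → ι → ι → ℝ) (g : ℝ → Matrix ι ι ℝ)
    (j k : ι) (t : ℝ) : ℝ :=
  ∑ i, riemann D c g i i j k t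

/-- The scalar curvature. -/
def scalarCurv (D : ι → (ℝ → ℝ) → ℝ → ℝ) (c : ι → ι → ι → ℝ) (g : ℝ → Matrix ι ι ℝ)
    (t : ℝ) : ℝ :=
  ∑ j, ∑ k, (g t)⁻¹ j k * ricci D c g j k t

end Frame

/-! ### Left invariant frames on a Lie group -/

section Group

variable {G : Type*} [TopologicalSpace G] [ChartedSpace (EuclideanSpace ℝ (Fin 3)) G] [Group G]

/-- `γ^k_{ij}`, where `[e_i, e_j] = γ^k_{ij} e_k`; the arguments are in the order `i j k`. -/
def structConst (e : Basis (Fin 3) ℝ (GroupLieAlgebra (𝓡 3) G)) (i j k : Fin 3) : ℝ :=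
  e.repr ⁅e i, e j⁆ k

/-- The derivative `e_i(f)` of a function along the left invariant vector field `e_i`. -/
def frameD (e : Basis (Fin 3) ℝ (GroupLieAlgebra (𝓡 3) G)) (i : Fin 3) (f : G → ℝ) : G → ℝ :=
  fun x => mfderiv (𝓡 3) 𝓘(ℝ, ℝ) f x (mulInvariantVectorField (e i) x)

/-- Vector field multiindices `K = {(i_1, j_1), …, (i_k, j_k)}` with `i_m ∈ {1, 2, 3}`, `j_m ≥ 1`
and `|K| = j_1 + ⋯ + j_k = n`: the composition of `n` is `(j_1, …, j_k)`. For `n = 0` there is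
exactly one, the multiindex `0`. -/
abbrev MultiIndex (n : ℕ) : Type := (c : Composition n) × (Fin c.length → Fin 3)

/-- `e_K = e_{i_1}^{j_1} ⋯ e_{i_k}^{j_k}`. -/
def frameDK (e : Basis (Fin 3) ℝ (GroupLieAlgebra (𝓡 3) G)) {n : ℕ} (K : MultiIndex n)
    (f : G → ℝ) : G → ℝ :=
  (List.ofFn fun m => (K.2 m, K.1.blocksFun m)).foldr (fun p F => (frameD e p.1)^[p.2] F) f

/-- The density, with respect to Lebesgue measure in the chart at the identity, of the Riemannian
volume of the metric `h` for which the left invariant frame `{e_i}` is orthonormal: if `M` is the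
matrix whose columns are the coordinate vectors of the `e_i`, then `√(det h) = |det M|⁻¹`. -/
def frameDensity (e : Basis (Fin 3) ℝ (GroupLieAlgebra (𝓡 3) G)) (x : G) : ℝ :=
  |Matrix.det (Matrix.of fun k i : Fin 3 =>
    (show EuclideanSpace ℝ (Fin 3) from
      mfderiv (𝓡 3) 𝓘(ℝ, EuclideanSpace ℝ (Fin 3)) (extChartAt (𝓡 3) (1 : G)) x
        (mulInvariantVectorField (e i) x)) k)|⁻¹

theorem exists_compact_in_chart (G : Type*) [TopologicalSpace G]
    [ChartedSpace (EuclideanSpace ℝ (Fin 3)) G] [Group G] :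
    ∃ K : TopologicalSpace.PositiveCompacts G,
      (K : Set G) ⊆ (chartAt (EuclideanSpace ℝ (Fin 3)) (1 : G)).source := by
  have : LocallyCompactSpace G := ChartedSpace.locallyCompactSpace (EuclideanSpace ℝ (Fin 3)) G
  exact exists_positiveCompacts_subset
    (chartAt (EuclideanSpace ℝ (Fin 3)) (1 : G)).open_source
    ⟨1, mem_chart_source (EuclideanSpace ℝ (Fin 3)) (1 : G)⟩

/-- A compact set with non-empty interior inside the domain of the chart at the identity. -/
def refCompact (G : Type*) [TopologicalSpace G]
    [ChartedSpace (EuclideanSpace ℝ (Fin 3)) G] [Group G] :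
    TopologicalSpace.PositiveCompacts G :=
  (exists_compact_in_chart G).choose

/-- The volume measure `μ_h` of the left invariant Riemannian metric `h = δ_{ij} ξ^i ⊗ ξ^j`, where
`{ξ^i}` is dual to `{e_i}`. As `h` is left invariant, `μ_h` is the left Haar measure that gives a
reference compact set in the chart at the identity its Riemannian volume, the integral of
`√(det h)` over the coordinate image of that set. -/
def frameVolume [LieGroup (𝓡 3) ∞ G] [MeasurableSpace G] [BorelSpace G]
    (e : Basis (Fin 3) ℝ (GroupLieAlgebra (𝓡 3) G)) : Measure G :=
  haveI : IsTopologicalGroup G := topologicalGroup_of_lieGroup (𝓡 3) ∞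
  (∫⁻ y in extChartAt (𝓡 3) (1 : G) '' (refCompact G : Set G),
      ENNReal.ofReal (frameDensity e ((extChartAt (𝓡 3) (1 : G)).symm y))) •
    Measure.haarMeasure (refCompact G)

end Group

end Bianchi

/-! ### Bianchi spacetimes -/

/-- A Bianchi spacetime: the manifold `G × I`, with `I = (t₋, t₊)` an open interval, and the
metric `-dt ⊗ dt + a_{ij}(t) ξ^i ⊗ ξ^j`, where `{ξ^i}` is the dual basis of a basis `{e_i}` of the
Lie algebra of the `3`-dimensional Lie group `G`. -/
structure BianchiSpacetime (G : Type*) [TopologicalSpace G]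
    [ChartedSpace (EuclideanSpace ℝ (Fin 3)) G] [Group G] where
  tMinus : EReal
  tPlus : EReal
  tMinus_lt_tPlus : tMinus < tPlus
  e : Basis (Fin 3) ℝ (GroupLieAlgebra (𝓡 3) G)
  a : ℝ → Matrix (Fin 3) (Fin 3) ℝ
  smooth_a : ∀ i j, ContDiffOn ℝ ∞ (fun t => a t i j) {t : ℝ | tMinus < t ∧ (t : EReal) < tPlus}
  posDef_a : ∀ t : ℝ, tMinus < t → (t : EReal) < tPlus → (a t).PosDef

namespace BianchiSpacetime

variable {G : Type*} [TopologicalSpace G] [ChartedSpace (EuclideanSpace ℝ (Fin 3)) G] [Group G]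
  (B : BianchiSpacetime G)

/-- The interval `I = (t₋, t₊)`. -/
def I : Set ℝ := {t : ℝ | B.tMinus < t ∧ (t : EReal) < B.tPlus}

/-- Indices of the spacetime frame `e_0 = ∂_t, e_1, e_2, e_3`; the index `0` is `Sum.inl ()`. -/
abbrev Idx : Type := Unit ⊕ Fin 3

/-- The components of the spacetime metric in the frame `{e_α}`. -/
def metric (t : ℝ) : Matrix Idx Idx ℝ := Matrix.fromBlocks (-1) 0 0 (B.a t)

/-- The components of `[e_α, e_β]`; note that `[∂_t, e_i] = 0`. -/
def stConst : Idx → Idx → Idx → ℝ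
  | .inr i, .inr j, .inr k => Bianchi.structConst B.e i j k
  | _, _, _ => 0

/-- The action of `e_α` on functions that depend on `t` only. -/
def stD : Idx → (ℝ → ℝ) → ℝ → ℝ
  | .inl _, φ, t => deriv φ t
  | .inr _, _, _ => 0

/-- The spacetime Ricci curvature `Ric(e_α, e_β)`. -/
def ric (α β : Idx) (t : ℝ) : ℝ := Bianchi.ricci stD B.stConst B.metric α β t

/-- The spacetime scalar curvature `S`. -/
def scal (t : ℝ) : ℝ := Bianchi.scalarCurv stD B.stConst B.metric t

/-- The scalar curvature `S̄` of the hypersurface `G × {t}` with its induced metric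
`a_{ij}(t) ξ^i ⊗ ξ^j`. -/
def spatialScal (t : ℝ) : ℝ :=
  Bianchi.scalarCurv (fun _ _ _ => 0) (Bianchi.structConst B.e) B.a t

/-- Einstein's equations `Ric - (1/2) S g + Λ g = T` on the spacetime, in the frame `{e_α}`. -/
def SolvesEinstein (Λ : ℝ) (T : ℝ → Matrix Idx Idx ℝ) : Prop :=
  ∀ t ∈ B.I, ∀ α β, B.ric α β t - (1 / 2) * B.scal t * B.metric t α β + Λ * B.metric t α β = T t α β

/-- The energy density `ρ = T_{00}`. -/
def rho (T : ℝ → Matrix Idx Idx ℝ) (t : ℝ) : ℝ := T t (.inl ()) (.inl ())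

/-- The mean pressure `p̄ = (1/3) a^{ij} T_{ij}`. -/
def pBar (T : ℝ → Matrix Idx Idx ℝ) (t : ℝ) : ℝ :=
  (1 / 3) * ∑ i, ∑ j, (B.a t)⁻¹ i j * T t (.inr i) (.inr j)

/-- The second fundamental form `k̄_{ij} = g(∇_{e_i} ∂_t, e_j)` of `G × {t}`. -/
def kBar (t : ℝ) : Matrix (Fin 3) (Fin 3) ℝ :=
  Matrix.of fun i j => Bianchi.koszul stD B.stConst B.metric (.inr i) (.inl ()) (.inr j) t

/-- The mean curvature `θ = a^{ij} k̄_{ij}`. -/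
def theta (t : ℝ) : ℝ := ∑ i, ∑ j, (B.a t)⁻¹ i j * B.kBar t i j

/-- The expansion normalised shear `Σ_{ij} = (k̄_{ij} - (1/3) θ a_{ij}) / θ`. -/
def shear (t : ℝ) : Matrix (Fin 3) (Fin 3) ℝ :=
  Matrix.of fun i j => (B.kBar t i j - (1 / 3) * B.theta t * B.a t i j) / B.theta t

/-- `Σ^{ij} Σ_{ij}`, the indices being raised with `a^{ij}`. -/
def shearSq (t : ℝ) : ℝ :=
  ∑ i, ∑ j, ∑ k, ∑ l, (B.a t)⁻¹ i k * (B.a t)⁻¹ j l * B.shear t k l * B.shear t i j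

/-- `Ω_tot = Ω_ρ + 3 Ω_p̄ - 2 Ω_Λ`. -/
def omegaTot (Λ : ℝ) (T : ℝ → Matrix Idx Idx ℝ) (t : ℝ) : ℝ :=
  3 * rho T t / B.theta t ^ 2 + 3 * (3 * B.pBar T t / B.theta t ^ 2)
    - 2 * (3 * Λ / B.theta t ^ 2)

/-- The deceleration parameter `q = 3 Σ^{ij} Σ_{ij} + (1/2) Ω_tot`. -/
def q (Λ : ℝ) (T : ℝ → Matrix Idx Idx ℝ) (t : ℝ) : ℝ :=
  3 * B.shearSq t + (1 / 2) * B.omegaTot Λ T t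

/-- The logarithmic volume density `τ = (1/3) ln √(det a)`. -/
def tau (t : ℝ) : ℝ := (1 / 3) * Real.log (Real.sqrt (B.a t).det)

/-- `t₋` is a monotone volume singularity, as witnessed by `t₀`: the mean curvature is positive on
`(t₋, t₀)`, and `τ → -∞` as `t → t₋`. -/
structure IsMonotoneVolumeSingularity (t₀ : ℝ) : Prop where
  mem : t₀ ∈ B.I
  theta_pos : ∀ t ∈ B.I, t < t₀ → 0 < B.theta t
  tendsto_tau : Tendsto B.tau (comap ((↑) : ℝ → EReal) (𝓝[>] B.tMinus)) atBot

/-- The interval `I₀ = (t₋, t₀)`. -/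
def I₀ (t₀ : ℝ) : Set ℝ := {t ∈ B.I | t < t₀}

/-- The inverse of `τ : (t₋, t₀) → (-∞, τ(t₀))`: the proper time `t` as a function of `τ`. -/
def timeOfTau (t₀ τ : ℝ) : ℝ := Function.invFunOn B.tau (B.I₀ t₀) τ

/-- The time coordinate `σ`, with `dσ/dt = (1/3) (det a)^{-1/2}` and `σ = 0` where `τ = 0`. -/
def sigma (t₀ t : ℝ) : ℝ :=
  ∫ s in (B.timeOfTau t₀ 0)..t, (1 / 3) * (Real.sqrt (B.a s).det)⁻¹

/-- The proper time `t ∈ (t₋, t₀)` as a function of `σ`. -/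
def timeOfSigma (t₀ σ : ℝ) : ℝ := Function.invFunOn (B.sigma t₀) (B.I₀ t₀) σ

/-- `γ_S̄ = max{0, S̄} / θ²`, as a function of `τ`. -/
def gammaS (t₀ τ : ℝ) : ℝ :=
  max 0 (B.spatialScal (B.timeOfTau t₀ τ)) / B.theta (B.timeOfTau t₀ τ) ^ 2

/-- The matrix with components `â_{ij} = θ² a_{ij} / 9`, as a function of `τ`. -/
def aHat (t₀ τ : ℝ) : Matrix (Fin 3) (Fin 3) ℝ :=
  (B.theta (B.timeOfTau t₀ τ) ^ 2 / 9) • B.a (B.timeOfTau t₀ τ)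

/-- `φ̂₀ = 9 θ⁻² φ₀`, as a function of `τ`. -/
def phiHat (φ₀ : ℝ → ℝ) (t₀ τ : ℝ) : ℝ :=
  9 * (B.theta (B.timeOfTau t₀ τ) ^ 2)⁻¹ * φ₀ (B.timeOfTau t₀ τ)

/-! ### The Klein-Gordon equation -/

/-- The derivative `e_α(u)` of a function on the spacetime. -/
def spD : Idx → (G → ℝ → ℝ) → G → ℝ → ℝ
  | .inl _, u => fun x t => deriv (u x) t
  | .inr i, u => fun x t => Bianchi.frameD B.e i (fun y => u y t) x

/-- The wave operator, the trace of the Hessian: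
`□_g u = g^{αβ} (e_α(e_β(u)) - Γ^γ_{αβ} e_γ(u))`. -/
def box (u : G → ℝ → ℝ) (x : G) (t : ℝ) : ℝ :=
  ∑ α, ∑ β, (B.metric t)⁻¹ α β * (B.spD α (B.spD β u) x t
    - ∑ γ, Bianchi.christoffel stD B.stConst B.metric γ α β t * B.spD γ u x t)

/-- `u` is a smooth solution of `□_g u + φ₀ u = 0` on `G × (t₋, t₀)`. -/
structure IsSolution (φ₀ : ℝ → ℝ) (t₀ : ℝ) (u : G → ℝ → ℝ) : Prop where
  smooth : ContMDiffOn ((𝓡 3).prod 𝓘(ℝ, ℝ)) 𝓘(ℝ, ℝ) ∞ (Function.uncurry u) (univ ×ˢ B.I₀ t₀)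
  eqn : ∀ x, ∀ t ∈ B.I₀ t₀, B.box u x t + φ₀ t * u x t = 0

/-- The initial data of `u` at `τ = 0` have compact support. -/
def HasCompactData (t₀ : ℝ) (u : G → ℝ → ℝ) : Prop :=
  HasCompactSupport (fun x => u x (B.timeOfTau t₀ 0)) ∧
    HasCompactSupport (fun x => deriv (fun τ => u x (B.timeOfTau t₀ τ)) 0)

/-! ### Energies -/

/-- The integrand `∑_{|K| ≤ l} ([e_K(u)]_τ² + â^{ij} e_i[e_K(u)] e_j[e_K(u)] + 𝔣² [e_K(u)]²)` of
the energy of order `l`, at the time `τ`. -/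
def energyDensity (f : ℝ → ℝ) (t₀ : ℝ) (l : ℕ) (u : G → ℝ → ℝ) (τ : ℝ) (x : G) : ℝ :=
  ∑ n ∈ Finset.range (l + 1), ∑ K : Bianchi.MultiIndex n,
    ((deriv (fun s => Bianchi.frameDK B.e K (fun y => u y (B.timeOfTau t₀ s)) x) τ) ^ 2
      + ∑ i, ∑ j, (B.aHat t₀ τ)⁻¹ i j
          * Bianchi.frameD B.e i
              (Bianchi.frameDK B.e K (fun y => u y (B.timeOfTau t₀ τ))) x
          * Bianchi.frameD B.e j
              (Bianchi.frameDK B.e K (fun y => u y (B.timeOfTau t₀ τ))) x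
      + f τ ^ 2 * (Bianchi.frameDK B.e K (fun y => u y (B.timeOfTau t₀ τ)) x) ^ 2)

/-- `∑_{|K| ≤ l} [e_K(u_σ)]²` at the time `σ`. -/
def sigmaDensity (t₀ : ℝ) (l : ℕ) (u : G → ℝ → ℝ) (σ : ℝ) (x : G) : ℝ :=
  ∑ n ∈ Finset.range (l + 1), ∑ K : Bianchi.MultiIndex n,
    (Bianchi.frameDK B.e K (fun y => deriv (fun s => u y (B.timeOfSigma t₀ s)) σ) x) ^ 2

variable [LieGroup (𝓡 3) ∞ G] [MeasurableSpace G] [BorelSpace G]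

/-- The energy `𝓔_l[u](τ)`. -/
def energy (f : ℝ → ℝ) (t₀ : ℝ) (l : ℕ) (u : G → ℝ → ℝ) (τ : ℝ) : ℝ :=
  (1 / 2) * ∫ x, B.energyDensity f t₀ l u τ x ∂(Bianchi.frameVolume B.e)

end BianchiSpacetime

/-- The conditions on the function `𝔣` on `(-∞, 0]`: it is integrable, positive and `C¹`, `𝔣'/𝔣` is
bounded and `𝔣' ≥ 0`. -/
structure AdmissibleWeight (f : ℝ → ℝ) : Prop where
  integrable : IntegrableOn f (Iic 0)
  pos : ∀ τ ≤ 0, 0 < f τ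
  contDiff : ContDiffOn ℝ 1 f (Iic 0)
  bounded : ∃ C : ℝ, ∀ τ ≤ 0, |derivWithin f (Iic 0) τ / f τ| ≤ C
  deriv_nonneg : ∀ τ ≤ 0, 0 ≤ derivWithin f (Iic 0) τ

end

/-! In the time `τ` the equation reads u_ττ = -(2-q) u_τ + â^{ij}(e_i e_j u - ν_i e_j u) + φ̂₀ u,
where ν is a constant covector built from the structure constants (`traceCovector`). Both ‖â^{-1}‖
and |φ̂₀| are at most 𝔣² with 𝔣 integrable, so terms carrying them cost the energy only an
integrable rate. What remains is the competition between the damping 2-q and the change of â^{-1}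
itself.

Einstein's equations settle this competition. Raychaudhuri's equation gives 2-q = 3 + 3θ'/θ² (prime
is d/dt); with the Hamiltonian constraint, ρ ≥ p̄ and Λ ≥ 0 it follows that 2-q ≥ -3γ_S̄. The
constraint with ρ, Λ ≥ 0 also gives tr K² ≤ θ²(1+γ_S̄) for the Weingarten map K. An eigenvalue M of
K satisfies M² + (θ-M)²/2 ≤ tr K², so no eigenvalue exceeds θ(1+γ_S̄/2) (`bil_sharp_le`). In ½ ∂_τ
â^{-1} + (2-q) â^{-1} the terms with θ' cancel, and what is left is 27θ⁻³(θ a^{-1} - a^{-1} k̄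
a^{-1}) ≥ -(3/2) γ_S̄ â^{-1}. Hence dE/dτ ≥ -(2(2-q) + 6γ_S̄ + M𝔣) E (`energy_pointwise`,
`weighted_energy_le`), and Grönwall's inequality towards the past gives the first estimate, since
γ_S̄ and 𝔣 are integrable.

For l > 0 the e_K do not commute with the wave operator. But the span of the e_i is closed under
commutators, so commuting with e_i preserves the span of n-fold products of frame fields, and the
error is bounded by 𝔣 times square roots of energy densities of the same order
(`exists_commutator_bound`). All e_K u with |K| ≤ l are therefore estimated together as one system.

Integration by parts is justified in two steps. On a group that need not be unimodular, ∫ e_i F =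
κ_i ∫ F with constants κ_i (`exists_integral_frameD`); the extra term again comes with â^{ij} and is
harmless. Solutions keep compact support on bounded `τ`-intervals by finite speed of propagation,
which is the same estimate with a weight supported in a shrinking cone (`vanish_of_vanish_nearby`).

For the second estimate, V = θ √(det a) satisfies V_τ = (2-q)V and dσ/dτ = 1/V. So u_σ = V u_τ, and
V² cancels the exponential factor. Since 2-q ≥ -3γ_S̄, V is bounded in the past; hence `σ` tends to
-∞ with `τ`, and every σ ≤ 0 is attained. -/

noncomputable section

namespace Bianchi

/-! ### Left invariant fields as derivatives along translated curves. -/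

section Calculus

variable {G : Type*} [TopologicalSpace G] [ChartedSpace (EuclideanSpace ℝ (Fin 3)) G] [Group G]

/-- The coordinate vector of `e i` in the chart at the identity. -/
def frameVec (e : Basis (Fin 3) ℝ (GroupLieAlgebra (𝓡 3) G)) (i : Fin 3) :
    EuclideanSpace ℝ (Fin 3) := e i

/-- A curve through the identity, straight in the chart at the identity, with velocity `e i`. -/
def frameCurve (e : Basis (Fin 3) ℝ (GroupLieAlgebra (𝓡 3) G)) (i : Fin 3) (s : ℝ) : G :=
  (extChartAt (𝓡 3) (1 : G)).symm (extChartAt (𝓡 3) (1 : G) 1 + s • frameVec e i)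

theorem frameCurve_zero (e : Basis (Fin 3) ℝ (GroupLieAlgebra (𝓡 3) G)) (i : Fin 3) :
    frameCurve e i 0 = (1 : G) := by
  simp [frameCurve]

variable [LieGroup (𝓡 3) ∞ G]

theorem isManifold_of_lieGroup (G : Type*) [TopologicalSpace G]
    [ChartedSpace (EuclideanSpace ℝ (Fin 3)) G] [Group G] [h : LieGroup (𝓡 3) ∞ G] (n : ℕ∞) :
    IsManifold (𝓡 3) n G :=
  have : IsManifold (𝓡 3) ∞ G := h.toContMDiffMul.toIsManifold
  IsManifold.of_le (n := ∞) (by exact_mod_cast le_top)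

theorem eventually_contMDiffAt_frameCurve (e : Basis (Fin 3) ℝ (GroupLieAlgebra (𝓡 3) G))
    (i : Fin 3) :
    ∀ᶠ s in 𝓝 (0 : ℝ), ContMDiffAt 𝓘(ℝ, ℝ) (𝓡 3) ∞ (frameCurve e i : ℝ → G) s := by
  have : IsManifold (𝓡 3) ∞ G := isManifold_of_lieGroup G _
  set p := extChartAt (𝓡 3) (1 : G) 1 with hp
  set w := frameVec e i with hw
  have hc : Continuous fun s : ℝ => p + s • w := by fun_prop
  have hm : (extChartAt (𝓡 3) (1 : G)).target ∈ 𝓝 (p + (0 : ℝ) • w) := by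
    rw [zero_smul, add_zero]
    exact extChartAt_target_mem_nhds (I := 𝓡 3) (1 : G)
  filter_upwards [hc.continuousAt.preimage_mem_nhds hm] with s hs
  have h1 : ContMDiffAt 𝓘(ℝ, EuclideanSpace ℝ (Fin 3)) (𝓡 3) ∞ (extChartAt (𝓡 3) (1 : G)).symm
      (p + s • w) :=
    (contMDiffOn_extChartAt_symm (1 : G)).contMDiffAt
      ((isOpen_extChartAt_target (I := 𝓡 3) (1 : G)).mem_nhds hs)
  have h2 : ContMDiffAt 𝓘(ℝ, ℝ) 𝓘(ℝ, EuclideanSpace ℝ (Fin 3)) ∞ (fun s : ℝ => p + s • w) s :=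
    ContDiffAt.contMDiffAt (by fun_prop)
  exact h1.comp s h2

theorem hasMFDerivAt_frameCurve (e : Basis (Fin 3) ℝ (GroupLieAlgebra (𝓡 3) G)) (i : Fin 3) :
    HasMFDerivAt 𝓘(ℝ, ℝ) (𝓡 3) (frameCurve e i : ℝ → G) 0
      (ContinuousLinearMap.toSpanSingleton ℝ (frameVec e i)) := by
  have : IsManifold (𝓡 3) 1 G := isManifold_of_lieGroup G 1
  set p := extChartAt (𝓡 3) (1 : G) 1 with hp
  have h1 : HasMFDerivAt 𝓘(ℝ, EuclideanSpace ℝ (Fin 3)) (𝓡 3) (extChartAt (𝓡 3) (1 : G)).symm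
      (p + (0:ℝ) • frameVec e i) (ContinuousLinearMap.id ℝ (EuclideanSpace ℝ (Fin 3))) := by
    rw [zero_smul, add_zero]
    have := (mdifferentiableWithinAt_extChartAt_symm (I := 𝓡 3)
      (mem_extChartAt_target (1 : G))).hasMFDerivWithinAt
    rw [mfderivWithin_range_extChartAt_symm, ModelWithCorners.range_eq_univ] at this
    exact hasMFDerivWithinAt_univ.1 this
  have h2 : HasMFDerivAt 𝓘(ℝ, ℝ) 𝓘(ℝ, EuclideanSpace ℝ (Fin 3))
      (fun s : ℝ => p + s • frameVec e i) 0
      (ContinuousLinearMap.toSpanSingleton ℝ (frameVec e i)) := by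
    apply HasFDerivAt.hasMFDerivAt
    have := (((hasDerivAt_id (0:ℝ)).smul_const (frameVec e i)).const_add p).hasFDerivAt
    rw [one_smul] at this
    exact this
  exact h1.comp (0:ℝ) h2

/-- By left invariance, e_i at x is the velocity at s = 0 of the left translate by x of a single
curve through the identity. Only that velocity matters, so the curve need not be a one-parameter
subgroup. Frame derivatives thus become ordinary derivatives in s, from which their calculus rules
are read off. -/
theorem hasDerivAt_comp_frameCurve {e : Basis (Fin 3) ℝ (GroupLieAlgebra (𝓡 3) G)} {i : Fin 3}
    {F : G → ℝ} {x : G} (hF : MDifferentiableAt (𝓡 3) 𝓘(ℝ, ℝ) F x) :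
    HasDerivAt (fun s => F (x * frameCurve e i s)) (frameD e i F x) 0 := by
  have h1 : MDifferentiableAt (𝓡 3) (𝓡 3) (fun y : G => x * y) (frameCurve e i 0) :=
    (contMDiff_mul_left (I := 𝓡 3) (n := ∞)).mdifferentiableAt (by simp)
  have h0 : x * frameCurve e i 0 = x := by simp [frameCurve_zero]
  have h2 := h1.hasMFDerivAt.comp (0 : ℝ) (hasMFDerivAt_frameCurve e i)
  have h3 : HasMFDerivAt (𝓡 3) 𝓘(ℝ, ℝ) F ((fun y : G => x * y) (frameCurve e i 0))
      (mfderiv (𝓡 3) 𝓘(ℝ, ℝ) F (x * frameCurve e i 0)) := by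
    apply MDifferentiableAt.hasMFDerivAt
    simpa only [h0] using hF
  have h4 : HasFDerivAt (fun s : ℝ => F (x * frameCurve e i s)) (_ : ℝ →L[ℝ] ℝ) 0 :=
    hasMFDerivAt_iff_hasFDerivAt.1 (h3.comp (0 : ℝ) h2)
  refine h4.hasDerivAt.congr_deriv ?_
  have : ∀ y z : G, y = 1 → z = x → mfderiv (𝓡 3) 𝓘(ℝ, ℝ) F z
    ((mfderiv (𝓡 3) (𝓡 3) (fun y : G => x * y) y) (frameVec e i)) = frameD e i F x := by
    rintro y z rfl rfl; rfl
  rw [← this (frameCurve e i 0) (x * frameCurve e i 0) (frameCurve_zero e i) h0]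
  change mfderiv (𝓡 3) 𝓘(ℝ, ℝ) F _ (mfderiv (𝓡 3) (𝓡 3) (fun y : G => x * y) _
    (ContinuousLinearMap.toSpanSingleton ℝ (frameVec e i) 1)) = _
  simp

end Calculus
end Bianchi

namespace Bianchi

/-! ### Mixed partial derivatives and smooth dependence on parameters. -/

section MixedPartials

theorem hasDerivAt_partial_fst {K : ℝ × ℝ → ℝ} {s t : ℝ} (hK : DifferentiableAt ℝ K (s, t)) :
    HasDerivAt (fun r => K (r, t)) (fderiv ℝ K (s, t) (1, 0)) s := by
  have h := hK.hasFDerivAt.comp_hasDerivAt (f := fun r : ℝ => (r, t)) s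
    ((hasDerivAt_id s).prodMk (hasDerivAt_const s t))
  exact h

theorem hasDerivAt_partial_snd {K : ℝ × ℝ → ℝ} {s t : ℝ} (hK : DifferentiableAt ℝ K (s, t)) :
    HasDerivAt (fun r => K (s, r)) (fderiv ℝ K (s, t) (0, 1)) t := by
  have h := hK.hasFDerivAt.comp_hasDerivAt (f := fun r : ℝ => (s, r)) t
    ((hasDerivAt_const t s).prodMk (hasDerivAt_id t))
  exact h

theorem deriv_partial_comm {K : ℝ × ℝ → ℝ} {s t : ℝ} (hK : ContDiffAt ℝ ∞ K (s, t)) :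
    deriv (fun r => deriv (fun q => K (q, r)) s) t
      = deriv (fun q => deriv (fun r => K (q, r)) t) s := by
  have hev : ∀ᶠ p in 𝓝 (s, t), ContDiffAt ℝ 1 K p :=
    (hK.of_le (by norm_num)).eventually (n := 1) (by simp)
  have hd : DifferentiableAt ℝ (fderiv ℝ K) (s, t) :=
    (hK.fderiv_right (m := 1) (by norm_cast)).differentiableAt (by simp)
  have e1 : (fun r => deriv (fun q => K (q, r)) s) =ᶠ[𝓝 t] fun r => fderiv ℝ K (s, r) (1, 0) := by
    have : ContinuousAt (fun r : ℝ => (s, r)) t := by fun_prop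
    filter_upwards [this.eventually hev] with r hr
    exact (hasDerivAt_partial_fst (hr.differentiableAt (by simp))).deriv
  have e2 : (fun q => deriv (fun r => K (q, r)) t) =ᶠ[𝓝 s] fun q => fderiv ℝ K (q, t) (0, 1) := by
    have : ContinuousAt (fun r : ℝ => (r, t)) s := by fun_prop
    filter_upwards [this.eventually hev] with r hr
    exact (hasDerivAt_partial_snd (hr.differentiableAt (by simp))).deriv
  rw [e1.deriv_eq, e2.deriv_eq]
  have a1 : HasDerivAt (fun r => fderiv ℝ K (s, r)) (fderiv ℝ (fderiv ℝ K) (s, t) (0, 1)) t :=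
    hd.hasFDerivAt.comp_hasDerivAt (f := fun r : ℝ => (s, r)) t
      ((hasDerivAt_const t s).prodMk (hasDerivAt_id t))
  have a2 : HasDerivAt (fun r => fderiv ℝ K (r, t)) (fderiv ℝ (fderiv ℝ K) (s, t) (1, 0)) s :=
    hd.hasFDerivAt.comp_hasDerivAt (f := fun r : ℝ => (r, t)) s
      ((hasDerivAt_id s).prodMk (hasDerivAt_const s t))
  rw [(a1.clm_apply (hasDerivAt_const t ((1:ℝ), (0:ℝ)))).deriv,
    (a2.clm_apply (hasDerivAt_const s ((0:ℝ), (1:ℝ)))).deriv]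
  simpa using (hK.isSymmSndFDerivAt (by simpa using WithTop.coe_le_coe.2 (le_top : (2 : ℕ∞) ≤ ⊤))) (0, 1) (1, 0)

end MixedPartials

section ParamDeriv

variable {E H N : Type*} [NormedAddCommGroup E] [NormedSpace ℝ E] [TopologicalSpace H]
  {I : ModelWithCorners ℝ E H} [TopologicalSpace N] [ChartedSpace H N]

/-- Serves twice: for the derivative in time, and for the frame derivatives, where the real variable
is the parameter of `frameCurve`. -/
theorem contMDiffAt_deriv_param {F : N → ℝ → ℝ} {p : N} {s : ℝ} [IsManifold I ∞ N]
    (hF : ContMDiffAt (I.prod 𝓘(ℝ, ℝ)) 𝓘(ℝ, ℝ) ∞ (Function.uncurry F) (p, s)) :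
    ContMDiffAt (I.prod 𝓘(ℝ, ℝ)) 𝓘(ℝ, ℝ) ∞ (fun q : N × ℝ => deriv (F q.1) q.2) (p, s) := by
  have h1 : ContMDiffAt ((I.prod 𝓘(ℝ, ℝ)).prod 𝓘(ℝ, ℝ)) 𝓘(ℝ, ℝ) ∞
      (Function.uncurry fun (q : N × ℝ) (r : ℝ) => F q.1 r) ((p, s), s) := by
    have : ContMDiffAt ((I.prod 𝓘(ℝ, ℝ)).prod 𝓘(ℝ, ℝ)) (I.prod 𝓘(ℝ, ℝ)) ∞
      (fun z : (N × ℝ) × ℝ => (z.1.1, z.2)) ((p, s), s) :=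
      (contMDiffAt_fst.fst).prodMk contMDiffAt_snd
    exact ContMDiffAt.comp ((p, s), s) (g := Function.uncurry F) hF this
  have h2 := ContMDiffAt.mfderiv (m := ∞) (fun (q : N × ℝ) (r : ℝ) => F q.1 r) Prod.snd h1
    contMDiffAt_snd (by simp)
  have h2' : ContMDiffAt (I.prod 𝓘(ℝ, ℝ)) 𝓘(ℝ, ℝ →L[ℝ] ℝ) ∞
      (fun q : N × ℝ => fderiv ℝ (F q.1) q.2) (p, s) := by
    have hm : (fun x : N × ℝ => (mfderiv 𝓘(ℝ, ℝ) 𝓘(ℝ, ℝ) (F x.1) x.2 : ℝ →L[ℝ] ℝ))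
        = fun x => fderiv ℝ (F x.1) x.2 := funext fun x => mfderiv_eq_fderiv
    have hi := inTangentCoordinates_model_space (I := 𝓘(ℝ, ℝ)) (I' := 𝓘(ℝ, ℝ))
      (Prod.snd : N × ℝ → ℝ) (fun x => F x.1 x.2) (fun x : N × ℝ => fderiv ℝ (F x.1) x.2) (p, s)
    rw [← hi, ← hm]
    exact h2
  have h3 := h2'.clm_apply (contMDiffAt_const (c := (1 : ℝ)))
  refine h3.congr_of_eventuallyEq (Eventually.of_forall fun q => ?_)
  exact fderiv_apply_one_eq_deriv.symm

end ParamDeriv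

/-! ### Functions jointly smooth in space and time. -/

section Calculus

variable {G : Type*} [TopologicalSpace G] [ChartedSpace (EuclideanSpace ℝ (Fin 3)) G]

/-- Joint smoothness of a function of the group variable and of time, for times in `J`. -/
def SmoothOn (J : Set ℝ) (v : G → ℝ → ℝ) : Prop :=
  ContMDiffOn ((𝓡 3).prod 𝓘(ℝ, ℝ)) 𝓘(ℝ, ℝ) ∞ (Function.uncurry v) (univ ×ˢ J)

namespace SmoothOn

variable {J J' : Set ℝ} {v w : G → ℝ → ℝ}

theorem contMDiffAt (h : SmoothOn J v) (hJ : IsOpen J) {x : G} {t : ℝ} (ht : t ∈ J) :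
    ContMDiffAt ((𝓡 3).prod 𝓘(ℝ, ℝ)) 𝓘(ℝ, ℝ) ∞ (Function.uncurry v) (x, t) :=
  ContMDiffOn.contMDiffAt h ((isOpen_univ.prod hJ).mem_nhds ⟨mem_univ _, ht⟩)

theorem continuousOn (h : SmoothOn J v) : ContinuousOn (Function.uncurry v) (univ ×ˢ J) :=
  ContMDiffOn.continuousOn h

theorem add (hv : SmoothOn J v) (hw : SmoothOn J w) : SmoothOn J (fun x t => v x t + w x t) :=
  ContMDiffOn.add hv hw

theorem of_time {c : ℝ → ℝ} (hc : ContDiffOn ℝ ∞ c J) : SmoothOn J (fun (_ : G) t => c t) :=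
  hc.contMDiffOn.comp contMDiffOn_snd fun _ hp => hp.2

theorem of_space {F : G → ℝ} (hF : ContMDiff (𝓡 3) 𝓘(ℝ, ℝ) ∞ F) :
    SmoothOn J (fun x _ => F x) :=
  (hF.comp contMDiff_fst).contMDiffOn

theorem comp_time (h : SmoothOn J v) {c : ℝ → ℝ} (hc : ContDiffOn ℝ ∞ c J')
    (hm : MapsTo c J' J) : SmoothOn J' (fun x t => v x (c t)) :=
  ContMDiffOn.comp (g := Function.uncurry v) (f := fun p : G × ℝ => (p.1, c p.2)) h
    (contMDiffOn_fst.prodMk (hc.contMDiffOn.comp contMDiffOn_snd fun _ hp => hp.2))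
    fun _ hp => ⟨mem_univ _, hm hp.2⟩

theorem congr (h : SmoothOn J v) (he : ∀ x, ∀ t ∈ J, w x t = v x t) : SmoothOn J w :=
  ContMDiffOn.congr h fun p hp => he p.1 p.2 hp.2

theorem space (h : SmoothOn J v) {t : ℝ} (ht : t ∈ J) :
    ContMDiff (𝓡 3) 𝓘(ℝ, ℝ) ∞ (fun x => v x t) := by
  have h1 : ContMDiff (𝓡 3) ((𝓡 3).prod 𝓘(ℝ, ℝ)) ∞ fun x : G => (x, t) :=
    contMDiff_id.prodMk contMDiff_const
  rw [← contMDiffOn_univ] at h1 ⊢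
  exact ContMDiffOn.comp (g := Function.uncurry v) h h1 fun x _ => ⟨mem_univ _, ht⟩

theorem time (h : SmoothOn J v) (x : G) : ContDiffOn ℝ ∞ (v x) J := by
  have h1 : ContMDiff 𝓘(ℝ, ℝ) ((𝓡 3).prod 𝓘(ℝ, ℝ)) ∞ fun t : ℝ => (x, t) :=
    contMDiff_const.prodMk contMDiff_id
  exact (ContMDiffOn.comp (g := Function.uncurry v) h h1.contMDiffOn
    fun t ht => ⟨mem_univ _, ht⟩).contDiffOn

theorem hasDerivAt (h : SmoothOn J v) (hJ : IsOpen J) (x : G) {t : ℝ} (ht : t ∈ J) :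
    HasDerivAt (v x) (deriv (v x) t) t :=
  (((h.time x).contDiffAt (hJ.mem_nhds ht)).differentiableAt (by simp)).hasDerivAt

variable [Group G] [LieGroup (𝓡 3) ∞ G] {e : Basis (Fin 3) ℝ (GroupLieAlgebra (𝓡 3) G)}

theorem deriv (h : SmoothOn J v) (hJ : IsOpen J) : SmoothOn J (fun x => deriv (v x)) := by
  have : IsManifold (𝓡 3) ∞ G := isManifold_of_lieGroup G _
  intro p hp
  exact (contMDiffAt_deriv_param (h.contMDiffAt hJ (x := p.1) hp.2)).contMDiffWithinAt

theorem comp_frameCurve (h : SmoothOn J v) (hJ : IsOpen J) (i : Fin 3) (x : G) {t : ℝ}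
    (ht : t ∈ J) :
    ContMDiffAt (((𝓡 3).prod 𝓘(ℝ, ℝ)).prod 𝓘(ℝ, ℝ)) 𝓘(ℝ, ℝ) ∞
      (Function.uncurry fun (q : G × ℝ) (s : ℝ) => v (q.1 * frameCurve e i s) q.2) ((x, t), 0) := by
  have hc := (eventually_contMDiffAt_frameCurve e i).self_of_nhds
  have h1 : ContMDiffAt (((𝓡 3).prod 𝓘(ℝ, ℝ)).prod 𝓘(ℝ, ℝ)) (𝓡 3) ∞
      (fun z : (G × ℝ) × ℝ => frameCurve e i z.2) ((x, t), 0) :=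
    ContMDiffAt.comp (g := (frameCurve e i : ℝ → G)) ((x, t), (0:ℝ)) hc contMDiffAt_snd
  have h2 : ContMDiffAt (((𝓡 3).prod 𝓘(ℝ, ℝ)).prod 𝓘(ℝ, ℝ)) (𝓡 3) ∞
      (fun z : (G × ℝ) × ℝ => z.1.1 * frameCurve e i z.2) ((x, t), 0) :=
    contMDiffAt_fst.fst.mul h1
  have h3 : ContMDiffAt (((𝓡 3).prod 𝓘(ℝ, ℝ)).prod 𝓘(ℝ, ℝ)) ((𝓡 3).prod 𝓘(ℝ, ℝ)) ∞
      (fun z : (G × ℝ) × ℝ => (z.1.1 * frameCurve e i z.2, z.1.2)) ((x, t), 0) :=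
    h2.prodMk contMDiffAt_fst.snd
  refine ContMDiffAt.comp (((x, t), (0:ℝ))) (g := Function.uncurry v) ?_ h3
  exact h.contMDiffAt hJ ht

theorem frameD_eq (h : SmoothOn J v) (i : Fin 3) (x : G) {t : ℝ} (ht : t ∈ J) :
    Bianchi.frameD e i (fun y => v y t) x
      = _root_.deriv (fun s => v (x * frameCurve e i s) t) 0 :=
  (hasDerivAt_comp_frameCurve ((h.space ht).mdifferentiableAt (by simp))).deriv.symm

theorem frameD (h : SmoothOn J v) (hJ : IsOpen J) (i : Fin 3) :
    SmoothOn J (fun x t => Bianchi.frameD e i (fun y => v y t) x) := by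
  have : IsManifold (𝓡 3) ∞ G := isManifold_of_lieGroup G _
  refine SmoothOn.congr (v := fun x t => _root_.deriv (fun s => v (x * frameCurve e i s) t) 0) ?_
    fun x t ht => h.frameD_eq i x ht
  rintro ⟨x, t⟩ hp
  have h1 := contMDiffAt_deriv_param (h.comp_frameCurve (e := e) hJ i x hp.2)
  have h2 : ContMDiffAt ((𝓡 3).prod 𝓘(ℝ, ℝ)) (((𝓡 3).prod 𝓘(ℝ, ℝ)).prod 𝓘(ℝ, ℝ)) ∞
    (fun q : G × ℝ => (q, (0:ℝ))) (x, t) := contMDiffAt_id.prodMk contMDiffAt_const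
  exact (ContMDiffAt.comp (x, t) h1 h2).contMDiffWithinAt

/-- Symmetry of second derivatives for the function v(x c(s), t) of two real variables, c being the
curve `frameCurve`. -/
theorem deriv_frameD (h : SmoothOn J v) (hJ : IsOpen J) (i : Fin 3) (x : G) {t : ℝ} (ht : t ∈ J) :
    _root_.deriv (fun r => Bianchi.frameD e i (fun y => v y r) x) t
      = Bianchi.frameD e i (fun y => _root_.deriv (v y) t) x := by
  have e1 : (fun r => Bianchi.frameD e i (fun y => v y r) x) =ᶠ[𝓝 t]
      fun r => _root_.deriv (fun s => v (x * frameCurve e i s) r) 0 := by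
    filter_upwards [hJ.mem_nhds ht] with r hr using h.frameD_eq i x hr
  rw [e1.deriv_eq, (h.deriv hJ).frameD_eq (e := e) i x ht]
  refine deriv_partial_comm (K := fun p : ℝ × ℝ => v (x * frameCurve e i p.1) p.2) ?_
  have h1 : ContMDiffAt 𝓘(ℝ, ℝ × ℝ) (((𝓡 3).prod 𝓘(ℝ, ℝ)).prod 𝓘(ℝ, ℝ)) ∞
      (fun p : ℝ × ℝ => ((x, p.2), p.1)) (0, t) :=
    (contMDiffAt_const.prodMk (contDiffAt_snd.contMDiffAt)).prodMk contDiffAt_fst.contMDiffAt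
  exact (ContMDiffAt.comp ((0:ℝ), t) (h.comp_frameCurve (e := e) hJ i x ht) h1).contDiffAt

end SmoothOn

end Calculus
end Bianchi

namespace Bianchi

/-! ### Leibniz rules and commutators of the frame. -/

section Calculus

variable {G : Type*} [TopologicalSpace G] [ChartedSpace (EuclideanSpace ℝ (Fin 3)) G] [Group G]
  [LieGroup (𝓡 3) ∞ G] {e : Basis (Fin 3) ℝ (GroupLieAlgebra (𝓡 3) G)} {i : Fin 3}
  {F H : G → ℝ} {x : G}

theorem frameD_eq_of_hasDerivAt {F : G → ℝ} (hF : MDifferentiableAt (𝓡 3) 𝓘(ℝ, ℝ) F x) {c : ℝ}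
    (h : HasDerivAt (fun s => F (x * frameCurve e i s)) c 0) : frameD e i F x = c :=
  (hasDerivAt_comp_frameCurve hF).unique h

theorem frameD_add (hF : MDifferentiableAt (𝓡 3) 𝓘(ℝ, ℝ) F x)
    (hH : MDifferentiableAt (𝓡 3) 𝓘(ℝ, ℝ) H x) :
    frameD e i (fun y => F y + H y) x = frameD e i F x + frameD e i H x :=
  frameD_eq_of_hasDerivAt (hF.add hH)
    ((hasDerivAt_comp_frameCurve hF).add (hasDerivAt_comp_frameCurve hH))

theorem frameD_mul (hF : MDifferentiableAt (𝓡 3) 𝓘(ℝ, ℝ) F x)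
    (hH : MDifferentiableAt (𝓡 3) 𝓘(ℝ, ℝ) H x) :
    frameD e i (fun y => F y * H y) x = frameD e i F x * H x + F x * frameD e i H x := by
  refine frameD_eq_of_hasDerivAt (hF.mul hH) ?_
  refine ((hasDerivAt_comp_frameCurve (e := e) (i := i) hF).mul
    (hasDerivAt_comp_frameCurve (e := e) (i := i) hH)).congr_deriv ?_
  simp [frameCurve_zero]

theorem frameD_const_mul (c : ℝ) (hF : MDifferentiableAt (𝓡 3) 𝓘(ℝ, ℝ) F x) :
    frameD e i (fun y => c * F y) x = c * frameD e i F x :=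
  frameD_eq_of_hasDerivAt (mdifferentiableAt_const.mul hF)
    ((hasDerivAt_comp_frameCurve hF).const_mul c)

theorem frameD_sum {ι : Type*} (s : Finset ι) {F : ι → G → ℝ}
    (hF : ∀ k ∈ s, MDifferentiableAt (𝓡 3) 𝓘(ℝ, ℝ) (F k) x) :
    frameD e i (fun y => ∑ k ∈ s, F k y) x = ∑ k ∈ s, frameD e i (F k) x := by
  refine frameD_eq_of_hasDerivAt ?_ (HasDerivAt.fun_sum fun k hk => hasDerivAt_comp_frameCurve (hF k hk))
  classical
  induction s using Finset.induction_on with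
  | empty => simpa using mdifferentiableAt_const
  | insert a s ha ih =>
    simp only [Finset.sum_insert ha]
    exact (hF a (by simp)).add (ih fun k hk => hF k (by simp [hk]))

theorem frameD_comp {ψ : ℝ → ℝ} (hF : MDifferentiableAt (𝓡 3) 𝓘(ℝ, ℝ) F x)
    (hψ : DifferentiableAt ℝ ψ (F x)) :
    frameD e i (fun y => ψ (F y)) x = deriv ψ (F x) * frameD e i F x := by
  refine frameD_eq_of_hasDerivAt (hψ.mdifferentiableAt.comp x hF) ?_
  have h1 := hasDerivAt_comp_frameCurve (e := e) (i := i) hF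
  have h2 : HasDerivAt ψ (deriv ψ (F x)) (F (x * frameCurve e i 0)) := by
    simpa [frameCurve_zero] using hψ.hasDerivAt
  exact h2.comp (0 : ℝ) h1

theorem frameD_comp_mul_left (g : G)
    (hF : MDifferentiableAt (𝓡 3) 𝓘(ℝ, ℝ) F (g * x)) :
    frameD e i (fun y => F (g * y)) x = frameD e i F (g * x) := by
  refine frameD_eq_of_hasDerivAt (F := fun y => F (g * y)) ?_ ?_
  · exact hF.comp x ((contMDiff_mul_left (I := 𝓡 3) (n := ∞)).mdifferentiableAt (by simp))
  · simpa only [mul_assoc] using hasDerivAt_comp_frameCurve (e := e) (i := i) hF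

theorem contMDiff_frameD (hF : ContMDiff (𝓡 3) 𝓘(ℝ, ℝ) ∞ F) :
    ContMDiff (𝓡 3) 𝓘(ℝ, ℝ) ∞ (frameD e i F) :=
  ((SmoothOn.of_space (J := univ) hF).frameD (e := e) isOpen_univ i).space (mem_univ 0)

/-- The left invariant vector field of `v`, read in the chart at the identity. -/
def coordField (v : GroupLieAlgebra (𝓡 3) G) : EuclideanSpace ℝ (Fin 3) → EuclideanSpace ℝ (Fin 3) :=
  VectorField.mpullbackWithin 𝓘(ℝ, EuclideanSpace ℝ (Fin 3)) (𝓡 3)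
    (extChartAt (𝓡 3) (1 : G)).symm (mulInvariantVectorField v) (range (𝓡 3))

omit [LieGroup (𝓡 3) ∞ G] in
theorem mulInvariantVectorField_one (v : GroupLieAlgebra (𝓡 3) G) :
    (show EuclideanSpace ℝ (Fin 3) from mulInvariantVectorField v (1 : G)) = v := by
  have h : ∀ f : G → G, f = id →
      (show EuclideanSpace ℝ (Fin 3) from mfderiv (𝓡 3) (𝓡 3) f 1 v) = v := by
    rintro f rfl
    rw [mfderiv_id]
    rfl
  exact h (fun x => 1 * x) (by ext; simp)

/-- Chain rule: the field read in the chart contains the inverse of the derivative of the inverse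
chart, and the two cancel. -/
theorem mfderiv_eq_fderiv_coord (v : GroupLieAlgebra (𝓡 3) G) {y : EuclideanSpace ℝ (Fin 3)}
    (hF : ContMDiff (𝓡 3) 𝓘(ℝ, ℝ) ∞ F)
    (hy : y ∈ (extChartAt (𝓡 3) (1 : G)).target) :
    mfderiv (𝓡 3) 𝓘(ℝ, ℝ) F ((extChartAt (𝓡 3) (1 : G)).symm y)
        (mulInvariantVectorField v ((extChartAt (𝓡 3) (1 : G)).symm y))
      = fderiv ℝ (fun z => F ((extChartAt (𝓡 3) (1 : G)).symm z)) y (coordField v y) := by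
  have : IsManifold (𝓡 3) 1 G := isManifold_of_lieGroup G 1
  have h0 := mdifferentiableWithinAt_extChartAt_symm (I := 𝓡 3) hy
  have hinv := isInvertible_mfderivWithin_extChartAt_symm (I := 𝓡 3) hy
  have h1 := h0.hasMFDerivWithinAt
  rw [ModelWithCorners.range_eq_univ] at h1
  have h2 := hasMFDerivWithinAt_univ.1 h1
  have h3 : MDifferentiableAt (𝓡 3) 𝓘(ℝ, ℝ) F ((extChartAt (𝓡 3) (1 : G)).symm y) :=
    hF.mdifferentiableAt (by simp)
  have h4 : HasFDerivAt (fun z => F ((extChartAt (𝓡 3) (1 : G)).symm z))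
      (_ : EuclideanSpace ℝ (Fin 3) →L[ℝ] ℝ) y :=
    hasMFDerivAt_iff_hasFDerivAt.1 (h3.hasMFDerivAt.comp y h2)
  rw [h4.fderiv]
  obtain ⟨L, hL⟩ := hinv
  rw [ModelWithCorners.range_eq_univ] at hL
  have h6 : coordField v y = (mfderivWithin 𝓘(ℝ, EuclideanSpace ℝ (Fin 3)) (𝓡 3)
    (extChartAt (𝓡 3) (1 : G)).symm univ y).inverse
    (mulInvariantVectorField v ((extChartAt (𝓡 3) (1 : G)).symm y)) := by
    unfold coordField
    rw [ModelWithCorners.range_eq_univ]; rfl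
  rw [h6, ← hL, ContinuousLinearMap.inverse_equiv]
  change _ = mfderiv (𝓡 3) 𝓘(ℝ, ℝ) F ((extChartAt (𝓡 3) (1 : G)).symm y) (L (L.symm _))
  rw [L.apply_symm_apply]

theorem coordField_self (v : GroupLieAlgebra (𝓡 3) G) :
    coordField v (extChartAt (𝓡 3) (1 : G) 1) = v := by
  have : IsManifold (𝓡 3) 1 G := isManifold_of_lieGroup G 1
  have h : coordField v (extChartAt (𝓡 3) (1 : G) 1) =
    (mfderivWithin 𝓘(ℝ, EuclideanSpace ℝ (Fin 3)) (𝓡 3)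
    (extChartAt (𝓡 3) (1 : G)).symm (range (𝓡 3)) (extChartAt (𝓡 3) (1 : G) 1)).inverse
      (mulInvariantVectorField v ((extChartAt (𝓡 3) (1 : G)).symm (extChartAt (𝓡 3) (1 : G) 1))) :=
    rfl
  rw [h, mfderivWithin_range_extChartAt_symm]
  have h2 : ∀ z : G, z = 1 →
    (show EuclideanSpace ℝ (Fin 3) from mulInvariantVectorField v z) = v := by
    rintro z rfl; exact mulInvariantVectorField_one v
  have h3 := h2 _ (extChartAt_to_inv (I := 𝓡 3) (1 : G))
  refine Eq.trans ?_ h3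
  exact congrArg (fun L : EuclideanSpace ℝ (Fin 3) →L[ℝ] EuclideanSpace ℝ (Fin 3) => L _)
    ContinuousLinearMap.inverse_id

theorem differentiableAt_coordField (v : GroupLieAlgebra (𝓡 3) G) :
    DifferentiableAt ℝ (coordField v) (extChartAt (𝓡 3) (1 : G) 1) := by
  have : IsManifold (𝓡 3) 2 G := isManifold_of_lieGroup G 2
  have : LieGroup (𝓡 3) (minSmoothness ℝ 3) G := LieGroup.of_le (n := ∞) (by
    simpa using WithTop.coe_le_coe.2 (le_top : (3 : ℕ∞) ≤ ⊤))
  have h := (mdifferentiableAt_mulInvariantVectorField v (g := (1 : G))).mdifferentiableWithinAt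
    (s := univ)
  have h2 := h.differentiableWithinAt_mpullbackWithin_vectorField
  rw [preimage_univ, univ_inter, ModelWithCorners.range_eq_univ] at h2
  have h3 := differentiableWithinAt_univ.1 h2
  unfold coordField
  rw [ModelWithCorners.range_eq_univ]
  exact h3

/-- The bracket of the Lie algebra is by definition that of the left invariant fields at the
identity, computed in the chart there; the derivative of this chart at its centre is the identity
map. -/
theorem coordField_bracket (v w : GroupLieAlgebra (𝓡 3) G) :
    (show EuclideanSpace ℝ (Fin 3) from (⁅v, w⁆ : GroupLieAlgebra (𝓡 3) G))
      = VectorField.lieBracket ℝ (coordField v) (coordField w) (extChartAt (𝓡 3) (1 : G) 1) := by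
  have : IsManifold (𝓡 3) 1 G := isManifold_of_lieGroup G 1
  let b : EuclideanSpace ℝ (Fin 3) := VectorField.lieBracketWithin ℝ (coordField v) (coordField w)
    ((extChartAt (𝓡 3) (1 : G)).symm ⁻¹' univ ∩ range (𝓡 3)) (extChartAt (𝓡 3) (1 : G) 1)
  have h : (show EuclideanSpace ℝ (Fin 3) from (⁅v, w⁆ : GroupLieAlgebra (𝓡 3) G)) =
    (mfderiv (𝓡 3) 𝓘(ℝ, EuclideanSpace ℝ (Fin 3)) (extChartAt (𝓡 3) (1 : G)) 1).inverse b := rfl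
  have hb : b = VectorField.lieBracket ℝ (coordField v) (coordField w)
      (extChartAt (𝓡 3) (1 : G) 1) := by
    simp only [b]
    rw [preimage_univ, univ_inter, ModelWithCorners.range_eq_univ,
      VectorField.lieBracketWithin_univ]
  rw [h, mfderiv_extChartAt_self, ← hb]
  exact congrArg (fun L : EuclideanSpace ℝ (Fin 3) →L[ℝ] EuclideanSpace ℝ (Fin 3) => L _)
    ContinuousLinearMap.inverse_id

theorem frameD_eq_fderiv_coord {y : EuclideanSpace ℝ (Fin 3)}
    (hF : ContMDiff (𝓡 3) 𝓘(ℝ, ℝ) ∞ F) (hy : y ∈ (extChartAt (𝓡 3) (1 : G)).target) :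
    frameD e i F ((extChartAt (𝓡 3) (1 : G)).symm y)
      = fderiv ℝ (fun z => F ((extChartAt (𝓡 3) (1 : G)).symm z)) y (coordField (e i) y) :=
  mfderiv_eq_fderiv_coord (e i) hF hy

theorem contDiffAt_comp_extChartAt_symm {y : EuclideanSpace ℝ (Fin 3)}
    (hF : ContMDiff (𝓡 3) 𝓘(ℝ, ℝ) ∞ F) (hy : y ∈ (extChartAt (𝓡 3) (1 : G)).target) :
    ContDiffAt ℝ ∞ (fun z => F ((extChartAt (𝓡 3) (1 : G)).symm z)) y := by
  have : IsManifold (𝓡 3) ∞ G := isManifold_of_lieGroup G _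
  have h1 : ContMDiffAt 𝓘(ℝ, EuclideanSpace ℝ (Fin 3)) (𝓡 3) ∞ (extChartAt (𝓡 3) (1 : G)).symm y :=
    (contMDiffOn_extChartAt_symm (1 : G)).contMDiffAt
      ((isOpen_extChartAt_target (I := 𝓡 3) (1 : G)).mem_nhds hy)
  exact (hF.contMDiffAt.comp y h1).contDiffAt

theorem frameD_frameD_one (hF : ContMDiff (𝓡 3) 𝓘(ℝ, ℝ) ∞ F) (i j : Fin 3) :
    frameD e i (frameD e j F) 1 =
      fderiv ℝ (fderiv ℝ (fun z => F ((extChartAt (𝓡 3) (1 : G)).symm z)))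
        (extChartAt (𝓡 3) (1 : G) 1) (frameVec e i) (frameVec e j)
      + fderiv ℝ (fun z => F ((extChartAt (𝓡 3) (1 : G)).symm z)) (extChartAt (𝓡 3) (1 : G) 1)
        (fderiv ℝ (coordField (e j)) (extChartAt (𝓡 3) (1 : G) 1) (frameVec e i)) := by
  set p := extChartAt (𝓡 3) (1 : G) 1 with hp
  have hpt : p ∈ (extChartAt (𝓡 3) (1 : G)).target := mem_extChartAt_target (1 : G)
  have h1 : (extChartAt (𝓡 3) (1 : G)).symm p = 1 := extChartAt_to_inv (I := 𝓡 3) (1 : G)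
  have h2 := frameD_eq_fderiv_coord (e := e) (i := i) (contMDiff_frameD (e := e) (i := j) hF) hpt
  rw [h1] at h2
  rw [h2]
  have h3 : (fun z => frameD e j F ((extChartAt (𝓡 3) (1 : G)).symm z)) =ᶠ[𝓝 p]
      fun z => fderiv ℝ (fun z => F ((extChartAt (𝓡 3) (1 : G)).symm z)) z (coordField (e j) z) := by
    filter_upwards [(isOpen_extChartAt_target (I := 𝓡 3) (1 : G)).mem_nhds hpt] with z hz
    exact frameD_eq_fderiv_coord hF hz
  have h4 : DifferentiableAt ℝ (fderiv ℝ (fun z => F ((extChartAt (𝓡 3) (1 : G)).symm z))) p :=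
    ((contDiffAt_comp_extChartAt_symm hF hpt).fderiv_right (m := 1) (by norm_cast)).differentiableAt
      (by simp)
  have hc : ∀ k, coordField (e k) p = frameVec e k := fun k => coordField_self (e k)
  rw [h3.fderiv_eq, fderiv_clm_apply h4 (differentiableAt_coordField (e j)), hc, hc, add_comm]
  rfl

/-- In coordinates the second derivatives of F cancel by symmetry; the derivatives of the
coefficient fields remain and form the Lie bracket. -/
theorem frameD_comm_one (hF : ContMDiff (𝓡 3) 𝓘(ℝ, ℝ) ∞ F) (i j : Fin 3) :
    frameD e i (frameD e j F) 1 - frameD e j (frameD e i F) 1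
      = ∑ k, structConst e i j k * frameD e k F 1 := by
  set p := extChartAt (𝓡 3) (1 : G) 1 with hp
  have hpt : p ∈ (extChartAt (𝓡 3) (1 : G)).target := mem_extChartAt_target (1 : G)
  have h1 : (extChartAt (𝓡 3) (1 : G)).symm p = 1 := extChartAt_to_inv (I := 𝓡 3) (1 : G)
  have h2 : ∀ k, frameD e k F 1
      = fderiv ℝ (fun z => F ((extChartAt (𝓡 3) (1 : G)).symm z)) p (frameVec e k) := by
    intro k
    have := frameD_eq_fderiv_coord (e := e) (i := k) hF hpt
    rw [h1, coordField_self] at this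
    exact this
  have h3 := ((contDiffAt_comp_extChartAt_symm hF hpt).isSymmSndFDerivAt
    (by simpa using WithTop.coe_le_coe.2 (le_top : (2 : ℕ∞) ≤ ⊤))) (frameVec e i) (frameVec e j)
  have h4 : (∑ k, structConst e i j k • frameVec e k)
      = VectorField.lieBracket ℝ (coordField (e i)) (coordField (e j)) p := by
    rw [← coordField_bracket]
    exact e.sum_repr ⁅e i, e j⁆
  have hc : ∀ k, coordField (e k) p = frameVec e k := fun k => coordField_self (e k)
  rw [frameD_frameD_one hF, frameD_frameD_one hF, h3]
  simp only [h2, ← smul_eq_mul, ← map_smul, ← map_sum, h4, VectorField.lieBracket, map_sub,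
    ← hp, hc]
  abel

/-- Frame derivatives commute with left translations, so the identity at 1, applied to F(x ·), gives
the one at x. -/
theorem frameD_comm (hF : ContMDiff (𝓡 3) 𝓘(ℝ, ℝ) ∞ F) (i j : Fin 3) (x : G) :
    frameD e i (frameD e j F) x - frameD e j (frameD e i F) x
      = ∑ k, structConst e i j k * frameD e k F x := by
  have hFx : ContMDiff (𝓡 3) 𝓘(ℝ, ℝ) ∞ (fun y => F (x * y)) := hF.comp contMDiff_mul_left
  have hd : ∀ {H : G → ℝ}, ContMDiff (𝓡 3) 𝓘(ℝ, ℝ) ∞ H → ∀ y,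
    MDifferentiableAt (𝓡 3) 𝓘(ℝ, ℝ) H y := fun hH y => hH.mdifferentiableAt (by simp)
  have h1 : ∀ k, frameD e k (fun y => F (x * y)) = fun y => frameD e k F (x * y) := fun k =>
    funext fun y => frameD_comp_mul_left x (hd hF _)
  have h2 := frameD_comm_one (e := e) hFx i j
  simpa only [h1, frameD_comp_mul_left x (hd (contMDiff_frameD hF) _), mul_one] using h2

end Calculus
end Bianchi

namespace Bianchi

/-! ### Integrals depending on time, with uniformly compact support. -/

section ParametricIntegral

variable {X : Type*} [TopologicalSpace X] [T2Space X] [MeasurableSpace X] [BorelSpace X]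
  {μ : Measure X} [IsFiniteMeasureOnCompacts μ] {K : Set X} {J : Set ℝ} {F F' : X → ℝ → ℝ}

theorem hasDerivAt_integral_of_compact (hK : IsCompact K) (hJ : IsOpen J)
    (hF : ContinuousOn (Function.uncurry F) (univ ×ˢ J))
    (hF' : ContinuousOn (Function.uncurry F') (univ ×ˢ J))
    (hd : ∀ x, ∀ t ∈ J, HasDerivAt (F x) (F' x t) t)
    (hs : ∀ x, x ∉ K → ∀ t ∈ J, F x t = 0) {t : ℝ} (ht : t ∈ J) :
    HasDerivAt (fun r => ∫ x, F x r ∂μ) (∫ x, F' x t ∂μ) t := by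
  have hs' : ∀ x, x ∉ K → ∀ r ∈ J, F' x r = 0 := by
    intro x hx r hr
    refine (hd x r hr).unique ((hasDerivAt_const r (0 : ℝ)).congr_of_eventuallyEq ?_)
    filter_upwards [hJ.mem_nhds hr] with q hq using hs x hx q hq
  have hcont : ∀ {H : X → ℝ → ℝ}, ContinuousOn (Function.uncurry H) (univ ×ˢ J) → ∀ r ∈ J,
      Continuous fun x => H x r := by
    intro H hH r hr
    exact ContinuousOn.comp_continuous (g := Function.uncurry H) (f := fun x => (x, r)) hH
      (by fun_prop) fun x => ⟨mem_univ _, hr⟩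
  obtain ⟨ε, hε, hball⟩ := Metric.nhds_basis_closedBall.mem_iff.1 (hJ.mem_nhds ht)
  obtain ⟨C, hC⟩ := ((hK.prod (isCompact_closedBall t ε)).bddAbove_image
    (f := fun p => ‖Function.uncurry F' p‖)
    (hF'.norm.mono (prod_mono (subset_univ _) hball)))
  refine (hasDerivAt_integral_of_dominated_loc_of_deriv_le (F := fun r x => F x r)
    (F' := fun r x => F' x r) (bound := K.indicator fun _ => C)
    (Metric.closedBall_mem_nhds t hε) ?_ ?_ ?_ ?_ ?_ ?_).2
  · filter_upwards [hJ.mem_nhds ht] with r hr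
    exact (hcont hF r hr).aestronglyMeasurable
  · exact (hcont hF t ht).integrable_of_hasCompactSupport
      (HasCompactSupport.intro hK fun x hx => hs x hx t ht)
  · exact (hcont hF' t ht).aestronglyMeasurable
  · refine Eventually.of_forall fun x r hr => ?_
    by_cases hx : x ∈ K
    · rw [indicator_of_mem hx]
      exact hC ⟨(x, r), ⟨hx, hr⟩, rfl⟩
    · rw [indicator_of_notMem hx, hs' x hx r (hball hr), norm_zero]
  · exact (integrable_indicator_iff hK.measurableSet).2 (integrableOn_const hK.measure_ne_top)
  · exact Eventually.of_forall fun x r hr => hd x r (hball hr)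

omit [T2Space X] in
theorem continuousOn_integral_of_compact (hK : IsCompact K)
    (hF : ContinuousOn (Function.uncurry F) (univ ×ˢ J))
    (hs : ∀ x, x ∉ K → ∀ t ∈ J, F x t = 0) :
    ContinuousOn (fun r => ∫ x, F x r ∂μ) J := by
  refine continuousOn_integral_of_compact_support (f := fun r x => F x r) hK ?_
    fun p x hp hx => hs x hx p hp
  exact hF.comp (f := fun p : ℝ × X => (p.2, p.1)) (by fun_prop) fun p hp => ⟨mem_univ _, hp.1⟩

end ParametricIntegral

/-! ### The divergence identity for Haar measure. -/

section IntegrationByParts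

open Measure
open scoped Pointwise

variable {G : Type*} [TopologicalSpace G] [T2Space G] [ChartedSpace (EuclideanSpace ℝ (Fin 3)) G]
  [Group G] [LieGroup (𝓡 3) ∞ G] [MeasurableSpace G] [BorelSpace G]

omit [T2Space G] [MeasurableSpace G] [BorelSpace G] in
theorem exists_frameCurve_smooth (e : Basis (Fin 3) ℝ (GroupLieAlgebra (𝓡 3) G)) (i : Fin 3) :
    ∃ ε > 0, ∀ s ∈ Icc (-ε) ε, ContMDiffAt 𝓘(ℝ, ℝ) (𝓡 3) ∞ (frameCurve e i : ℝ → G) s := by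
  obtain ⟨ε, hε, hball⟩ := Metric.nhds_basis_closedBall.mem_iff.1
    (eventually_contMDiffAt_frameCurve e i)
  exact ⟨ε, hε, fun s hs => hball (by rw [Real.closedBall_eq_Icc]; simpa using hs)⟩

theorem hasDerivAt_integral_frameCurve [IsTopologicalGroup G] (μ : Measure G)
    [IsFiniteMeasureOnCompacts μ]
    (e : Basis (Fin 3) ℝ (GroupLieAlgebra (𝓡 3) G)) (i : Fin 3) {F : G → ℝ}
    (hF : ContMDiff (𝓡 3) 𝓘(ℝ, ℝ) ∞ F) (hc : HasCompactSupport F) :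
    HasDerivAt (fun s => ∫ x, F (x * frameCurve e i s) ∂μ) (∫ x, frameD e i F x ∂μ) 0 := by
  obtain ⟨ε, hε, hsm⟩ := exists_frameCurve_smooth e i
  have hsm' : SmoothOn (Ioo (-ε) ε) (fun x s => F (x * frameCurve e i s)) := by
    have h1 : ContMDiffOn 𝓘(ℝ, ℝ) (𝓡 3) ∞ (frameCurve e i : ℝ → G) (Ioo (-ε) ε) := fun s hs =>
      (hsm s (Ioo_subset_Icc_self hs)).contMDiffWithinAt
    have h2 : ContMDiffOn ((𝓡 3).prod 𝓘(ℝ, ℝ)) (𝓡 3) ∞ (fun p : G × ℝ => frameCurve e i p.2)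
        (univ ×ˢ Ioo (-ε) ε) :=
      ContMDiffOn.comp (g := (frameCurve e i : ℝ → G)) h1 contMDiffOn_snd fun p hp => hp.2
    exact hF.comp_contMDiffOn (contMDiffOn_fst.mul h2)
  have h0 : (0 : ℝ) ∈ Ioo (-ε) ε := by simp [hε]
  -- If F(x c(s)) ≠ 0 with |s| ≤ ε, then x lies in the support of F times c(s)⁻¹. This product set
  -- contains the supports of all the translates at once.
  have hcpt : IsCompact (tsupport F * (frameCurve e i '' Icc (-ε) ε)⁻¹) := by
    refine IsCompact.mul hc (IsCompact.inv (isCompact_Icc.image_of_continuousOn fun s hs => ?_))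
    exact (hsm s hs).continuousAt.continuousWithinAt
  have := hasDerivAt_integral_of_compact (μ := μ) hcpt isOpen_Ioo hsm'.continuousOn
    (hsm'.deriv isOpen_Ioo).continuousOn (fun x t ht => hsm'.hasDerivAt isOpen_Ioo x ht) ?_ h0
  · refine this.congr_deriv (integral_congr_ae (Eventually.of_forall fun x => ?_))
    exact (hasDerivAt_comp_frameCurve (hF.mdifferentiableAt (by simp))).deriv
  · intro x hx s hs
    by_contra hne
    refine hx ⟨x * frameCurve e i s, subset_tsupport _ hne, (frameCurve e i s)⁻¹, ?_, by simp⟩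
    simpa using ⟨s, Ioo_subset_Icc_self hs, rfl⟩

/-- The measure is left invariant, while e_i differentiates along right translations, under which it
is only rescaled. The factor does not depend on F, so its derivative at s = 0 is a common constant
κ_i, which vanishes in the unimodular case. -/
theorem exists_integral_frameD [IsTopologicalGroup G] (μ : Measure G) [IsHaarMeasure μ]
    (e : Basis (Fin 3) ℝ (GroupLieAlgebra (𝓡 3) G)) (i : Fin 3) :
    ∃ κ : ℝ, ∀ F : G → ℝ, ContMDiff (𝓡 3) 𝓘(ℝ, ℝ) ∞ F → HasCompactSupport F →
      ∫ x, frameD e i F x ∂μ = κ * ∫ x, F x ∂μ := by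
  have : IsManifold (𝓡 3) ∞ G := isManifold_of_lieGroup G _
  have hscale : ∀ F : G → ℝ, ContMDiff (𝓡 3) 𝓘(ℝ, ℝ) ∞ F → HasCompactSupport F → ∀ g : G,
      ∫ x, F (x * g) ∂μ = (haarScalarFactor (map (· * g) μ) μ : ℝ) * ∫ x, F x ∂μ := by
    intro F hF hc g
    have h1 := integral_isMulLeftInvariant_eq_smul_of_hasCompactSupport (map (· * g) μ) μ
      hF.continuous hc
    rw [integral_smul_nnreal_measure, integral_map (by fun_prop)
      hF.continuous.aestronglyMeasurable] at h1
    exact h1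
  -- A bump function has positive integral, so the ratio of its translated integral to its integral
  -- exhibits the scale factor as a differentiable function of s.
  obtain ⟨ρ⟩ : Nonempty (SmoothBumpFunction (𝓡 3) (1 : G)) := inferInstance
  have hρ : 0 < ∫ x, ρ x ∂μ :=
    ρ.continuous.integral_pos_of_hasCompactSupport_nonneg_nonzero ρ.hasCompactSupport
      (fun x => ρ.nonneg) (x := 1) (by simp)
  refine ⟨(∫ x, frameD e i ρ x ∂μ) / ∫ x, ρ x ∂μ, fun F hF hc => ?_⟩
  have h1 := hasDerivAt_integral_frameCurve μ e i hF hc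
  have h2 := (hasDerivAt_integral_frameCurve μ e i ρ.contMDiff ρ.hasCompactSupport).div_const
    (∫ x, ρ x ∂μ)
  refine h1.unique ((h2.mul_const (∫ x, F x ∂μ)).congr_of_eventuallyEq (.of_forall fun s => ?_))
  simp only [hscale F hF hc, hscale ρ ρ.contMDiff ρ.hasCompactSupport]
  rw [mul_div_cancel_right₀ _ hρ.ne']

end IntegrationByParts

/-! ### Finiteness of the normalisation of the volume measure. -/

section Volume

variable {G : Type*} [TopologicalSpace G] [ChartedSpace (EuclideanSpace ℝ (Fin 3)) G]
  [Group G] [LieGroup (𝓡 3) ∞ G] {e : Basis (Fin 3) ℝ (GroupLieAlgebra (𝓡 3) G)}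

theorem continuousOn_frameD {F : G → ℝ} {U : Set G} (hU : IsOpen U)
    (hF : ContMDiffOn (𝓡 3) 𝓘(ℝ, ℝ) ∞ F U) (i : Fin 3) : ContinuousOn (frameD e i F) U := by
  have : IsManifold (𝓡 3) ∞ G := isManifold_of_lieGroup G _
  intro x hx
  have hFx : ∀ y ∈ U, ContMDiffAt (𝓡 3) 𝓘(ℝ, ℝ) ∞ F y := fun y hy =>
    hF.contMDiffAt (hU.mem_nhds hy)
  have h1 : ContMDiffAt ((𝓡 3).prod 𝓘(ℝ, ℝ)) 𝓘(ℝ, ℝ) ∞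
      (Function.uncurry fun (y : G) (s : ℝ) => F (y * frameCurve e i s)) (x, 0) := by
    have hc := (eventually_contMDiffAt_frameCurve e i).self_of_nhds
    have h2 : ContMDiffAt ((𝓡 3).prod 𝓘(ℝ, ℝ)) (𝓡 3) ∞
        (fun z : G × ℝ => z.1 * frameCurve e i z.2) (x, 0) :=
      contMDiffAt_fst.mul
        (ContMDiffAt.comp (g := (frameCurve e i : ℝ → G)) (x, (0:ℝ)) hc contMDiffAt_snd)
    refine ContMDiffAt.comp (x, (0:ℝ)) (g := F) ?_ h2
    simpa [frameCurve_zero] using hFx x hx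
  have h2 := (contMDiffAt_deriv_param h1).continuousAt
  have h3 : ContinuousAt (fun y : G => deriv (fun s => F (y * frameCurve e i s)) 0) x :=
    ContinuousAt.comp (f := fun y : G => (y, (0:ℝ))) h2 (by fun_prop)
  refine (h3.congr ?_).continuousWithinAt
  filter_upwards [hU.mem_nhds hx] with y hy
  exact (hasDerivAt_comp_frameCurve ((hFx y hy).mdifferentiableAt (by simp))).deriv

/-- The derivative, at the identity, of the left translation by `x` read in the chart at the
identity. -/
def coordTranslation (x : G) : EuclideanSpace ℝ (Fin 3) →L[ℝ] EuclideanSpace ℝ (Fin 3) :=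
  (show EuclideanSpace ℝ (Fin 3) →L[ℝ] EuclideanSpace ℝ (Fin 3) from
    mfderiv (𝓡 3) 𝓘(ℝ, EuclideanSpace ℝ (Fin 3)) (extChartAt (𝓡 3) (1 : G)) x).comp
  (show EuclideanSpace ℝ (Fin 3) →L[ℝ] EuclideanSpace ℝ (Fin 3) from
    mfderiv (𝓡 3) (𝓡 3) (fun y : G => x * y) 1)

theorem coordTranslation_injective {x : G} (hx : x ∈ (extChartAt (𝓡 3) (1 : G)).source) :
    Function.Injective (coordTranslation x) := by
  have : IsManifold (𝓡 3) 1 G := isManifold_of_lieGroup G 1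
  have h1 : Function.Injective
      (mfderiv (𝓡 3) 𝓘(ℝ, EuclideanSpace ℝ (Fin 3)) (extChartAt (𝓡 3) (1 : G)) x) := by
    obtain ⟨L, hL⟩ := isInvertible_mfderiv_extChartAt (I := 𝓡 3) hx
    rw [← hL]
    exact L.injective
  have hd : ∀ z y : G, MDifferentiableAt (𝓡 3) (𝓡 3) (fun y : G => z * y) y := fun z y =>
    (contMDiff_mul_left (I := 𝓡 3) (n := ∞)).mdifferentiableAt (by simp)
  have h2 : Function.Injective (mfderiv (𝓡 3) (𝓡 3) (fun y : G => x * y) 1) := by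
    have h3 : mfderiv (𝓡 3) (𝓡 3) ((fun y : G => x⁻¹ * y) ∘ (fun y : G => x * y)) 1 =
        ContinuousLinearMap.id _ _ := by
      have : (fun y : G => x⁻¹ * y) ∘ (fun y : G => x * y) = id := by ext; simp
      rw [this, id_eq, mfderiv_id]
    rw [mfderiv_comp (I' := 𝓡 3) _ (hd _ _) (hd _ _)] at h3
    intro a b hab
    have h4 := DFunLike.congr_fun h3 a
    have h5 := DFunLike.congr_fun h3 b
    refine h4.symm.trans (Eq.trans ?_ h5)
    exact congrArg (mfderiv (𝓡 3) (𝓡 3) (fun y : G => x⁻¹ * y) (x * 1)) hab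
  exact h1.comp h2

/-- The matrix of coordinates, in the chart at the identity, of the left invariant frame. -/
def frameMatrix (e : Basis (Fin 3) ℝ (GroupLieAlgebra (𝓡 3) G)) (x : G) :
    Matrix (Fin 3) (Fin 3) ℝ :=
  Matrix.of fun k i => coordTranslation x (frameVec e i) k

theorem det_frameMatrix_ne_zero {x : G} (hx : x ∈ (extChartAt (𝓡 3) (1 : G)).source) :
    (frameMatrix e x).det ≠ 0 := by
  let b : Basis (Fin 3) ℝ (EuclideanSpace ℝ (Fin 3)) := e
  let L := LinearEquiv.ofInjectiveEndo (coordTranslation x).toLinearMap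
    (coordTranslation_injective hx)
  have h := LinearEquiv.isUnit_det L b (EuclideanSpace.basisFun (Fin 3) ℝ).toBasis
  have h2 : LinearMap.toMatrix b (EuclideanSpace.basisFun (Fin 3) ℝ).toBasis L.toLinearMap
      = frameMatrix e x := by
    ext k i
    rw [LinearMap.toMatrix_apply]
    rfl
  rw [h2] at h
  exact h.ne_zero

theorem continuousOn_frameMatrix (k i : Fin 3) :
    ContinuousOn (fun x : G => frameMatrix e x k i) (extChartAt (𝓡 3) (1 : G)).source := by
  have : IsManifold (𝓡 3) ∞ G := isManifold_of_lieGroup G _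
  have : IsManifold (𝓡 3) 1 G := isManifold_of_lieGroup G 1
  have h1 : ContMDiffOn (𝓡 3) 𝓘(ℝ, ℝ) ∞ (fun x : G => extChartAt (𝓡 3) (1 : G) x k)
      (extChartAt (𝓡 3) (1 : G)).source := by
    have h2 : ContMDiff 𝓘(ℝ, EuclideanSpace ℝ (Fin 3)) 𝓘(ℝ, ℝ) ∞
      (fun v : EuclideanSpace ℝ (Fin 3) => v k) := ContDiff.contMDiff (by fun_prop)
    rw [extChartAt_source]
    exact h2.comp_contMDiffOn contMDiffOn_extChartAt
  refine (continuousOn_frameD (e := e) (isOpen_extChartAt_source (1 : G)) h1 i).congr ?_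
  intro x hx
  have h3 : MDifferentiableAt (𝓡 3) 𝓘(ℝ, EuclideanSpace ℝ (Fin 3)) (extChartAt (𝓡 3) (1 : G)) x :=
    mdifferentiableAt_extChartAt (by rwa [extChartAt_source] at hx)
  have h4 : HasMFDerivAt 𝓘(ℝ, EuclideanSpace ℝ (Fin 3)) 𝓘(ℝ, ℝ)
      (fun v : EuclideanSpace ℝ (Fin 3) => v k) (extChartAt (𝓡 3) (1 : G) x)
      (EuclideanSpace.proj k : EuclideanSpace ℝ (Fin 3) →L[ℝ] ℝ) :=
    (EuclideanSpace.proj k : EuclideanSpace ℝ (Fin 3) →L[ℝ] ℝ).hasFDerivAt.hasMFDerivAt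
  have h5 : mfderiv (𝓡 3) 𝓘(ℝ, ℝ) (fun x : G => extChartAt (𝓡 3) (1 : G) x k) x = _ :=
    (h4.comp x h3.hasMFDerivAt).mfderiv
  change _ = mfderiv (𝓡 3) 𝓘(ℝ, ℝ) (fun x : G => extChartAt (𝓡 3) (1 : G) x k) x
    (mulInvariantVectorField (e i) x)
  rw [h5]
  rfl

theorem continuousOn_frameDensity :
    ContinuousOn (frameDensity e) (extChartAt (𝓡 3) (1 : G)).source := by
  have h : ContinuousOn (fun x : G => (frameMatrix e x).det) (extChartAt (𝓡 3) (1 : G)).source := by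
    simp only [Matrix.det_apply]
    exact continuousOn_finsetSum _ fun σ _ => ContinuousOn.const_smul
      (continuousOn_finsetProd _ fun k _ => continuousOn_frameMatrix _ _) _
  exact h.abs.inv₀ fun x hx => abs_ne_zero.2 (det_frameMatrix_ne_zero hx)

/-- The matrix of the frame is continuous and invertible on the chart domain, hence its inverse
determinant is bounded on the reference compact set. This makes `frameVolume` a finite multiple of
Haar measure. -/
theorem lintegral_frameDensity_lt_top :
    ∫⁻ y in extChartAt (𝓡 3) (1 : G) '' (refCompact G : Set G),
      ENNReal.ofReal (frameDensity e ((extChartAt (𝓡 3) (1 : G)).symm y)) < ⊤ := by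
  have hsub : (refCompact G : Set G) ⊆ (extChartAt (𝓡 3) (1 : G)).source := by
    rw [extChartAt_source]
    exact (exists_compact_in_chart G).choose_spec
  have hc : IsCompact (extChartAt (𝓡 3) (1 : G) '' (refCompact G : Set G)) :=
    (refCompact G).isCompact.image_of_continuousOn ((continuousOn_extChartAt (1 : G)).mono hsub)
  obtain ⟨C, hC⟩ := (refCompact G).isCompact.bddAbove_image
    ((continuousOn_frameDensity (e := e)).mono hsub)
  calc _ ≤ ∫⁻ y in extChartAt (𝓡 3) (1 : G) '' (refCompact G : Set G), ENNReal.ofReal C := by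
        refine setLIntegral_mono' hc.measurableSet ?_
        rintro _ ⟨x, hx, rfl⟩
        rw [(extChartAt (𝓡 3) (1 : G)).left_inv (hsub hx)]
        exact ENNReal.ofReal_le_ofReal (hC ⟨x, hx, rfl⟩)
    _ < ⊤ := by
        rw [setLIntegral_const]
        exact ENNReal.mul_lt_top ENNReal.ofReal_lt_top hc.measure_lt_top

end Volume

end Bianchi

namespace Bianchi

/-! ### The algebra generated by the frame operators. -/

section Operators

variable {G : Type*} [TopologicalSpace G] [ChartedSpace (EuclideanSpace ℝ (Fin 3)) G] [Group G]
  [LieGroup (𝓡 3) ∞ G] (e : Basis (Fin 3) ℝ (GroupLieAlgebra (𝓡 3) G))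

/-- `e_i` as an operator on smooth functions. -/
def frameOp (i : Fin 3) : Module.End ℝ C^∞⟮𝓡 3, G; 𝓘(ℝ, ℝ), ℝ⟯ where
  toFun F := ⟨frameD e i F, contMDiff_frameD F.contMDiff⟩
  map_add' F H := by
    ext x
    exact frameD_add F.mdifferentiableAt H.mdifferentiableAt
  map_smul' c F := by
    ext x
    exact frameD_const_mul c F.mdifferentiableAt

/-- `e_K` as an operator on smooth functions. -/
def frameOpK {n : ℕ} (K : MultiIndex n) : Module.End ℝ C^∞⟮𝓡 3, G; 𝓘(ℝ, ℝ), ℝ⟯ :=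
  (List.ofFn fun m => frameOp e (K.2 m) ^ (K.1.blocksFun m)).prod

theorem frameOp_pow_apply (i : Fin 3) (j : ℕ) (F : C^∞⟮𝓡 3, G; 𝓘(ℝ, ℝ), ℝ⟯) :
    ⇑((frameOp e i ^ j) F) = (frameD e i)^[j] F := by
  induction j with
  | zero => rfl
  | succ j ih =>
    rw [pow_succ', Function.iterate_succ_apply', ← ih]
    rfl

theorem frameOpK_apply {n : ℕ} (K : MultiIndex n) (F : C^∞⟮𝓡 3, G; 𝓘(ℝ, ℝ), ℝ⟯) :
    ⇑(frameOpK e K F) = frameDK e K F := by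
  have h : ∀ L : List (Fin 3 × ℕ), ⇑((L.map fun p => frameOp e p.1 ^ p.2).prod F)
      = L.foldr (fun p H => (frameD e p.1)^[p.2] H) F := by
    intro L
    induction L with
    | nil => rfl
    | cons p L ih =>
      rw [List.map_cons, List.prod_cons, List.foldr_cons, ← ih]
      exact frameOp_pow_apply e p.1 p.2 _
  have := h (List.ofFn fun m => (K.2 m, K.1.blocksFun m))
  rw [List.map_ofFn] at this
  exact this

theorem frameOp_comm (i j : Fin 3) :
    frameOp e i * frameOp e j - frameOp e j * frameOp e i
      = ∑ k, structConst e i j k • frameOp e k := by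
  ext F x
  have h : ∀ c : Fin 3 → ℝ, (∑ k, c k • frameOp e k) F x = ∑ k, c k * frameD e k F x := by
    intro c
    simp [Fin.sum_univ_three]
    rfl
  rw [h]
  exact frameD_comm F.contMDiff i j x

/-- The span of the operators `e_i`. -/
def frameSpan : Submodule ℝ (Module.End ℝ C^∞⟮𝓡 3, G; 𝓘(ℝ, ℝ), ℝ⟯) :=
  Submodule.span ℝ (range (frameOp e))

theorem frameOp_mem (i : Fin 3) : frameOp e i ∈ frameSpan e := Submodule.subset_span ⟨i, rfl⟩

theorem frameOp_commutator_mem_frameSpan (i : Fin 3) {D : Module.End ℝ C^∞⟮𝓡 3, G; 𝓘(ℝ, ℝ), ℝ⟯}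
    (hD : D ∈ frameSpan e) : frameOp e i * D - D * frameOp e i ∈ frameSpan e := by
  induction hD using Submodule.span_induction with
  | mem x hx =>
    obtain ⟨j, rfl⟩ := hx
    rw [frameOp_comm]
    exact Submodule.sum_mem _ fun k _ => Submodule.smul_mem _ _ (frameOp_mem e k)
  | zero => simp
  | add x y _ _ hx hy =>
    have : frameOp e i * (x + y) - (x + y) * frameOp e i
      = (frameOp e i * x - x * frameOp e i) + (frameOp e i * y - y * frameOp e i) := by noncomm_ring
    rw [this]
    exact Submodule.add_mem _ hx hy
  | smul c x _ hx =>
    rw [mul_smul_comm, smul_mul_assoc, ← smul_sub]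
    exact Submodule.smul_mem _ _ hx

/-- The commutator with e_i is a derivation that maps the span V of the frame into itself, hence
maps V^n into V^n. So commuting e_i with e_K does not raise the order beyond |K|. -/
theorem frameOp_commutator_mem_pow (i : Fin 3) (n : ℕ)
    {D : Module.End ℝ C^∞⟮𝓡 3, G; 𝓘(ℝ, ℝ), ℝ⟯} (hD : D ∈ frameSpan e ^ n) :
    frameOp e i * D - D * frameOp e i ∈ frameSpan e ^ n := by
  induction n generalizing D with
  | zero =>
    rw [Submodule.pow_zero, Submodule.mem_one] at hD
    obtain ⟨c, rfl⟩ := hD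
    rw [Algebra.commutes, sub_self]
    exact Submodule.zero_mem _
  | succ n ih =>
    rw [Submodule.pow_succ] at hD ⊢
    refine Submodule.mul_induction_on hD (fun x hx y hy => ?_) fun x y hx hy => ?_
    · have : frameOp e i * (x * y) - x * y * frameOp e i
        = (frameOp e i * x - x * frameOp e i) * y + x * (frameOp e i * y - y * frameOp e i) := by
        rw [mul_sub, sub_mul]
        simp only [mul_assoc]
        abel
      rw [this]
      exact Submodule.add_mem _ (Submodule.mul_mem_mul (ih hx) hy)
        (Submodule.mul_mem_mul hx (frameOp_commutator_mem_frameSpan e i hy))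
    · have : frameOp e i * (x + y) - (x + y) * frameOp e i
        = (frameOp e i * x - x * frameOp e i) + (frameOp e i * y - y * frameOp e i) := by
        noncomm_ring
      rw [this]
      exact Submodule.add_mem _ hx hy

theorem frameOpK_mem_pow {n : ℕ} (K : MultiIndex n) : frameOpK e K ∈ frameSpan e ^ n := by
  have h : ∀ L : List (Fin 3 × ℕ), (L.map fun p => frameOp e p.1 ^ p.2).prod
      ∈ frameSpan e ^ (L.map Prod.snd).sum := by
    intro L
    induction L with
    | nil => exact Submodule.one_le.1 le_rfl
    | cons p L ih =>
      simp only [List.map_cons, List.prod_cons, List.sum_cons]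
      have hadd : frameSpan e ^ (p.2 + (L.map Prod.snd).sum)
        = frameSpan e ^ p.2 * frameSpan e ^ (L.map Prod.snd).sum := by
        rcases eq_or_ne (L.map Prod.snd).sum 0 with h0 | h0
        · rw [h0, Submodule.pow_zero, add_zero, Submodule.mul_one]
        · exact Submodule.pow_add _ h0
      rw [hadd]
      exact Submodule.mul_mem_mul (Submodule.pow_mem_pow _ (frameOp_mem e p.1) _) ih
  have := h (List.ofFn fun m => (K.2 m, K.1.blocksFun m))
  rw [List.map_ofFn, List.map_ofFn, List.sum_ofFn] at this
  have hs : ∑ i, (Prod.snd ∘ fun m => (K.2 m, K.1.blocksFun m)) i = n := K.1.sum_blocksFun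
  rw [hs] at this
  exact this

theorem frameSpan_pow_le (n : ℕ) :
    frameSpan e ^ n ≤ Submodule.span ℝ (range fun K : MultiIndex n => frameOpK e K) := by
  rw [frameSpan, Submodule.span_pow]
  refine Submodule.span_mono ?_
  intro D hD
  obtain ⟨c, rfl⟩ := Set.mem_pow.1 hD
  choose d hd using fun k => (c k).2
  -- The composition 1 + ⋯ + 1 of n encodes an arbitrary word e_{d_1} ⋯ e_{d_n}.
  refine ⟨⟨Composition.ones n, fun m => d (Fin.cast (Composition.ones_length n) m)⟩, ?_⟩
  simp only [frameOpK]
  congr 1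
  refine List.ext_getElem (by simp) fun k h1 h2 => ?_
  simp [hd]

/-- Moving e_K past e_i e_j produces both the commutators of e_i with e_K, with coefficients α, and
the double commutators, with coefficients β. All of them stay in the span of the e_L with |L| = |K|,
and the coefficients depend on the frame alone. -/
theorem exists_commutator_coeff {n : ℕ} (K : MultiIndex n) :
    ∃ (α : Fin 3 → MultiIndex n → ℝ) (β : Fin 3 → Fin 3 → MultiIndex n → ℝ),
      (∀ i, frameOp e i * frameOpK e K - frameOpK e K * frameOp e i
        = ∑ L, α i L • frameOpK e L) ∧
      ∀ i j, frameOp e j * (∑ L, α i L • frameOpK e L) - (∑ L, α i L • frameOpK e L) * frameOp e j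
        = ∑ L, β i j L • frameOpK e L := by
  have h : ∀ D ∈ frameSpan e ^ n, ∃ c : MultiIndex n → ℝ, D = ∑ L, c L • frameOpK e L := by
    intro D hD
    obtain ⟨c, hc⟩ := (Submodule.mem_span_range_iff_exists_fun ℝ).1 (frameSpan_pow_le e n hD)
    exact ⟨c, hc.symm⟩
  choose α hα using fun i => h _ (frameOp_commutator_mem_pow e i n (frameOpK_mem_pow e K))
  choose β hβ using fun i j => h _ (frameOp_commutator_mem_pow e j n
    (frameOp_commutator_mem_pow e i n (frameOpK_mem_pow e K)))
  refine ⟨α, β, hα, fun i j => ?_⟩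
  rw [← hα, hβ]

end Operators

end Bianchi

namespace Bianchi

/-! ### Quadratic forms bounded by c², and an algebraic commutator identity. -/

section Forms

/-- The bilinear form `A^{ij} η_i ξ_j`. -/
def bil (A : Matrix (Fin 3) (Fin 3) ℝ) (η ξ : Fin 3 → ℝ) : ℝ := ∑ i, ∑ j, A i j * η i * ξ j

/-- `A` is symmetric and non-negative, and its norm is at most `c ^ 2`. -/
structure FormBound (A : Matrix (Fin 3) (Fin 3) ℝ) (c : ℝ) : Prop where
  symm : ∀ i j, A i j = A j i
  nonneg : ∀ ξ, 0 ≤ bil A ξ ξ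
  le : ∀ ξ, bil A ξ ξ ≤ c ^ 2 * ∑ i, ξ i ^ 2
  bound_nonneg : 0 ≤ c

variable {A : Matrix (Fin 3) (Fin 3) ℝ} {c : ℝ}

theorem FormBound.bil_comm (h : FormBound A c) (η ξ : Fin 3 → ℝ) : bil A η ξ = bil A ξ η := by
  unfold bil
  rw [Finset.sum_comm]
  refine Finset.sum_congr rfl fun i _ => Finset.sum_congr rfl fun j _ => ?_
  rw [h.symm j i]
  ring

/-- Cauchy–Schwarz from the discriminant of the quadratic polynomial s ↦ A(η + sξ, η + sξ), for
which semidefiniteness suffices. -/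
theorem FormBound.abs_bil_le_sqrt (h : FormBound A c) (η ξ : Fin 3 → ℝ) :
    |bil A η ξ| ≤ √(bil A η η) * √(bil A ξ ξ) := by
  have hexp : ∀ s : ℝ, bil A (fun i => η i + s * ξ i) (fun i => η i + s * ξ i)
      = bil A ξ ξ * (s * s) + 2 * bil A η ξ * s + bil A η η := by
    intro s
    have h1 : bil A (fun i => η i + s * ξ i) (fun i => η i + s * ξ i)
      = bil A η η + s * bil A η ξ + s * bil A ξ η + s ^ 2 * bil A ξ ξ := by
      simp only [bil, Finset.mul_sum, ← Finset.sum_add_distrib]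
      exact Finset.sum_congr rfl fun i _ => Finset.sum_congr rfl fun j _ => by ring
    rw [h1, h.bil_comm ξ η]
    ring
  have hd := discrim_le_zero (a := bil A ξ ξ) (b := 2 * bil A η ξ) (c := bil A η η)
    fun s => by rw [← hexp]; exact h.nonneg _
  rw [discrim] at hd
  rw [← Real.sqrt_mul (h.nonneg η)]
  refine Real.abs_le_sqrt ?_
  nlinarith

theorem FormBound.abs_bil_le (h : FormBound A c) (η ξ : Fin 3 → ℝ) :
    |bil A η ξ| ≤ c * √(∑ i, η i ^ 2) * √(bil A ξ ξ) := by
  refine (h.abs_bil_le_sqrt η ξ).trans (mul_le_mul_of_nonneg_right ?_ (Real.sqrt_nonneg _))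
  rw [Real.sqrt_le_left (mul_nonneg h.bound_nonneg (Real.sqrt_nonneg _)), mul_pow,
    Real.sq_sqrt (Finset.sum_nonneg fun i _ => sq_nonneg _)]
  exact h.le η

theorem bil_single (A : Matrix (Fin 3) (Fin 3) ℝ) (i j : Fin 3) :
    bil A (Pi.single i 1) (Pi.single j 1) = A i j := by
  simp [bil, Pi.single_apply]

theorem FormBound.abs_entry_le (h : FormBound A c) (i j : Fin 3) : |A i j| ≤ c ^ 2 := by
  have hs : ∀ k : Fin 3, ∑ i, (Pi.single k (1 : ℝ) : Fin 3 → ℝ) i ^ 2 = 1 := fun k => by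
    simp [Pi.single_apply]
  have h1 := h.abs_bil_le (Pi.single i 1) (Pi.single j 1)
  rw [bil_single, bil_single, hs, Real.sqrt_one, mul_one] at h1
  have h2 := h.le (Pi.single j 1)
  rw [bil_single, hs, mul_one] at h2
  calc |A i j| ≤ c * √(A j j) := h1
    _ ≤ c * c := mul_le_mul_of_nonneg_left (Real.sqrt_le_iff.2 ⟨h.bound_nonneg, h2⟩) h.bound_nonneg
    _ = c ^ 2 := by ring

end Forms

/-- With S_i = [E_i, P] one has [P, E_i E_j] = -S_i E_j - E_i S_j, and bringing E_j to the left of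
S_i costs the double commutator. In the resulting form every term is some Q_L or a single E_i
applied to it, which is what an energy density of the same order controls. -/
theorem commutator_quadratic {R ι : Type*} [Ring R] [Algebra ℝ R] [Fintype ι] (E : Fin 3 → R)
    (P : R) (Q : ι → R) (A : Matrix (Fin 3) (Fin 3) ℝ) (ν : Fin 3 → ℝ) {α : Fin 3 → ι → ℝ}
    {β : Fin 3 → Fin 3 → ι → ℝ} (hα : ∀ i, E i * P - P * E i = ∑ L, α i L • Q L)
    (hβ : ∀ i j, E j * (∑ L, α i L • Q L) - (∑ L, α i L • Q L) * E j = ∑ L, β i j L • Q L) :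
    P * (∑ i, ∑ j, A i j • (E i * E j - ν i • E j))
        - (∑ i, ∑ j, A i j • (E i * E j - ν i • E j)) * P
      = ∑ i, ∑ j, A i j • ∑ L, ((β i j L + ν i * α j L) • Q L
          - α j L • (E i * Q L) - α i L • (E j * Q L)) := by
  simp only [Finset.mul_sum, Finset.sum_mul, ← Finset.sum_sub_distrib]
  refine Finset.sum_congr rfl fun i _ => Finset.sum_congr rfl fun j _ => ?_
  rw [mul_smul_comm, smul_mul_assoc, ← smul_sub]
  congr 1
  simp only [Finset.sum_sub_distrib, add_smul, mul_smul, Finset.sum_add_distrib, ← Finset.smul_sum,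
    ← mul_smul_comm, ← Finset.mul_sum, ← hβ, ← hα]
  simp only [mul_sub, sub_mul, smul_sub, mul_smul_comm, smul_mul_assoc, mul_assoc]
  abel

section EndApply

variable {G : Type*} [TopologicalSpace G] [ChartedSpace (EuclideanSpace ℝ (Fin 3)) G]

theorem sum_end_apply {ι : Type*} (s : Finset ι)
    (D : ι → Module.End ℝ C^∞⟮𝓡 3, G; 𝓘(ℝ, ℝ), ℝ⟯) (F : C^∞⟮𝓡 3, G; 𝓘(ℝ, ℝ), ℝ⟯) (x : G) :
    (∑ k ∈ s, D k) F x = ∑ k ∈ s, D k F x := by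
  classical
  induction s using Finset.induction_on with
  | empty => rfl
  | insert a s ha ih =>
    rw [Finset.sum_insert ha, Finset.sum_insert ha, ← ih]
    rfl

theorem smul_end_apply (c : ℝ) (D : Module.End ℝ C^∞⟮𝓡 3, G; 𝓘(ℝ, ℝ), ℝ⟯)
    (F : C^∞⟮𝓡 3, G; 𝓘(ℝ, ℝ), ℝ⟯) (x : G) : (c • D) F x = c * D F x := rfl

theorem sub_end_apply (D D' : Module.End ℝ C^∞⟮𝓡 3, G; 𝓘(ℝ, ℝ), ℝ⟯)
    (F : C^∞⟮𝓡 3, G; 𝓘(ℝ, ℝ), ℝ⟯) (x : G) : (D - D') F x = D F x - D' F x := rfl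

end EndApply

/-! ### Commutators of e_K with the spatial wave operator. -/

section Commutator

variable {G : Type*} [TopologicalSpace G] [ChartedSpace (EuclideanSpace ℝ (Fin 3)) G] [Group G]
  [LieGroup (𝓡 3) ∞ G] (e : Basis (Fin 3) ℝ (GroupLieAlgebra (𝓡 3) G))

/-- The spatial part `A^{ij} (e_i e_j - ν_i e_j)` of the wave operator. -/
def waveOp (A : Matrix (Fin 3) (Fin 3) ℝ) (ν : Fin 3 → ℝ) :
    Module.End ℝ C^∞⟮𝓡 3, G; 𝓘(ℝ, ℝ), ℝ⟯ :=
  ∑ i, ∑ j, A i j • (frameOp e i * frameOp e j - ν i • frameOp e j)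

theorem frameOp_mul_apply (i : Fin 3) (D : Module.End ℝ C^∞⟮𝓡 3, G; 𝓘(ℝ, ℝ), ℝ⟯)
    (F : C^∞⟮𝓡 3, G; 𝓘(ℝ, ℝ), ℝ⟯) (x : G) : (frameOp e i * D) F x = frameD e i (D F) x := rfl

theorem waveOp_apply (A : Matrix (Fin 3) (Fin 3) ℝ) (ν : Fin 3 → ℝ)
    (F : C^∞⟮𝓡 3, G; 𝓘(ℝ, ℝ), ℝ⟯) (x : G) :
    waveOp e A ν F x = (∑ i, ∑ j, A i j * frameD e i (frameD e j F) x)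
      - bil A ν (fun j => frameD e j F x) := by
  simp only [waveOp, sum_end_apply, smul_end_apply, sub_end_apply, bil, ← Finset.sum_sub_distrib]
  refine Finset.sum_congr rfl fun i _ => Finset.sum_congr rfl fun j _ => ?_
  rw [frameOp_mul_apply, mul_sub, ← mul_assoc]
  rfl

theorem commutator_waveOp {n : ℕ} (K : MultiIndex n) (A : Matrix (Fin 3) (Fin 3) ℝ)
    (ν : Fin 3 → ℝ) {α : Fin 3 → MultiIndex n → ℝ} {β : Fin 3 → Fin 3 → MultiIndex n → ℝ}
    (hα : ∀ i, frameOp e i * frameOpK e K - frameOpK e K * frameOp e i = ∑ L, α i L • frameOpK e L)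
    (hβ : ∀ i j, frameOp e j * (∑ L, α i L • frameOpK e L)
      - (∑ L, α i L • frameOpK e L) * frameOp e j = ∑ L, β i j L • frameOpK e L) :
    frameOpK e K * waveOp e A ν - waveOp e A ν * frameOpK e K
      = ∑ i, ∑ j, A i j • ∑ L, ((β i j L + ν i * α j L) • frameOpK e L
          - α j L • (frameOp e i * frameOpK e L) - α i L • (frameOp e j * frameOpK e L)) :=
  commutator_quadratic (frameOp e) (frameOpK e K) (frameOpK e) A ν hα hβ

/-- The point is uniformity in A: α, β and ν are constants, so time dependence enters only through
A. Its size c² splits by Cauchy–Schwarz as c times the A-norm of the gradient in the first order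
terms, and remains whole in the terms without a further derivative. -/
theorem exists_commutator_bound {n : ℕ} (K : MultiIndex n) (ν : Fin 3 → ℝ) :
    ∃ C, 0 ≤ C ∧ ∀ A c, FormBound A c → ∀ (F : C^∞⟮𝓡 3, G; 𝓘(ℝ, ℝ), ℝ⟯) (x : G),
      |frameOpK e K (waveOp e A ν F) x - waveOp e A ν (frameOpK e K F) x|
        ≤ C * c * ∑ L : MultiIndex n, (√(bil A (fun i => frameD e i (frameOpK e L F) x)
          (fun i => frameD e i (frameOpK e L F) x)) + c * |frameOpK e L F x|) := by
  obtain ⟨α, β, hα, hβ⟩ := exists_commutator_coeff e K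
  let B : MultiIndex n → ℝ := fun L =>
    2 * √(∑ i, α i L ^ 2) + ∑ i, ∑ j, |β i j L + ν i * α j L|
  have hB : ∀ L, 0 ≤ B L := fun L => by positivity
  refine ⟨∑ L, B L, Finset.sum_nonneg fun L _ => hB L, fun A c hA F x => ?_⟩
  have h1 : frameOpK e K (waveOp e A ν F) x - waveOp e A ν (frameOpK e K F) x
      = (frameOpK e K * waveOp e A ν - waveOp e A ν * frameOpK e K) F x := rfl
  have h2 : (frameOpK e K * waveOp e A ν - waveOp e A ν * frameOpK e K) F x
      = ∑ L, ((∑ i, ∑ j, A i j * (β i j L + ν i * α j L)) * frameOpK e L F x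
        - 2 * bil A (fun i => α i L) (fun i => frameD e i (frameOpK e L F) x)) := by
    rw [commutator_waveOp e K A ν hα hβ]
    simp only [sum_end_apply, smul_end_apply, sub_end_apply, frameOp_mul_apply, Finset.mul_sum]
    rw [Finset.sum_congr rfl fun i _ => Finset.sum_comm, Finset.sum_comm]
    refine Finset.sum_congr rfl fun L _ => ?_
    rw [two_mul]
    nth_rewrite 1 [hA.bil_comm]
    simp only [bil, Finset.sum_mul, ← Finset.sum_add_distrib, ← Finset.sum_sub_distrib]
    exact Finset.sum_congr rfl fun i _ => Finset.sum_congr rfl fun j _ => by ring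
  rw [h1, h2]
  refine (Finset.abs_sum_le_sum_abs _ _).trans ?_
  rw [Finset.mul_sum]
  refine Finset.sum_le_sum fun L _ => ?_
  set s := √(bil A (fun i => frameD e i (frameOpK e L F) x)
          (fun i => frameD e i (frameOpK e L F) x))
  have hs : 0 ≤ s := Real.sqrt_nonneg _
  have hc := hA.bound_nonneg
  have h3 : |∑ i, ∑ j, A i j * (β i j L + ν i * α j L)|
      ≤ c ^ 2 * ∑ i, ∑ j, |β i j L + ν i * α j L| := by
    rw [Finset.mul_sum]
    refine (Finset.abs_sum_le_sum_abs _ _).trans (Finset.sum_le_sum fun i _ => ?_)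
    rw [Finset.mul_sum]
    refine (Finset.abs_sum_le_sum_abs _ _).trans (Finset.sum_le_sum fun j _ => ?_)
    rw [abs_mul]
    exact mul_le_mul_of_nonneg_right (hA.abs_entry_le i j) (abs_nonneg _)
  have h4 := hA.abs_bil_le (fun i => α i L) (fun i => frameD e i (frameOpK e L F) x)
  have h5 : B L ≤ ∑ L, B L := Finset.single_le_sum (fun L _ => hB L) (Finset.mem_univ L)
  set b := ∑ i, ∑ j, |β i j L + ν i * α j L| with hb
  have hb0 : 0 ≤ b := by positivity
  have ha0 : 0 ≤ √(∑ i, α i L ^ 2) := Real.sqrt_nonneg _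
  have hBL : B L = 2 * √(∑ i, α i L ^ 2) + b := rfl
  have hF0 := abs_nonneg (frameOpK e L F x)
  calc _ ≤ |(∑ i, ∑ j, A i j * (β i j L + ν i * α j L))| * |frameOpK e L F x|
          + 2 * |bil A (fun i => α i L) (fun i => frameD e i (frameOpK e L F) x)| := by
        refine (abs_sub _ _).trans_eq ?_
        rw [abs_mul, abs_mul, abs_two]
    _ ≤ c ^ 2 * b * |frameOpK e L F x| + 2 * (c * √(∑ i, α i L ^ 2) * s) := by
        gcongr
    _ ≤ B L * c * (s + c * |frameOpK e L F x|) := by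
        rw [hBL]
        have : 0 ≤ b * c * s := by positivity
        have : 0 ≤ √(∑ i, α i L ^ 2) * c * (c * |frameOpK e L F x|) := by positivity
        nlinarith
    _ ≤ _ := by gcongr

end Commutator

end Bianchi

/-! ### The pointwise energy inequality. -/

namespace Bianchi

/-- The energy density `(p² + A^{ij} ξ_i ξ_j + c² w²) / 2`. -/
def dens (A : Matrix (Fin 3) (Fin 3) ℝ) (c p : ℝ) (ξ : Fin 3 → ℝ) (w : ℝ) : ℝ :=
  1 / 2 * (p ^ 2 + bil A ξ ξ + c ^ 2 * w ^ 2)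

theorem FormBound.dens_nonneg {A : Matrix (Fin 3) (Fin 3) ℝ} {c : ℝ} (h : FormBound A c) (p : ℝ)
    (ξ : Fin 3 → ℝ) (w : ℝ) : 0 ≤ dens A c p ξ w := by
  have := h.nonneg ξ
  unfold dens
  positivity

/-- For a solution w, the letters p, p2, ξ, η, Ξ stand for w_τ, w_ττ, e_i w, e_i w_τ, e_i e_j w, and
χt, g for the time derivative and gradient of the weight χ. The right side is the time derivative of
the weighted density, minus the divergence of the flux, plus the κ-correction that makes the two
added terms integrate to zero. The terms with η and Ξ cancel identically; `hflux` absorbs g; the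
first order terms combine into A(κ - ν, ξ), of size 𝔣 times the density. -/
theorem energy_pointwise {A A' : Matrix (Fin 3) (Fin 3) ℝ} {f f' b φ γ χ χt p p2 w R : ℝ}
    {ξ η g κ ν : Fin 3 → ℝ} {Ξ : Fin 3 → Fin 3 → ℝ} (hA : FormBound A f) (hf' : 0 ≤ f')
    (hχ : 0 ≤ χ) (hγ : 0 ≤ γ) (hb : -(3 * γ) ≤ b)
    (hA' : -(3 / 2 * γ * bil A ξ ξ) ≤ 1 / 2 * bil A' ξ ξ + b * bil A ξ ξ) (hφ : |φ| ≤ f ^ 2)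
    (hpde : p2 = -b * p + (∑ i, ∑ j, A i j * Ξ i j) - bil A ν ξ + φ * w + R)
    (hflux : |p * bil A g ξ| ≤ χt * dens A f p ξ w) :
    -((2 * b + 6 * γ + (√(∑ i, (κ i - ν i) ^ 2) + 2) * f) * (χ * dens A f p ξ w))
        - χ * (|R| * |p|)
      ≤ χt * dens A f p ξ w
        + χ * (p * p2 + bil A η ξ + 1 / 2 * bil A' ξ ξ + f * f' * w ^ 2 + f ^ 2 * (w * p))
        - ∑ i, ∑ j, A i j * (g i * (p * ξ j) + χ * (η i * ξ j + p * Ξ i j))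
        + ∑ i, κ i * ∑ j, A i j * (χ * (p * ξ j)) := by
  have e1 : ∑ i, ∑ j, A i j * (g i * (p * ξ j) + χ * (η i * ξ j + p * Ξ i j))
      = p * bil A g ξ + χ * bil A η ξ + χ * (p * ∑ i, ∑ j, A i j * Ξ i j) := by
    simp only [bil, Finset.mul_sum, ← Finset.sum_add_distrib]
    exact Finset.sum_congr rfl fun i _ => Finset.sum_congr rfl fun j _ => by ring
  have e2 : ∑ i, κ i * ∑ j, A i j * (χ * (p * ξ j)) = χ * (p * bil A κ ξ) := by
    simp only [bil, Finset.mul_sum]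
    exact Finset.sum_congr rfl fun i _ => Finset.sum_congr rfl fun j _ => by ring
  have e3 : bil A κ ξ - bil A ν ξ = bil A (fun i => κ i - ν i) ξ := by
    simp only [bil, ← Finset.sum_sub_distrib]
    exact Finset.sum_congr rfl fun i _ => Finset.sum_congr rfl fun j _ => by ring
  set d := dens A f p ξ w with hd
  have hd2 : 2 * d = p ^ 2 + bil A ξ ξ + f ^ 2 * w ^ 2 := by rw [hd, dens]; ring
  set m := √(∑ i, (κ i - ν i) ^ 2)
  have hm : 0 ≤ m := Real.sqrt_nonneg _
  have hf : 0 ≤ f := hA.bound_nonneg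
  have hξ := hA.nonneg ξ
  have hsq := Real.sq_sqrt hξ
  have h1 : -(m * f * d) ≤ p * bil A (fun i => κ i - ν i) ξ := by
    have h := hA.abs_bil_le (fun i => κ i - ν i) ξ
    have h2 : |p * bil A (fun i => κ i - ν i) ξ| ≤ |p| * (f * m * √(bil A ξ ξ)) := by
      rw [abs_mul]
      exact mul_le_mul_of_nonneg_left h (abs_nonneg _)
    have h3 : |p| * √(bil A ξ ξ) ≤ d := by
      have := sq_abs p
      have : 0 ≤ f ^ 2 * w ^ 2 := by positivity
      nlinarith [sq_nonneg (|p| - √(bil A ξ ξ))]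
    have h4 : |p| * (f * m * √(bil A ξ ξ)) ≤ m * f * d := by
      calc |p| * (f * m * √(bil A ξ ξ)) = m * f * (|p| * √(bil A ξ ξ)) := by ring
        _ ≤ m * f * d := by gcongr
    linarith [neg_abs_le (p * bil A (fun i => κ i - ν i) ξ)]
  -- Needed for two cross terms: φ w p from the equation, and f² w p from differentiating f² w².
  have h2 : ∀ a : ℝ, |a| ≤ f ^ 2 → -(f * d) ≤ a * (w * p) := by
    intro a ha
    have h3 : |a * (w * p)| ≤ f ^ 2 * (|w| * |p|) := by
      rw [abs_mul, abs_mul]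
      exact mul_le_mul_of_nonneg_right ha (by positivity)
    have h4 : f * (|w| * |p|) ≤ d := by
      have := sq_abs p
      have := sq_abs w
      nlinarith [sq_nonneg (f * |w| - |p|)]
    have h5 : f ^ 2 * (|w| * |p|) ≤ f * d := by
      calc f ^ 2 * (|w| * |p|) = f * (f * (|w| * |p|)) := by ring
        _ ≤ f * d := by gcongr
    linarith [neg_abs_le (a * (w * p))]
  have h3 := h2 φ hφ
  have h4 := h2 (f ^ 2) (by rw [abs_of_nonneg (sq_nonneg f)])
  have h5 : -(|R| * |p|) ≤ R * p := by
    rw [← abs_mul]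
    exact neg_abs_le _
  have h6 : 0 ≤ f * f' * w ^ 2 := by positivity
  -- The damping -b p² cancels against the kinetic part of 2b·d. The gradient part is exactly `hA'`,
  -- and the part with w² uses only b ≥ -3γ.
  have h7 : -(6 * γ * d) ≤ -b * p ^ 2 + 1 / 2 * bil A' ξ ξ + 2 * b * d := by
    have hw : 0 ≤ f ^ 2 * w ^ 2 := by positivity
    have h8 : 2 * b * d = b * p ^ 2 + b * bil A ξ ξ + b * (f ^ 2 * w ^ 2) := by
      rw [mul_assoc, mul_left_comm, hd2]; ring
    have h9 : -(3 * γ) * (f ^ 2 * w ^ 2) ≤ b * (f ^ 2 * w ^ 2) := mul_le_mul_of_nonneg_right hb hw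
    have h10 : 6 * γ * d = 3 * γ * (p ^ 2) + 3 * γ * bil A ξ ξ + 3 * γ * (f ^ 2 * w ^ 2) := by
      have : 6 * γ * d = 3 * γ * (2 * d) := by ring
      rw [this, hd2]; ring
    have h11 : 0 ≤ γ * p ^ 2 := by positivity
    have h12 : 0 ≤ γ * bil A ξ ξ := by positivity
    linarith
  have h8 : -((2 * b + 6 * γ + (m + 2) * f) * d) - |R| * |p|
      ≤ -b * p ^ 2 + p * bil A (fun i => κ i - ν i) ξ + φ * (w * p) + R * p + 1 / 2 * bil A' ξ ξ
        + f * f' * w ^ 2 + f ^ 2 * (w * p) := by linarith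
  have h9 := mul_le_mul_of_nonneg_left h8 hχ
  have h10 : p * bil A g ξ ≤ χt * d := (le_abs_self _).trans hflux
  rw [e1, e2, hpde]
  rw [← e3] at h9
  linarith

/-- The coefficients of the wave equation in the time coordinate `τ ≤ 0`, with the bounds on which
the energy estimates rest. -/
structure WaveCoeff (A A' : ℝ → Matrix (Fin 3) (Fin 3) ℝ) (b φ γ f f' : ℝ → ℝ) : Prop where
  form : ∀ τ ≤ 0, FormBound (A τ) (f τ)
  hasDerivAt_A : ∀ τ ≤ 0, ∀ i j, HasDerivAt (fun s => A s i j) (A' τ i j) τ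
  continuousOn_A' : ∀ i j, ContinuousOn (fun s => A' s i j) (Iic 0)
  hasDerivAt_f : ∀ τ < 0, HasDerivAt f (f' τ) τ
  continuousOn_f : ContinuousOn f (Iic 0)
  continuousOn_f' : ContinuousOn f' (Iio 0)
  f'_nonneg : ∀ τ < 0, 0 ≤ f' τ
  continuousOn_b : ContinuousOn b (Iic 0)
  continuousOn_γ : ContinuousOn γ (Iic 0)
  γ_nonneg : ∀ τ ≤ 0, 0 ≤ γ τ
  b_ge : ∀ τ ≤ 0, -(3 * γ τ) ≤ b τ
  A'_ge : ∀ τ ≤ 0, ∀ ξ, -(3 / 2 * γ τ * bil (A τ) ξ ξ)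
    ≤ 1 / 2 * bil (A' τ) ξ ξ + b τ * bil (A τ) ξ ξ
  abs_φ_le : ∀ τ ≤ 0, |φ τ| ≤ f τ ^ 2

end Bianchi

namespace Bianchi

/-! ### Regularity of the weighted energy density. -/

section WeightedEnergy

variable {G : Type*} [TopologicalSpace G] [ChartedSpace (EuclideanSpace ℝ (Fin 3)) G] [Group G]

/-- The components `e_i(w)` of the spatial gradient. -/
def grad (e : Basis (Fin 3) ℝ (GroupLieAlgebra (𝓡 3) G)) (w : G → ℝ → ℝ) (x : G) (τ : ℝ)
    (i : Fin 3) : ℝ := frameD e i (fun y => w y τ) x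

/-- The energy density of `w`. -/
def waveDens (e : Basis (Fin 3) ℝ (GroupLieAlgebra (𝓡 3) G)) (A : ℝ → Matrix (Fin 3) (Fin 3) ℝ)
    (f : ℝ → ℝ) (w : G → ℝ → ℝ) (x : G) (τ : ℝ) : ℝ :=
  dens (A τ) (f τ) (deriv (w x) τ) (grad e w x τ) (w x τ)

/-- `w` solves the wave equation with coefficients `A`, `b`, `φ`, `ν` and source `R`, for
`τ ≤ 0`. -/
def IsWave (e : Basis (Fin 3) ℝ (GroupLieAlgebra (𝓡 3) G)) (A : ℝ → Matrix (Fin 3) (Fin 3) ℝ)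
    (b φ : ℝ → ℝ) (ν : Fin 3 → ℝ) (w R : G → ℝ → ℝ) : Prop :=
  ∀ x, ∀ τ ≤ 0, deriv (deriv (w x)) τ = -b τ * deriv (w x) τ
    + (∑ i, ∑ j, A τ i j * frameD e i (frameD e j fun y => w y τ) x)
    - bil (A τ) ν (grad e w x τ) + φ τ * w x τ + R x τ

variable [LieGroup (𝓡 3) ∞ G] {e : Basis (Fin 3) ℝ (GroupLieAlgebra (𝓡 3) G)}
  {A A' : ℝ → Matrix (Fin 3) (Fin 3) ℝ} {b φ γ f f' : ℝ → ℝ} {J : Set ℝ} {w χ : G → ℝ → ℝ}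

/-- The time derivative of the weighted energy density. -/
def waveDensDeriv (e : Basis (Fin 3) ℝ (GroupLieAlgebra (𝓡 3) G))
    (A A' : ℝ → Matrix (Fin 3) (Fin 3) ℝ) (f f' : ℝ → ℝ) (χ w : G → ℝ → ℝ) (x : G) (τ : ℝ) : ℝ :=
  deriv (χ x) τ * waveDens e A f w x τ
    + χ x τ * (deriv (w x) τ * deriv (deriv (w x)) τ
      + bil (A τ) (grad e (fun y => deriv (w y)) x τ) (grad e w x τ)
      + 1 / 2 * bil (A' τ) (grad e w x τ) (grad e w x τ) + f τ * f' τ * w x τ ^ 2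
      + f τ ^ 2 * (w x τ * deriv (w x) τ))

theorem continuousOn_time {X : Type*} [TopologicalSpace X] {c : ℝ → ℝ} {S : Set ℝ}
    (hc : ContinuousOn c S) : ContinuousOn (fun p : X × ℝ => c p.2) (univ ×ˢ S) :=
  hc.comp continuousOn_snd fun _ hp => hp.2

theorem SmoothOn.continuousOn_grad (hw : SmoothOn J w) (hJ : IsOpen J) (i : Fin 3) :
    ContinuousOn (fun p : G × ℝ => grad e w p.1 p.2 i) (univ ×ˢ J) :=
  (hw.frameD (e := e) hJ i).continuousOn

theorem continuousOn_bil {X : Type*} [TopologicalSpace X] {S : Set ℝ} {B : ℝ → Matrix (Fin 3) (Fin 3) ℝ}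
    (hB : ∀ i j, ContinuousOn (fun s => B s i j) S) {ξ η : X → ℝ → Fin 3 → ℝ}
    (hξ : ∀ i, ContinuousOn (fun p : X × ℝ => ξ p.1 p.2 i) (univ ×ˢ S))
    (hη : ∀ i, ContinuousOn (fun p : X × ℝ => η p.1 p.2 i) (univ ×ˢ S)) :
    ContinuousOn (fun p : X × ℝ => bil (B p.2) (ξ p.1 p.2) (η p.1 p.2)) (univ ×ˢ S) := by
  unfold bil
  exact continuousOn_finsetSum _ fun i _ => continuousOn_finsetSum _ fun j _ =>
    ((continuousOn_time (hB i j)).mul (hξ i)).mul (hη j)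

theorem WaveCoeff.continuousOn_A (hW : WaveCoeff A A' b φ γ f f') (i j : Fin 3) :
    ContinuousOn (fun s => A s i j) (Iic 0) := fun τ hτ =>
  (hW.hasDerivAt_A τ hτ i j).continuousAt.continuousWithinAt

theorem WaveCoeff.continuousOn_waveDens (hW : WaveCoeff A A' b φ γ f f') (hJ : IsOpen J)
    (hJ0 : Iic 0 ⊆ J) (hw : SmoothOn J w) :
    ContinuousOn (fun p : G × ℝ => waveDens e A f w p.1 p.2) (univ ×ˢ Iic 0) := by
  have hsub : (univ : Set G) ×ˢ Iic (0 : ℝ) ⊆ univ ×ˢ J := prod_mono_right hJ0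
  have hg := fun i => (hw.continuousOn_grad (e := e) hJ i).mono hsub
  have h1 : ContinuousOn (fun p : G × ℝ => deriv (w p.1) p.2) (univ ×ˢ Iic 0) :=
    (hw.deriv hJ).continuousOn.mono hsub
  have h2 : ContinuousOn (fun p : G × ℝ => w p.1 p.2) (univ ×ˢ Iic 0) := hw.continuousOn.mono hsub
  unfold waveDens dens
  exact continuousOn_const.mul (((h1.pow 2).add (continuousOn_bil hW.continuousOn_A hg hg)).add
    (((continuousOn_time hW.continuousOn_f).pow 2).mul (h2.pow 2)))

theorem WaveCoeff.continuousOn_waveDensDeriv (hW : WaveCoeff A A' b φ γ f f') (hJ : IsOpen J)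
    (hJ0 : Iic 0 ⊆ J) (hw : SmoothOn J w) (hχ : SmoothOn univ χ) :
    ContinuousOn (fun p : G × ℝ => waveDensDeriv e A A' f f' χ w p.1 p.2) (univ ×ˢ Iio 0) := by
  have hs0 : Iio (0 : ℝ) ⊆ Iic 0 := Iio_subset_Iic_self
  have hsub : (univ : Set G) ×ˢ Iio (0 : ℝ) ⊆ univ ×ˢ J := prod_mono_right (hs0.trans hJ0)
  have hg := fun i => (hw.continuousOn_grad (e := e) hJ i).mono hsub
  have hg' := fun i => ((hw.deriv hJ).continuousOn_grad (e := e) hJ i).mono hsub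
  have h1 : ContinuousOn (fun p : G × ℝ => deriv (w p.1) p.2) (univ ×ˢ Iio 0) :=
    (hw.deriv hJ).continuousOn.mono hsub
  have h1' : ContinuousOn (fun p : G × ℝ => deriv (deriv (w p.1)) p.2) (univ ×ˢ Iio 0) :=
    ((hw.deriv hJ).deriv hJ).continuousOn.mono hsub
  have h2 : ContinuousOn (fun p : G × ℝ => w p.1 p.2) (univ ×ˢ Iio 0) := hw.continuousOn.mono hsub
  have h3 : ContinuousOn (fun p : G × ℝ => χ p.1 p.2) (univ ×ˢ Iio 0) :=
    hχ.continuousOn.mono (prod_mono_right (subset_univ _))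
  have h4 : ContinuousOn (fun p : G × ℝ => deriv (χ p.1) p.2) (univ ×ˢ Iio 0) :=
    (hχ.deriv isOpen_univ).continuousOn.mono (prod_mono_right (subset_univ _))
  have h5 := (hW.continuousOn_waveDens (e := e) hJ hJ0 hw).mono
    (prod_mono_right hs0 : (univ : Set G) ×ˢ Iio (0 : ℝ) ⊆ _)
  have hf := continuousOn_time (X := G) (hW.continuousOn_f.mono hs0)
  have hf' := continuousOn_time (X := G) hW.continuousOn_f'
  have hb1 := continuousOn_bil (fun i j => (hW.continuousOn_A i j).mono hs0) hg' hg
  have hb2 := continuousOn_bil (fun i j => (hW.continuousOn_A' i j).mono hs0) hg hg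
  unfold waveDensDeriv
  exact (h4.mul h5).add (h3.mul (((((h1.mul h1').add hb1).add (continuousOn_const.mul hb2)).add
    ((hf.mul hf').mul (h2.pow 2))).add ((hf.pow 2).mul (h2.mul h1))))

theorem WaveCoeff.hasDerivAt_waveDens (hW : WaveCoeff A A' b φ γ f f') (hJ : IsOpen J)
    (hJ0 : Iic 0 ⊆ J) (hw : SmoothOn J w) (hχ : SmoothOn univ χ) (x : G) {τ : ℝ} (hτ : τ < 0) :
    HasDerivAt (fun s => χ x s * waveDens e A f w x s) (waveDensDeriv e A A' f f' χ w x τ) τ := by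
  have hτJ := hJ0 hτ.le
  have h1 := hw.hasDerivAt hJ x hτJ
  have h2 := (hw.deriv hJ).hasDerivAt hJ x hτJ
  have h3 : ∀ i, HasDerivAt (fun s => grad e w x s i) (grad e (fun y => deriv (w y)) x τ i) τ := by
    intro i
    have := (hw.frameD (e := e) hJ i).hasDerivAt hJ x hτJ
    rw [hw.deriv_frameD hJ i x hτJ] at this
    exact this
  have h4 : HasDerivAt (fun s => bil (A s) (grad e w x s) (grad e w x s))
      (bil (A' τ) (grad e w x τ) (grad e w x τ)
        + 2 * bil (A τ) (grad e (fun y => deriv (w y)) x τ) (grad e w x τ)) τ := by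
    have h5 : HasDerivAt (fun s => bil (A s) (grad e w x s) (grad e w x s))
      (∑ i, ∑ j, ((A' τ i j * grad e w x τ i
          + A τ i j * grad e (fun y => deriv (w y)) x τ i) * grad e w x τ j
        + A τ i j * grad e w x τ i * grad e (fun y => deriv (w y)) x τ j)) τ := by
      unfold bil
      exact HasDerivAt.fun_sum fun i _ => HasDerivAt.fun_sum fun j _ =>
        ((hW.hasDerivAt_A τ hτ.le i j).mul (h3 i)).mul (h3 j)
    refine h5.congr_deriv ?_
    rw [two_mul]
    nth_rewrite 2 [(hW.form τ hτ.le).bil_comm]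
    simp only [bil, ← Finset.sum_add_distrib]
    exact Finset.sum_congr rfl fun i _ => Finset.sum_congr rfl fun j _ => by ring
  have h6 := hW.hasDerivAt_f τ hτ
  have h7 := hχ.hasDerivAt isOpen_univ x (mem_univ τ)
  have h8 := ((((h2.pow 2).add h4).add ((h6.pow 2).mul (h1.pow 2))).const_mul (1 / 2))
  refine (h7.mul h8).congr_deriv ?_
  simp only [waveDensDeriv, waveDens, dens, Pi.add_apply, Pi.mul_apply, Pi.pow_apply]
  ring

end WeightedEnergy

end Bianchi

namespace Bianchi

/-! ### The weighted energy estimate for a system of waves. -/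

section WeightedEnergy

variable {G : Type*} [TopologicalSpace G] [ChartedSpace (EuclideanSpace ℝ (Fin 3)) G] [Group G]
  [LieGroup (𝓡 3) ∞ G] {e : Basis (Fin 3) ℝ (GroupLieAlgebra (𝓡 3) G)}
  {A A' : ℝ → Matrix (Fin 3) (Fin 3) ℝ} {b φ γ f f' : ℝ → ℝ} {J : Set ℝ} {χ : G → ℝ → ℝ}

/-- The energy flux `A^{ij} χ w_τ e_j(w)`. -/
def flux (e : Basis (Fin 3) ℝ (GroupLieAlgebra (𝓡 3) G)) (A : ℝ → Matrix (Fin 3) (Fin 3) ℝ)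
    (χ w : G → ℝ → ℝ) (τ : ℝ) (i : Fin 3) (x : G) : ℝ :=
  ∑ j, A τ i j * (χ x τ * (deriv (w x) τ * grad e w x τ j))

theorem contMDiff_flux {w : G → ℝ → ℝ} (hJ : IsOpen J) (hw : SmoothOn J w)
    (hχ : SmoothOn univ χ) {τ : ℝ} (hτ : τ ∈ J) (i : Fin 3) :
    ContMDiff (𝓡 3) 𝓘(ℝ, ℝ) ∞ (flux e A χ w τ i) :=
  contMDiff_finsetSum fun j _ => contMDiff_const.mul ((hχ.space (mem_univ τ)).mul
    (((hw.deriv hJ).space hτ).mul ((hw.frameD (e := e) hJ j).space hτ)))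

theorem frameD_flux {w : G → ℝ → ℝ} (hJ : IsOpen J) (hw : SmoothOn J w)
    (hχ : SmoothOn univ χ) {τ : ℝ} (hτ : τ ∈ J) (i : Fin 3) (x : G) :
    frameD e i (flux e A χ w τ i) x = ∑ j, A τ i j * (grad e χ x τ i
        * (deriv (w x) τ * grad e w x τ j) + χ x τ * (grad e (fun y => deriv (w y)) x τ i
        * grad e w x τ j + deriv (w x) τ * frameD e i (frameD e j fun y => w y τ) x)) := by
  have hd : ∀ {H : G → ℝ}, ContMDiff (𝓡 3) 𝓘(ℝ, ℝ) ∞ H → ∀ y,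
    MDifferentiableAt (𝓡 3) 𝓘(ℝ, ℝ) H y := fun hH y => hH.mdifferentiableAt (by simp)
  have h1 := hχ.space (mem_univ τ)
  have h2 := (hw.deriv hJ).space hτ
  have h3 : ∀ j, ContMDiff (𝓡 3) 𝓘(ℝ, ℝ) ∞ fun x => grad e w x τ j :=
    fun j => (hw.frameD (e := e) hJ j).space hτ
  have h4 : ∀ j, ContMDiff (𝓡 3) 𝓘(ℝ, ℝ) ∞ fun x => deriv (w x) τ * grad e w x τ j :=
    fun j => h2.mul (h3 j)
  have h5 : ∀ j, ContMDiff (𝓡 3) 𝓘(ℝ, ℝ) ∞ fun x => χ x τ * (deriv (w x) τ * grad e w x τ j) :=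
    fun j => h1.mul (h4 j)
  unfold flux
  rw [frameD_sum Finset.univ (F := fun j x => A τ i j * (χ x τ * (deriv (w x) τ * grad e w x τ j)))
    fun j _ => hd (contMDiff_const.mul (h5 j)) x]
  refine Finset.sum_congr rfl fun j _ => ?_
  rw [frameD_const_mul _ (hd (h5 j) x), frameD_mul (hd h1 x) (hd (h4 j) x),
    frameD_mul (hd h2 x) (hd (h3 j) x)]
  rfl

/-- The product of E with exp(∫_{τ₂}^τ k) is nondecreasing. Neither E nor k needs a sign, and
differentiability is asked only inside the interval: the endpoint may be τ = 0, beyond which nothing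
is assumed of 𝔣. -/
theorem monotoneOn_gronwall {E E' k : ℝ → ℝ} {τ₂ τ₁ : ℝ} (hτ : τ₂ ≤ τ₁) (hτ₁ : τ₁ ≤ 0)
    (hE : ContinuousOn E (Icc τ₂ τ₁)) (hE' : ∀ τ ∈ Ioo τ₂ τ₁, HasDerivAt E (E' τ) τ)
    (hk : ContinuousOn k (Iic 0)) (h : ∀ τ ∈ Ioo τ₂ τ₁, -(k τ * E τ) ≤ E' τ) :
    E τ₂ ≤ E τ₁ * Real.exp (∫ s in τ₂..τ₁, k s) := by
  have hsub : Icc τ₂ τ₁ ⊆ Iic 0 := fun s hs => hs.2.trans hτ₁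
  have hki : ∀ τ ∈ Icc τ₂ τ₁, IntervalIntegrable k volume τ₂ τ := by
    intro τ hτ
    refine (hk.mono ?_).intervalIntegrable
    rw [uIcc_of_le hτ.1]
    exact (Icc_subset_Icc_right hτ.2).trans hsub
  have hd : ∀ τ ∈ Ioo τ₂ τ₁, HasDerivAt (fun r => ∫ s in τ₂..r, k s) (k τ) τ := by
    intro τ hτ
    have hn : Iio (0 : ℝ) ∈ 𝓝 τ := Iio_mem_nhds (hτ.2.trans_le hτ₁)
    refine intervalIntegral.integral_hasDerivAt_right (hki τ (Ioo_subset_Icc_self hτ)) ?_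
      (hk.continuousAt (mem_of_superset hn Iio_subset_Iic_self))
    exact (hk.mono Iio_subset_Iic_self).stronglyMeasurableAtFilter isOpen_Iio τ
      (hτ.2.trans_le hτ₁)
  have hc : ContinuousOn (fun r => ∫ s in τ₂..r, k s) (Icc τ₂ τ₁) := by
    have := intervalIntegral.continuousOn_primitive_interval' (hki τ₁ ⟨hτ, le_rfl⟩) left_mem_uIcc
    rwa [uIcc_of_le hτ] at this
  have hm : MonotoneOn (fun τ => E τ * Real.exp (∫ s in τ₂..τ, k s)) (Icc τ₂ τ₁) := by
    have hder : ∀ τ ∈ Ioo τ₂ τ₁, HasDerivAt (fun τ => E τ * Real.exp (∫ s in τ₂..τ, k s))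
        (E' τ * Real.exp (∫ s in τ₂..τ, k s) + E τ * (Real.exp (∫ s in τ₂..τ, k s) * k τ)) τ :=
      fun τ hτ => (hE' τ hτ).mul (hd τ hτ).exp
    refine monotoneOn_of_deriv_nonneg (convex_Icc _ _) (hE.mul (Real.continuous_exp.comp_continuousOn hc))
      ?_ ?_
    · rw [interior_Icc]
      exact fun τ hτ => (hder τ hτ).differentiableAt.differentiableWithinAt
    · rw [interior_Icc]
      intro τ hτ
      rw [(hder τ hτ).deriv]
      have := mul_nonneg (by linarith [h τ hτ] : 0 ≤ E' τ + k τ * E τ)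
        (Real.exp_pos (∫ s in τ₂..τ, k s)).le
      linarith
  simpa using hm ⟨le_rfl, hτ⟩ ⟨hτ, le_rfl⟩ hτ

variable [T2Space G] [MeasurableSpace G] [BorelSpace G] {ι : Type*} [Fintype ι]

/-- One estimate for two purposes: χ = 1 gives the energy bound for compactly supported solutions,
and a cone weight gives finite propagation. Condition `hflux` says that the loss of weight towards
the past pays for the flux caused by its gradient. The sources may involve all components, which is
what the commutators produce. -/
theorem weighted_energy_le (hW : WaveCoeff A A' b φ γ f f') (hJ : IsOpen J) (hJ0 : Iic 0 ⊆ J)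
    {μ : Measure G} [IsFiniteMeasureOnCompacts μ] {κ ν : Fin 3 → ℝ}
    (hκ : ∀ i, ∀ F : G → ℝ, ContMDiff (𝓡 3) 𝓘(ℝ, ℝ) ∞ F → HasCompactSupport F →
      ∫ x, frameD e i F x ∂μ = κ i * ∫ x, F x ∂μ)
    {w R : ι → G → ℝ → ℝ} (hw : ∀ k, SmoothOn J (w k))
    (hpde : ∀ k, IsWave e A b φ ν (w k) (R k)) {C : ℝ} (hC : 0 ≤ C)
    (hR : ∀ k x, ∀ τ ≤ 0, |R k x τ| ≤ C * f τ * ∑ l,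
      (√(bil (A τ) (grad e (w l) x τ) (grad e (w l) x τ)) + f τ * |w l x τ|))
    (hχ : SmoothOn univ χ) (hχ0 : ∀ x τ, 0 ≤ χ x τ) {τ₂ τ₁ : ℝ} (h21 : τ₂ ≤ τ₁) (h10 : τ₁ ≤ 0)
    (hflux : ∀ k x, ∀ τ ∈ Icc τ₂ τ₁, |deriv (w k x) τ * bil (A τ) (grad e χ x τ)
      (grad e (w k) x τ)| ≤ deriv (χ x) τ * waveDens e A f (w k) x τ)
    {K : Set G} (hK : IsCompact K)
    (hsupp : ∀ x, x ∉ K → ∀ τ ∈ Icc τ₂ τ₁, χ x τ = 0 ∨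
      ∀ k, deriv (w k x) τ = 0 ∧ w k x τ = 0 ∧ ∀ i, grad e (w k) x τ i = 0) :
    ∫ x, ∑ k, χ x τ₂ * waveDens e A f (w k) x τ₂ ∂μ
      ≤ (∫ x, ∑ k, χ x τ₁ * waveDens e A f (w k) x τ₁ ∂μ)
        * Real.exp (∫ s in τ₂..τ₁, (2 * b s + 6 * γ s
          + (√(∑ i, (κ i - ν i) ^ 2) + 2 + 3 * Fintype.card ι * C) * f s)) := by
  have hIccIic : Icc τ₂ τ₁ ⊆ Iic 0 := fun s hs => hs.2.trans h10
  have hIooIio : Ioo τ₂ τ₁ ⊆ Iio 0 := fun s hs => hs.2.trans_le h10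
  have hsuppD : ∀ x, x ∉ K → ∀ τ ∈ Icc τ₂ τ₁, ∀ k, χ x τ * waveDens e A f (w k) x τ = 0 := by
    intro x hx τ hτ k
    rcases hsupp x hx τ hτ with h | h
    · rw [h, zero_mul]
    · obtain ⟨h1, h2, h3⟩ := h k
      have : grad e (w k) x τ = fun _ => 0 := funext h3
      simp [waveDens, dens, bil, h1, h2, this]
  have hcontH : ContinuousOn (fun p : G × ℝ => ∑ k, χ p.1 p.2 * waveDens e A f (w k) p.1 p.2)
      (univ ×ˢ Iic 0) :=
    continuousOn_finsetSum _ fun k _ => (hχ.continuousOn.mono (prod_mono_right (subset_univ _))).mul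
      (hW.continuousOn_waveDens hJ hJ0 (hw k))
  have hcontH' : ContinuousOn (fun p : G × ℝ => ∑ k, waveDensDeriv e A A' f f' χ (w k) p.1 p.2)
      (univ ×ˢ Iio 0) :=
    continuousOn_finsetSum _ fun k _ => hW.continuousOn_waveDensDeriv hJ hJ0 (hw k) hχ
  have hHd : ∀ x, ∀ τ ∈ Ioo τ₂ τ₁, HasDerivAt (fun s => ∑ k, χ x s * waveDens e A f (w k) x s)
      (∑ k, waveDensDeriv e A A' f f' χ (w k) x τ) τ := fun x τ hτ =>
    HasDerivAt.fun_sum fun k _ => hW.hasDerivAt_waveDens hJ hJ0 (hw k) hχ x (hIooIio hτ)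
  have hsuppH : ∀ x, x ∉ K → ∀ τ ∈ Icc τ₂ τ₁, ∑ k, χ x τ * waveDens e A f (w k) x τ = 0 :=
    fun x hx τ hτ => Finset.sum_eq_zero fun k _ => hsuppD x hx τ hτ k
  refine monotoneOn_gronwall (E := fun τ => ∫ x, ∑ k, χ x τ * waveDens e A f (w k) x τ ∂μ) h21 h10
    (E' := fun τ => ∫ x, ∑ k, waveDensDeriv e A A' f f' χ (w k) x τ ∂μ) ?_ ?_ ?_ ?_
  · exact continuousOn_integral_of_compact hK (hcontH.mono (prod_mono_right hIccIic)) hsuppH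
  · intro τ hτ
    exact hasDerivAt_integral_of_compact
      (F := fun x s => ∑ k, χ x s * waveDens e A f (w k) x s)
      (F' := fun x s => ∑ k, waveDensDeriv e A A' f f' χ (w k) x s) hK isOpen_Ioo
      (hcontH.mono (prod_mono_right (Ioo_subset_Icc_self.trans hIccIic)))
      (hcontH'.mono (prod_mono_right hIooIio)) hHd
      (fun x hx s hs => hsuppH x hx s (Ioo_subset_Icc_self hs)) hτ
  · exact ((continuousOn_const.mul hW.continuousOn_b).add
      (continuousOn_const.mul hW.continuousOn_γ)).add (continuousOn_const.mul hW.continuousOn_f)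
  intro τ hτ
  have hτI := Ioo_subset_Icc_self hτ
  have hτ0 : τ ≤ 0 := hIccIic hτI
  have hτJ := hJ0 hτ0
  have hA := hW.form τ hτ0
  have hf0 := hA.bound_nonneg
  -- the flux is smooth with compact support
  have hFs : ∀ k i, ContMDiff (𝓡 3) 𝓘(ℝ, ℝ) ∞ (flux e A χ (w k) τ i) := fun k i =>
    contMDiff_flux hJ (hw k) hχ hτJ i
  have hF0 : ∀ k i x, x ∉ K → flux e A χ (w k) τ i x = 0 := by
    intro k i x hx
    refine Finset.sum_eq_zero fun j _ => ?_
    rcases hsupp x hx τ hτI with h | h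
    · simp [h]
    · simp [(h k).1]
  have hFc : ∀ k i, HasCompactSupport (flux e A χ (w k) τ i) := fun k i =>
    HasCompactSupport.intro hK (hF0 k i)
  have hFi : ∀ k i, Integrable (flux e A χ (w k) τ i) μ := fun k i =>
    (hFs k i).continuous.integrable_of_hasCompactSupport (hFc k i)
  have hDFi : ∀ k i, Integrable (frameD e i (flux e A χ (w k) τ i)) μ := by
    intro k i
    refine (contMDiff_frameD (hFs k i)).continuous.integrable_of_hasCompactSupport
      (HasCompactSupport.intro hK fun x hx => ?_)
    have hev : flux e A χ (w k) τ i =ᶠ[𝓝 x] fun _ => 0 := by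
      filter_upwards [hK.isClosed.isOpen_compl.mem_nhds hx] with y hy using hF0 k i y hy
    simp only [frameD]
    rw [hev.mfderiv_eq, mfderiv_const]
    rfl
  have hHi : Integrable (fun x => ∑ k, χ x τ * waveDens e A f (w k) x τ) μ := by
    refine Continuous.integrable_of_hasCompactSupport ?_
      (HasCompactSupport.intro hK fun x hx => hsuppH x hx τ hτI)
    exact ContinuousOn.comp_continuous (f := fun x : G => (x, τ)) hcontH (by fun_prop)
      fun x => ⟨mem_univ _, hτ0⟩
  have hH'i : Integrable (fun x => ∑ k, waveDensDeriv e A A' f f' χ (w k) x τ) μ := by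
    refine Continuous.integrable_of_hasCompactSupport ?_
      (HasCompactSupport.intro hK fun x hx => ?_)
    · exact ContinuousOn.comp_continuous (f := fun x : G => (x, τ)) hcontH' (by fun_prop)
        fun x => ⟨mem_univ _, hIooIio hτ⟩
    · refine (hHd x τ hτ).unique ((hasDerivAt_const τ (0 : ℝ)).congr_of_eventuallyEq ?_)
      filter_upwards [isOpen_Ioo.mem_nhds hτ] with s hs
      exact hsuppH x hx s (Ioo_subset_Icc_self hs)
  -- The divergence of each flux and its κ-multiple have equal integrals. Inserting their difference
  -- leaves the integral unchanged and makes the integrand bounded below pointwise.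
  have hint : ∫ x, ∑ k, waveDensDeriv e A A' f f' χ (w k) x τ ∂μ
      = ∫ x, ((∑ k, waveDensDeriv e A A' f f' χ (w k) x τ)
        - (∑ k, ∑ i, frameD e i (flux e A χ (w k) τ i) x)
        + ∑ k, ∑ i, κ i * flux e A χ (w k) τ i x) ∂μ := by
    have i1 : Integrable (fun x => ∑ k, ∑ i, frameD e i (flux e A χ (w k) τ i) x) μ :=
      integrable_finsetSum _ fun k _ => integrable_finsetSum _ fun i _ => hDFi k i
    have i2 : Integrable (fun x => ∑ k, ∑ i, κ i * flux e A χ (w k) τ i x) μ :=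
      integrable_finsetSum _ fun k _ => integrable_finsetSum _ fun i _ => (hFi k i).const_mul _
    have i0 : Integrable (fun x => (∑ k, waveDensDeriv e A A' f f' χ (w k) x τ)
        - ∑ k, ∑ i, frameD e i (flux e A χ (w k) τ i) x) μ := hH'i.sub i1
    rw [integral_add i0 i2, integral_sub hH'i i1,
      integral_finsetSum _ fun k _ => integrable_finsetSum _ fun i _ => hDFi k i,
      integral_finsetSum _ fun k _ => integrable_finsetSum _ fun i _ => (hFi k i).const_mul _]
    have : ∀ k, ∫ x, ∑ i, frameD e i (flux e A χ (w k) τ i) x ∂μ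
        = ∫ x, ∑ i, κ i * flux e A χ (w k) τ i x ∂μ := by
      intro k
      rw [integral_finsetSum _ fun i _ => hDFi k i,
        integral_finsetSum _ fun i _ => (hFi k i).const_mul _]
      exact Finset.sum_congr rfl fun i _ => by
        rw [hκ i _ (hFs k i) (hFc k i), integral_const_mul]
    simp only [this]
    ring
  rw [hint, ← integral_const_mul, ← integral_neg]
  refine integral_mono (hHi.const_mul _).neg
    ((hH'i.sub (integrable_finsetSum _ fun k _ => integrable_finsetSum _ fun i _ => hDFi k i)).add
      (integrable_finsetSum _ fun k _ => integrable_finsetSum _ fun i _ => (hFi k i).const_mul _))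
    fun x => ?_
  simp only [← Finset.sum_sub_distrib, ← Finset.sum_add_distrib]
  have hd0 : ∀ k, 0 ≤ waveDens e A f (w k) x τ := fun k => hA.dens_nonneg _ _ _
  -- pointwise bound for each component
  have hpt : ∀ k, -((2 * b τ + 6 * γ τ + (√(∑ i, (κ i - ν i) ^ 2) + 2) * f τ)
        * (χ x τ * waveDens e A f (w k) x τ)) - χ x τ * (|R k x τ| * |deriv (w k x) τ|)
      ≤ waveDensDeriv e A A' f f' χ (w k) x τ - ∑ i, frameD e i (flux e A χ (w k) τ i) x
        + ∑ i, κ i * flux e A χ (w k) τ i x := by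
    intro k
    have := energy_pointwise (κ := κ) (η := grad e (fun y => deriv (w k y)) x τ) hA
      (hW.f'_nonneg τ (hIooIio hτ)) (hχ0 x τ) (hW.γ_nonneg τ hτ0)
      (hW.b_ge τ hτ0) (hW.A'_ge τ hτ0 _) (hW.abs_φ_le τ hτ0) (hpde k x τ hτ0)
      (hflux k x τ hτI)
    simp only [frameD_flux hJ (hw k) hχ hτJ]
    exact this
  -- the remainder
  have hRk : ∑ k, χ x τ * (|R k x τ| * |deriv (w k x) τ|)
      ≤ 3 * Fintype.card ι * C * f τ * ∑ k, χ x τ * waveDens e A f (w k) x τ := by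
    -- Origin of the constant 3: with s_l the A-norm of the gradient, |p_k| (s_l + f|w_l|) ≤ p_k² +
    -- ½(s_l² + f² w_l²) ≤ 2d_k + d_l. Summation over k and l then gives 2 + 1 times the number of
    -- components.
    have h1 : ∀ k l, |deriv (w k x) τ| * (√(bil (A τ) (grad e (w l) x τ) (grad e (w l) x τ))
        + f τ * |w l x τ|) ≤ 2 * waveDens e A f (w k) x τ + waveDens e A f (w l) x τ := by
      intro k l
      have hk2 : deriv (w k x) τ ^ 2 ≤ 2 * waveDens e A f (w k) x τ := by
        have := hA.nonneg (grad e (w k) x τ)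
        have : 0 ≤ f τ ^ 2 * w k x τ ^ 2 := by positivity
        simp only [waveDens, dens]; linarith
      have hl2 : bil (A τ) (grad e (w l) x τ) (grad e (w l) x τ) + f τ ^ 2 * w l x τ ^ 2
          ≤ 2 * waveDens e A f (w l) x τ := by
        simp only [waveDens, dens]; nlinarith [sq_nonneg (deriv (w l x) τ)]
      have hsq := Real.sq_sqrt (hA.nonneg (grad e (w l) x τ))
      have := sq_abs (deriv (w k x) τ)
      have := sq_abs (w l x τ)
      nlinarith [sq_nonneg (|deriv (w k x) τ| - √(bil (A τ) (grad e (w l) x τ) (grad e (w l) x τ))),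
        sq_nonneg (|deriv (w k x) τ| - f τ * |w l x τ|)]
    have h2 : ∀ k, |R k x τ| * |deriv (w k x) τ| ≤ C * f τ * ∑ l,
        (2 * waveDens e A f (w k) x τ + waveDens e A f (w l) x τ) := by
      intro k
      calc |R k x τ| * |deriv (w k x) τ| ≤ (C * f τ * ∑ l,
            (√(bil (A τ) (grad e (w l) x τ) (grad e (w l) x τ)) + f τ * |w l x τ|))
              * |deriv (w k x) τ| := mul_le_mul_of_nonneg_right (hR k x τ hτ0) (abs_nonneg _)
        _ = C * f τ * ∑ l, |deriv (w k x) τ| *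
            (√(bil (A τ) (grad e (w l) x τ) (grad e (w l) x τ)) + f τ * |w l x τ|) := by
              rw [← Finset.mul_sum]; ring
        _ ≤ _ := mul_le_mul_of_nonneg_left (Finset.sum_le_sum fun l _ => h1 k l) (by positivity)
    calc ∑ k, χ x τ * (|R k x τ| * |deriv (w k x) τ|)
        ≤ ∑ k, χ x τ * (C * f τ * ∑ l,
          (2 * waveDens e A f (w k) x τ + waveDens e A f (w l) x τ)) :=
          Finset.sum_le_sum fun k _ => mul_le_mul_of_nonneg_left (h2 k) (hχ0 x τ)
      _ = _ := by
          simp only [Finset.sum_add_distrib, Finset.sum_const, Finset.card_univ, nsmul_eq_mul,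
            ← Finset.mul_sum]
          ring
  calc _ = ∑ k, -((2 * b τ + 6 * γ τ + (√(∑ i, (κ i - ν i) ^ 2) + 2) * f τ)
        * (χ x τ * waveDens e A f (w k) x τ))
        - 3 * Fintype.card ι * C * f τ * ∑ k, χ x τ * waveDens e A f (w k) x τ := by
        rw [Finset.sum_neg_distrib, ← Finset.mul_sum
          (f := fun k => χ x τ * waveDens e A f (w k) x τ)]
        ring
    _ ≤ ∑ k, -((2 * b τ + 6 * γ τ + (√(∑ i, (κ i - ν i) ^ 2) + 2) * f τ)
        * (χ x τ * waveDens e A f (w k) x τ)) - ∑ k, χ x τ * (|R k x τ| * |deriv (w k x) τ|) := by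
        linarith
    _ ≤ _ := by
        rw [← Finset.sum_sub_distrib]
        exact Finset.sum_le_sum fun k _ => hpt k

end WeightedEnergy

end Bianchi

namespace Bianchi

/-! ### Finite speed of propagation. -/

section FinitePropagation

variable {G : Type*} [TopologicalSpace G] [ChartedSpace (EuclideanSpace ℝ (Fin 3)) G] [Group G]
  [LieGroup (𝓡 3) ∞ G] {e : Basis (Fin 3) ℝ (GroupLieAlgebra (𝓡 3) G)}
  {A A' : ℝ → Matrix (Fin 3) (Fin 3) ℝ} {b φ γ f f' : ℝ → ℝ} {J : Set ℝ}

theorem frameD_eq_zero_of_eventually {F : G → ℝ} {x : G} (i : Fin 3) (h : ∀ᶠ y in 𝓝 x, F y = 0) :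
    frameD e i F x = 0 := by
  have h' : F =ᶠ[𝓝 x] fun _ => 0 := h
  simp only [frameD]
  rw [h'.mfderiv_eq, mfderiv_const]
  rfl

theorem frameD_const (i : Fin 3) (c : ℝ) (x : G) : frameD e i (fun _ => c) x = 0 := by
  simp only [frameD]
  rw [mfderiv_const]
  rfl

theorem WaveCoeff.monotoneOn_f (hW : WaveCoeff A A' b φ γ f f') : MonotoneOn f (Iic 0) := by
  refine monotoneOn_of_deriv_nonneg (convex_Iic 0) hW.continuousOn_f ?_ ?_
  · rw [interior_Iic]
    exact fun τ hτ => (hW.hasDerivAt_f τ hτ).differentiableAt.differentiableWithinAt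
  · rw [interior_Iic]
    intro τ hτ
    rw [(hW.hasDerivAt_f τ hτ).deriv]
    exact hW.f'_nonneg τ hτ

/-- A smooth weight concentrated near `g`, whose support shrinks as `τ` decreases from `τ₁`. -/
def coneWeight (ρ : G → ℝ) (lam : ℝ) (g : G) (τ₁ : ℝ) (x : G) (τ : ℝ) : ℝ :=
  expNegInvGlue (ρ (g⁻¹ * x) + lam * (τ - τ₁))

theorem smoothOn_coneWeight {ρ : G → ℝ} (hρ : ContMDiff (𝓡 3) 𝓘(ℝ, ℝ) ∞ ρ) (lam : ℝ) (g : G)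
    (τ₁ : ℝ) : SmoothOn univ (coneWeight ρ lam g τ₁) := by
  have h1 : ContMDiff (𝓡 3) 𝓘(ℝ, ℝ) ∞ fun x => ρ (g⁻¹ * x) := hρ.comp contMDiff_mul_left
  have h2 : SmoothOn univ (fun (x : G) t => ρ (g⁻¹ * x) + lam * (t - τ₁)) :=
    (SmoothOn.of_space h1).add (SmoothOn.of_time (by fun_prop))
  exact expNegInvGlue.contDiff.contMDiff.comp_contMDiffOn (n := ∞) h2

theorem differentiable_expNegInvGlue : Differentiable ℝ expNegInvGlue :=
  (expNegInvGlue.contDiff (n := 1)).differentiable (by simp)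

theorem grad_coneWeight {ρ : G → ℝ} (hρ : ContMDiff (𝓡 3) 𝓘(ℝ, ℝ) ∞ ρ) (lam : ℝ) (g : G)
    (τ₁ : ℝ) (x : G) (τ : ℝ) (i : Fin 3) :
    grad e (coneWeight ρ lam g τ₁) x τ i
      = deriv expNegInvGlue (ρ (g⁻¹ * x) + lam * (τ - τ₁)) * frameD e i ρ (g⁻¹ * x) := by
  have h1 : ContMDiff (𝓡 3) 𝓘(ℝ, ℝ) ∞ fun x => ρ (g⁻¹ * x) := hρ.comp contMDiff_mul_left
  have h2 : ContMDiff (𝓡 3) 𝓘(ℝ, ℝ) ∞ fun x => ρ (g⁻¹ * x) + lam * (τ - τ₁) :=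
    h1.add contMDiff_const
  simp only [grad, coneWeight]
  rw [frameD_comp (F := fun x => ρ (g⁻¹ * x) + lam * (τ - τ₁)) (h2.mdifferentiableAt (by simp))
    (differentiable_expNegInvGlue _), frameD_add (h1.mdifferentiableAt (by simp)) mdifferentiableAt_const,
    frameD_comp_mul_left g⁻¹ (hρ.mdifferentiableAt (by simp)),
    frameD_const]
  simp

theorem deriv_coneWeight (ρ : G → ℝ) (lam : ℝ) (g : G) (τ₁ : ℝ) (x : G) (τ : ℝ) :
    deriv (coneWeight ρ lam g τ₁ x) τ
      = lam * deriv expNegInvGlue (ρ (g⁻¹ * x) + lam * (τ - τ₁)) := by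
  have h1 : HasDerivAt (fun τ => ρ (g⁻¹ * x) + lam * (τ - τ₁)) lam τ := by
    simpa using (((hasDerivAt_id τ).sub_const τ₁).const_mul lam).const_add (ρ (g⁻¹ * x))
  have h2 := (differentiable_expNegInvGlue (ρ (g⁻¹ * x) + lam * (τ - τ₁))).hasDerivAt.comp τ h1
  rw [mul_comm]
  exact h2.deriv

variable [T2Space G] [MeasurableSpace G] [BorelSpace G]

/-- A domain of dependence argument with a smooth weight, positive where ρ(g⁻¹x) > λ(τ₁ - τ). As A ≤
f² ≤ f(0)² in the past, a slope λ ≥ f(0) max|∇ρ| makes the region spacelike or null and yields the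
flux condition. The weighted energy vanishes at τ₁, hence at τ₂, and g still has positive weight
there because λ(τ₁ - τ₂) ≤ 1/2 < ρ(1). By left translation, λ and the admissible time step do not
depend on g. -/
theorem vanish_of_vanish_nearby (hW : WaveCoeff A A' b φ γ f f') (hf : ∀ τ ≤ 0, 0 < f τ)
    (hJ : IsOpen J) (hJ0 : Iic 0 ⊆ J) {μ : Measure G} [IsFiniteMeasureOnCompacts μ]
    [μ.IsOpenPosMeasure] {κ ν : Fin 3 → ℝ}
    (hκ : ∀ i, ∀ F : G → ℝ, ContMDiff (𝓡 3) 𝓘(ℝ, ℝ) ∞ F → HasCompactSupport F →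
      ∫ x, frameD e i F x ∂μ = κ i * ∫ x, F x ∂μ)
    {v : G → ℝ → ℝ} (hv : SmoothOn J v) (hpde : IsWave e A b φ ν v fun _ _ => 0)
    {ρ : G → ℝ} (hρ : ContMDiff (𝓡 3) 𝓘(ℝ, ℝ) ∞ ρ) (hρc : HasCompactSupport ρ)
    (hρ1 : ρ 1 = 1) {m lam : ℝ}
    (hm : ∀ x, √(∑ i, frameD e i ρ x ^ 2) ≤ m) (hlam : 0 < lam) (hlm : f 0 * m ≤ lam)
    {τ₁ τ₂ : ℝ} (h21 : τ₂ ≤ τ₁) (h10 : τ₁ ≤ 0) (hδ : τ₁ - τ₂ ≤ 1 / (2 * lam)) {g : G}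
    (h0 : ∀ x, ρ (g⁻¹ * x) ≠ 0 → v x τ₁ = 0 ∧ deriv (v x) τ₁ = 0) :
    v g τ₂ = 0 ∧ deriv (v g) τ₂ = 0 := by
  have : IsTopologicalGroup G := topologicalGroup_of_lieGroup (𝓡 3) ∞
  have h20 := h21.trans h10
  set χ := coneWeight ρ lam g τ₁ with hχ
  have hχs : SmoothOn univ χ := smoothOn_coneWeight hρ lam g τ₁
  have hχ0 : ∀ x τ, 0 ≤ χ x τ := fun x τ => expNegInvGlue.nonneg _
  have hd0 : ∀ s, 0 ≤ deriv expNegInvGlue s := fun s => expNegInvGlue.monotone.deriv_nonneg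
  have key := weighted_energy_le (ι := Unit) hW hJ hJ0 (μ := μ) hκ (w := fun _ => v)
    (R := fun _ _ _ => 0) (fun _ => hv) (fun _ => hpde) le_rfl (by simp) hχs hχ0 h21 h10
    (by
      intro _ x τ hτ
      have hτ0 := hτ.2.trans h10
      have hA := hW.form τ hτ0
      set d := deriv expNegInvGlue (ρ (g⁻¹ * x) + lam * (τ - τ₁)) with hd
      have hg : grad e χ x τ = fun i => d * frameD e i ρ (g⁻¹ * x) :=
        funext fun i => grad_coneWeight hρ lam g τ₁ x τ i
      have hb : bil (A τ) (grad e χ x τ) (grad e v x τ)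
          = d * bil (A τ) (fun i => frameD e i ρ (g⁻¹ * x)) (grad e v x τ) := by
        rw [hg]
        simp only [bil, Finset.mul_sum]
        exact Finset.sum_congr rfl fun i _ => Finset.sum_congr rfl fun j _ => by ring
      have hdd := hd0 (ρ (g⁻¹ * x) + lam * (τ - τ₁))
      rw [← hd] at hdd
      rw [hb, hχ, deriv_coneWeight, ← hd, abs_mul, abs_mul, abs_of_nonneg hdd]
      have h1 := hA.abs_bil_le (fun i => frameD e i ρ (g⁻¹ * x)) (grad e v x τ)
      have hfm : f τ * √(∑ i, frameD e i ρ (g⁻¹ * x) ^ 2) ≤ lam :=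
        (mul_le_mul (hW.monotoneOn_f hτ0 self_mem_Iic hτ0) (hm _) (Real.sqrt_nonneg _)
          (hf 0 le_rfl).le).trans hlm
      have h2 : |deriv (v x) τ| * √(bil (A τ) (grad e v x τ) (grad e v x τ))
          ≤ waveDens e A f v x τ := by
        have h3 := Real.sq_sqrt (hA.nonneg (grad e v x τ))
        have h4 := sq_abs (deriv (v x) τ)
        have : 0 ≤ f τ ^ 2 * v x τ ^ 2 := by positivity
        simp only [waveDens, dens]
        nlinarith [sq_nonneg (|deriv (v x) τ| - √(bil (A τ) (grad e v x τ) (grad e v x τ)))]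
      calc |deriv (v x) τ| * (d * |bil (A τ) (fun i => frameD e i ρ (g⁻¹ * x)) (grad e v x τ)|)
          ≤ |deriv (v x) τ| * (d * (f τ * √(∑ i, frameD e i ρ (g⁻¹ * x) ^ 2)
              * √(bil (A τ) (grad e v x τ) (grad e v x τ)))) := by gcongr
        _ = f τ * √(∑ i, frameD e i ρ (g⁻¹ * x) ^ 2) * (d * (|deriv (v x) τ|
              * √(bil (A τ) (grad e v x τ) (grad e v x τ)))) := by ring
        _ ≤ lam * (d * waveDens e A f v x τ) := by gcongr
        _ = _ := by ring)
    (K := (fun y => g * y) '' tsupport ρ) (hρc.isCompact.image (by fun_prop))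
    (by
      intro x hx τ hτ
      left
      have : ρ (g⁻¹ * x) = 0 := by
        by_contra hne
        exact hx ⟨g⁻¹ * x, subset_tsupport _ hne, by simp⟩
      simp only [hχ, coneWeight, this, zero_add]
      exact expNegInvGlue.zero_of_nonpos (mul_nonpos_of_nonneg_of_nonpos hlam.le (by linarith [hτ.2])))
  have hz : ∀ x, χ x τ₁ * waveDens e A f v x τ₁ = 0 := by
    intro x
    by_cases hx : ρ (g⁻¹ * x) = 0
    · simp [hχ, coneWeight, hx]
    · have hev : ∀ᶠ y in 𝓝 x, v y τ₁ = 0 := by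
        have hc : Continuous fun y => ρ (g⁻¹ * y) := hρ.continuous.comp (by fun_prop)
        filter_upwards [hc.continuousAt.eventually_ne hx] with y hy using (h0 y hy).1
      have hg : grad e v x τ₁ = fun _ => 0 := funext fun i => frameD_eq_zero_of_eventually i hev
      simp [waveDens, dens, bil, hg, h0 x hx]
  have hcont : Continuous fun x => χ x τ₂ * waveDens e A f v x τ₂ := by
    have h1 : ContinuousOn (fun p : G × ℝ => χ p.1 p.2 * waveDens e A f v p.1 p.2) (univ ×ˢ Iic 0) :=
      (hχs.continuousOn.mono (prod_mono_right (subset_univ _))).mul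
        (hW.continuousOn_waveDens hJ hJ0 hv)
    exact ContinuousOn.comp_continuous (f := fun x : G => (x, τ₂)) h1 (by fun_prop)
        fun x => ⟨mem_univ _, h20⟩
  have hA := hW.form τ₂ h20
  have hdn : ∀ x, 0 ≤ χ x τ₂ * waveDens e A f v x τ₂ := fun x =>
    mul_nonneg (hχ0 x τ₂) (hA.dens_nonneg _ _ _)
  have hcs : HasCompactSupport fun x => χ x τ₂ * waveDens e A f v x τ₂ := by
    refine HasCompactSupport.intro (hρc.isCompact.image (f := fun y => g * y) (by fun_prop)) fun x hx => ?_
    have : ρ (g⁻¹ * x) = 0 := by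
      by_contra hne
      exact hx ⟨g⁻¹ * x, subset_tsupport _ hne, by simp⟩
    simp only [hχ, coneWeight, this, zero_add]
    rw [expNegInvGlue.zero_of_nonpos (mul_nonpos_of_nonneg_of_nonpos hlam.le (by linarith)), zero_mul]
  simp only [Finset.univ_unique, Finset.sum_singleton, hz, integral_zero, zero_mul] at key
  have hzero : (fun x => χ x τ₂ * waveDens e A f v x τ₂) = 0 := by
    have h1 := (integral_eq_zero_iff_of_nonneg (μ := μ) hdn
      (hcont.integrable_of_hasCompactSupport hcs)).1 (le_antisymm key (integral_nonneg hdn))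
    exact (Continuous.ae_eq_iff_eq μ hcont continuous_const).1 h1
  have hg := congrFun hzero g
  have hpos : 0 < χ g τ₂ := by
    refine expNegInvGlue.pos_of_pos ?_
    simp only [inv_mul_cancel, hρ1]
    have : lam * (τ₁ - τ₂) ≤ lam * (1 / (2 * lam)) := by gcongr
    have h2 : lam * (1 / (2 * lam)) = 1 / 2 := by field_simp
    linarith
  have hw : waveDens e A f v g τ₂ = 0 := by
    rcases mul_eq_zero.1 hg with h | h
    · exact absurd h hpos.ne'
    · exact h
  have hb := hA.nonneg (grad e v g τ₂)
  have hfp := hf τ₂ h20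
  simp only [waveDens, dens] at hw
  have h1 : deriv (v g) τ₂ ^ 2 = 0 := by nlinarith [sq_nonneg (deriv (v g) τ₂), sq_nonneg (f τ₂ * v g τ₂)]
  have h2 : (f τ₂ * v g τ₂) ^ 2 = 0 := by nlinarith [sq_nonneg (deriv (v g) τ₂), sq_nonneg (f τ₂ * v g τ₂)]
  have h3 := pow_eq_zero_iff (two_ne_zero) |>.1 h2
  exact ⟨(mul_eq_zero.1 h3).resolve_left hfp.ne', pow_eq_zero_iff (two_ne_zero) |>.1 h1⟩

/-- Solutions of the wave equation whose data at `τ = 0` have compact support have compact support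
on every bounded time interval. -/
theorem exists_compact_support (hW : WaveCoeff A A' b φ γ f f') (hf : ∀ τ ≤ 0, 0 < f τ)
    (hJ : IsOpen J) (hJ0 : Iic 0 ⊆ J) {μ : Measure G} [IsFiniteMeasureOnCompacts μ]
    [μ.IsOpenPosMeasure] {κ ν : Fin 3 → ℝ}
    (hκ : ∀ i, ∀ F : G → ℝ, ContMDiff (𝓡 3) 𝓘(ℝ, ℝ) ∞ F → HasCompactSupport F →
      ∫ x, frameD e i F x ∂μ = κ i * ∫ x, F x ∂μ)
    {v : G → ℝ → ℝ} (hv : SmoothOn J v) (hpde : IsWave e A b φ ν v fun _ _ => 0)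
    {K₀ : Set G} (hK₀ : IsCompact K₀) (h0 : ∀ x ∉ K₀, v x 0 = 0 ∧ deriv (v x) 0 = 0) (τ₂ : ℝ) :
    ∃ K : Set G, IsCompact K ∧ ∀ x ∉ K, ∀ τ ∈ Icc τ₂ 0, v x τ = 0 ∧ deriv (v x) τ = 0 := by
  have : IsTopologicalGroup G := topologicalGroup_of_lieGroup (𝓡 3) ∞
  have : IsManifold (𝓡 3) ∞ G := isManifold_of_lieGroup G _
  obtain ⟨ρ⟩ : Nonempty (SmoothBumpFunction (𝓡 3) (1 : G)) := inferInstance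
  have hρ : ContMDiff (𝓡 3) 𝓘(ℝ, ℝ) ∞ ρ := ρ.contMDiff
  have hρc : HasCompactSupport ρ := ρ.hasCompactSupport
  obtain ⟨m, hm⟩ : ∃ m, ∀ x, √(∑ i, frameD e i ρ x ^ 2) ≤ m := by
    have hc : Continuous fun x => √(∑ i, frameD e i ρ x ^ 2) := by
      refine Real.continuous_sqrt.comp (continuous_finsetSum _ fun i _ => ?_)
      exact (contMDiff_frameD hρ).continuous.pow 2
    have hs : HasCompactSupport fun x => √(∑ i, frameD e i ρ x ^ 2) := by
      refine HasCompactSupport.intro hρc.isCompact fun x hx => ?_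
      have hev : ∀ᶠ y in 𝓝 x, ρ y = 0 := by
        filter_upwards [(isClosed_tsupport ρ).isOpen_compl.mem_nhds hx] with y hy
        exact image_eq_zero_of_notMem_tsupport hy
      simp [frameD_eq_zero_of_eventually _ hev]
    obtain ⟨m, hm⟩ := hc.bounded_above_of_compact_support hs
    exact ⟨m, fun x => (le_abs_self _).trans (hm x)⟩
  have hm0 : 0 ≤ m := (Real.sqrt_nonneg _).trans (hm 1)
  -- The added 1 keeps the slope positive even if m = 0. The step δ is the time in which a weight of
  -- height 1 loses half its height.
  set lam := f 0 * m + 1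
  have hlam : 0 < lam := by have := hf 0 le_rfl; positivity
  set δ := 1 / (2 * lam)
  have hδ : 0 < δ := by positivity
  have hstep : ∀ n : ℕ, ∃ K : Set G, IsCompact K ∧ ∀ x ∉ K, ∀ τ ∈ Icc (-(n * δ)) 0,
      v x τ = 0 ∧ deriv (v x) τ = 0 := by
    intro n
    induction n with
    | zero =>
      refine ⟨K₀, hK₀, fun x hx τ hτ => ?_⟩
      have : τ = 0 := by
        have := hτ.1
        simp only [Nat.cast_zero, zero_mul, neg_zero] at this
        exact le_antisymm hτ.2 this
      rw [this]
      exact h0 x hx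
    | succ n ih =>
      obtain ⟨K, hK, hKv⟩ := ih
      -- If g is outside K·(supp ρ)⁻¹, then g·supp ρ does not meet K, so the data vanish on the
      -- whole base of the cone over g. As δ is independent of g, finitely many such enlargements
      -- reach any `τ₂`.
      refine ⟨K ∪ (fun p : G × G => p.1 * p.2⁻¹) '' (K ×ˢ tsupport ρ), hK.union
        ((hK.prod hρc.isCompact).image (by fun_prop)), fun g hg τ hτ => ?_⟩
      rw [mem_union, not_or] at hg
      have hn : -(n * δ) ≤ 0 := by
        have : 0 ≤ n * δ := by positivity
        linarith
      by_cases hτn : -(n * δ) ≤ τ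
      · exact hKv g hg.1 τ ⟨hτn, hτ.2⟩
      · push Not at hτn
        refine vanish_of_vanish_nearby hW hf hJ hJ0 hκ hv hpde hρ hρc
          ρ.eq_one hm hlam (by simp [lam]) hτn.le hn ?_ ?_
        · have := hτ.1
          push_cast at this
          change _ ≤ δ
          linarith
        · intro x hx
          refine hKv x (fun hxK => hg.2 ⟨(x, g⁻¹ * x), ⟨hxK, subset_tsupport _ hx⟩, by simp⟩) _ ⟨le_rfl, hn⟩
  obtain ⟨n, hn⟩ := exists_nat_gt (-τ₂ / δ)
  obtain ⟨K, hK, hKv⟩ := hstep n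
  refine ⟨K, hK, fun x hx τ hτ => hKv x hx τ ⟨?_, hτ.2⟩⟩
  rw [div_lt_iff₀ hδ] at hn
  linarith [hτ.1]

end FinitePropagation

end Bianchi

namespace Bianchi

/-! ### Higher order energies. -/

section HigherOrder

variable {G : Type*} [TopologicalSpace G] [ChartedSpace (EuclideanSpace ℝ (Fin 3)) G] [Group G]
  [LieGroup (𝓡 3) ∞ G] {e : Basis (Fin 3) ℝ (GroupLieAlgebra (𝓡 3) G)}
  {A A' : ℝ → Matrix (Fin 3) (Fin 3) ℝ} {b φ γ f f' : ℝ → ℝ} {J : Set ℝ} {v : G → ℝ → ℝ}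

/-- An operator on functions on the group which is local, preserves joint smoothness and commutes
with time derivatives. -/
structure IsTimeCompatible (D : (G → ℝ) → G → ℝ) : Prop where
  smoothOn : ∀ {J : Set ℝ} {v : G → ℝ → ℝ}, IsOpen J → SmoothOn J v →
    SmoothOn J fun x t => D (fun y => v y t) x
  deriv_comm : ∀ {J : Set ℝ} {v : G → ℝ → ℝ}, IsOpen J → SmoothOn J v → ∀ x, ∀ t ∈ J,
    deriv (fun r => D (fun y => v y r) x) t = D (fun y => deriv (v y) t) x
  map_zero : ∀ {F : G → ℝ} {U : Set G}, IsOpen U → (∀ x ∈ U, F x = 0) → ∀ x ∈ U, D F x = 0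

theorem IsTimeCompatible.id : IsTimeCompatible fun F : G → ℝ => F :=
  ⟨fun _ h => h, fun _ _ _ _ _ => rfl, fun _ h => h⟩

theorem isTimeCompatible_frameD (i : Fin 3) : IsTimeCompatible (frameD e i) :=
  ⟨fun hJ h => h.frameD hJ i, fun hJ h x _ ht => h.deriv_frameD hJ i x ht, fun hU h x hx =>
    frameD_eq_zero_of_eventually i (by filter_upwards [hU.mem_nhds hx] with y hy using h y hy)⟩

theorem IsTimeCompatible.comp {D D' : (G → ℝ) → G → ℝ} (h : IsTimeCompatible D)
    (h' : IsTimeCompatible D') : IsTimeCompatible fun F => D (D' F) where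
  smoothOn hJ hv := h.smoothOn hJ (h'.smoothOn hJ hv)
  deriv_comm hJ hv x t ht := by
    rw [h.deriv_comm hJ (h'.smoothOn hJ hv) x t ht]
    exact congrFun (congrArg D (funext fun y => h'.deriv_comm hJ hv y t ht)) x
  map_zero hU hF := h.map_zero hU (h'.map_zero hU hF)

theorem isTimeCompatible_iterate {D : (G → ℝ) → G → ℝ} (h : IsTimeCompatible D) (n : ℕ) :
    IsTimeCompatible (D^[n]) := by
  induction n with
  | zero => exact IsTimeCompatible.id
  | succ n ih =>
    rw [Function.iterate_succ']
    exact h.comp ih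

theorem isTimeCompatible_frameDK {n : ℕ} (K : MultiIndex n) : IsTimeCompatible (frameDK e K) := by
  unfold frameDK
  generalize (List.ofFn fun m => (K.2 m, K.1.blocksFun m)) = L
  induction L with
  | nil => exact IsTimeCompatible.id
  | cons p L ih => exact (isTimeCompatible_iterate (isTimeCompatible_frameD p.1) p.2).comp ih

/-- The derivative `e_K(v)` of a function of the group variable and of time. -/
def derivK (e : Basis (Fin 3) ℝ (GroupLieAlgebra (𝓡 3) G)) {n : ℕ} (K : MultiIndex n)
    (v : G → ℝ → ℝ) (x : G) (τ : ℝ) : ℝ := frameDK e K (fun y => v y τ) x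

theorem SmoothOn.derivK (hv : SmoothOn J v) (hJ : IsOpen J) {n : ℕ} (K : MultiIndex n) :
    SmoothOn J (derivK e K v) := (isTimeCompatible_frameDK K).smoothOn hJ hv

theorem SmoothOn.deriv_derivK (hv : SmoothOn J v) (hJ : IsOpen J) {n : ℕ} (K : MultiIndex n)
    (x : G) {τ : ℝ} (hτ : τ ∈ J) :
    _root_.deriv (Bianchi.derivK e K v x) τ = Bianchi.derivK e K (fun y => _root_.deriv (v y)) x τ :=
  (isTimeCompatible_frameDK K).deriv_comm hJ hv x τ hτ

theorem SmoothOn.deriv_deriv_derivK (hv : SmoothOn J v) (hJ : IsOpen J) {n : ℕ} (K : MultiIndex n)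
    (x : G) {τ : ℝ} (hτ : τ ∈ J) :
    _root_.deriv (_root_.deriv (Bianchi.derivK e K v x)) τ
      = Bianchi.derivK e K (fun y => _root_.deriv (_root_.deriv (v y))) x τ := by
  have h : _root_.deriv (Bianchi.derivK e K v x)
      =ᶠ[𝓝 τ] Bianchi.derivK e K (fun y => _root_.deriv (v y)) x := by
    filter_upwards [hJ.mem_nhds hτ] with s hs using hv.deriv_derivK hJ K x hs
  rw [h.deriv_eq, (hv.deriv hJ).deriv_derivK hJ K x hτ]

/-- The smooth function `v(·, τ)`. -/
def SmoothOn.slice (hv : SmoothOn J v) {τ : ℝ} (hτ : τ ∈ J) : C^∞⟮𝓡 3, G; 𝓘(ℝ, ℝ), ℝ⟯ :=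
  ⟨fun x => v x τ, hv.space hτ⟩

/-- On a time slice b and φ are scalars, so e_K passes through them and through the time
derivatives. Only the spatial operator leaves a commutator as source. -/
theorem IsWave.deriv_deriv_derivK {ν : Fin 3 → ℝ} (hpde : IsWave e A b φ ν v fun _ _ => 0) (hJ : IsOpen J)
    (hJ0 : Iic 0 ⊆ J) (hv : SmoothOn J v) {n : ℕ} (K : MultiIndex n) {τ : ℝ} (hτ : τ ≤ 0) (x : G) :
    deriv (deriv (derivK e K v x)) τ = -b τ * deriv (derivK e K v x) τ
      + (∑ i, ∑ j, A τ i j * frameD e i (frameD e j fun y => derivK e K v y τ) x)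
      - bil (A τ) ν (grad e (derivK e K v) x τ) + φ τ * derivK e K v x τ
      + (frameOpK e K (waveOp e (A τ) ν (hv.slice (hJ0 hτ))) x
        - waveOp e (A τ) ν (frameOpK e K (hv.slice (hJ0 hτ))) x) := by
  have hτJ := hJ0 hτ
  set V := hv.slice hτJ with hV
  set V₁ := (hv.deriv hJ).slice hτJ with hV₁
  set V₂ := ((hv.deriv hJ).deriv hJ).slice hτJ with hV₂
  have hVa : ∀ y, V y = v y τ := fun _ => rfl
  have heq : V₂ = (-b τ) • V₁ + waveOp e (A τ) ν V + φ τ • V := by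
    ext y
    have h1 := hpde y τ hτ
    have h2 : waveOp e (A τ) ν V y = (∑ i, ∑ j, A τ i j * frameD e i (frameD e j fun y => v y τ) y)
        - bil (A τ) ν (grad e v y τ) := waveOp_apply e (A τ) ν V y
    have h3 : V₂ y = deriv (deriv (v y)) τ := rfl
    have h4 : ((-b τ) • V₁ + waveOp e (A τ) ν V + φ τ • V) y
        = -b τ * deriv (v y) τ + waveOp e (A τ) ν V y + φ τ * v y τ := rfl
    rw [h3, h4, h1, h2]
    ring
  have hK2 := congrArg (fun F => frameOpK e K F x) heq
  simp only [_root_.map_add, _root_.map_smul] at hK2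
  have h0 : frameOpK e K V₂ x = deriv (deriv (derivK e K v x)) τ := by
    rw [hv.deriv_deriv_derivK hJ K x hτJ, frameOpK_apply]
    rfl
  have h1 : frameOpK e K V₁ x = deriv (derivK e K v x) τ := by
    rw [hv.deriv_derivK hJ K x hτJ, frameOpK_apply]
    rfl
  have h2f : (frameOpK e K V : G → ℝ) = fun y => derivK e K v y τ := by
    rw [frameOpK_apply]
    rfl
  have h3 : waveOp e (A τ) ν (frameOpK e K V) x
      = (∑ i, ∑ j, A τ i j * frameD e i (frameD e j fun y => derivK e K v y τ) x)
        - bil (A τ) ν (grad e (derivK e K v) x τ) := by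
    rw [waveOp_apply, h2f]
    rfl
  have h4 : frameOpK e K V₂ x = -b τ * frameOpK e K V₁ x + frameOpK e K (waveOp e (A τ) ν V) x
      + φ τ * frameOpK e K V x := hK2
  have h5 := congrFun h2f x
  rw [h0, h1, h5] at h4
  rw [h4, h3]
  ring

/-- The multiindices `K` with `|K| ≤ l`. -/
abbrev MultiIndexLE (l : ℕ) : Type := (n : Fin (l + 1)) × MultiIndex n

theorem sum_multiIndexLE {l : ℕ} (q : (n : ℕ) → MultiIndex n → ℝ) :
    ∑ K : MultiIndexLE l, q K.1 K.2 = ∑ n ∈ Finset.range (l + 1), ∑ K : MultiIndex n, q n K := by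
  rw [Finset.sum_range fun n => ∑ K : MultiIndex n, q n K]
  exact Fintype.sum_sigma' fun (n : Fin (l + 1)) (K : MultiIndex n) => q n K

theorem sum_multiIndex_le {l : ℕ} {q : (n : ℕ) → MultiIndex n → ℝ} (hq : ∀ n K, 0 ≤ q n K)
    (n : Fin (l + 1)) : ∑ K : MultiIndex n, q n K ≤ ∑ K : MultiIndexLE l, q K.1 K.2 := by
  rw [sum_multiIndexLE]
  exact Finset.single_le_sum (f := fun n => ∑ K : MultiIndex n, q n K)
    (fun n _ => Finset.sum_nonneg fun K _ => hq n K) (Finset.mem_range.2 n.2)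

/-- The commutator bounds for the finitely many K with |K| ≤ l share one constant, which is fixed
before the coefficients and the solution. -/
theorem exists_residual_bound (e : Basis (Fin 3) ℝ (GroupLieAlgebra (𝓡 3) G)) (ν : Fin 3 → ℝ)
    (l : ℕ) : ∃ C, 0 ≤ C ∧ ∀ {A A' : ℝ → Matrix (Fin 3) (Fin 3) ℝ} {b φ γ f f' : ℝ → ℝ} {J : Set ℝ}
      {v : G → ℝ → ℝ} (_ : WaveCoeff A A' b φ γ f f') (hJ0 : Iic 0 ⊆ J)
      (hv : SmoothOn J v) (K : MultiIndexLE l) (x : G) (τ : ℝ) (hτ : τ ≤ 0),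
      |frameOpK e K.2 (waveOp e (A τ) ν (hv.slice (hJ0 hτ))) x
        - waveOp e (A τ) ν (frameOpK e K.2 (hv.slice (hJ0 hτ))) x| ≤ C * f τ *
        ∑ L : MultiIndexLE l, (√(bil (A τ) (grad e (derivK e L.2 v) x τ)
          (grad e (derivK e L.2 v) x τ)) + f τ * |derivK e L.2 v x τ|) := by
  choose C hC hCb using fun K : MultiIndexLE l => exists_commutator_bound e K.2 ν
  refine ⟨∑ K, C K, Finset.sum_nonneg fun K _ => hC K, ?_⟩
  intro A A' b φ γ f f' J v hW hJ0 hv K x τ hτ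
  have hA := hW.form τ hτ
  have hf := hA.bound_nonneg
  have h0 : ∀ {n : ℕ} (L : MultiIndex n), 0 ≤ √(bil (A τ) (grad e (derivK e L v) x τ)
          (grad e (derivK e L v) x τ)) + f τ * |derivK e L v x τ| := fun L => by positivity
  refine (hCb K (A τ) (f τ) hA (hv.slice (hJ0 hτ)) x).trans ?_
  have h1 : ∀ {n : ℕ} (L : MultiIndex n), (frameOpK e L (hv.slice (hJ0 hτ)) : G → ℝ)
      = fun y => derivK e L v y τ := fun L => by
    rw [frameOpK_apply]
    rfl
  simp only [h1]
  have h2 : C K ≤ ∑ K, C K := Finset.single_le_sum (fun K _ => hC K) (Finset.mem_univ K)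
  have h3 : ∑ L : MultiIndex K.1, (√(bil (A τ) (grad e (derivK e L v) x τ)
        (grad e (derivK e L v) x τ)) + f τ * |derivK e L v x τ|)
      ≤ ∑ L : MultiIndexLE l, (√(bil (A τ) (grad e (derivK e L.2 v) x τ)
        (grad e (derivK e L.2 v) x τ)) + f τ * |derivK e L.2 v x τ|) := by
    exact sum_multiIndex_le (q := fun n (L : MultiIndex n) =>
      √(bil (A τ) (grad e (derivK e L v) x τ) (grad e (derivK e L v) x τ))
        + f τ * |derivK e L v x τ|) (fun n L => h0 L) K.1
  have h4 : 0 ≤ ∑ K, C K := Finset.sum_nonneg fun K _ => hC K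
  have h5 : (0 : ℝ) ≤ ∑ L : MultiIndex K.1, (√(bil (A τ) (grad e (derivK e L v) x τ)
        (grad e (derivK e L v) x τ)) + f τ * |derivK e L v x τ|) :=
    Finset.sum_nonneg fun L _ => h0 L
  exact mul_le_mul (mul_le_mul_of_nonneg_right h2 hf) h3 h5 (mul_nonneg h4 hf)

/-- The energy density of order `l`. -/
def waveDensLE (e : Basis (Fin 3) ℝ (GroupLieAlgebra (𝓡 3) G)) (A : ℝ → Matrix (Fin 3) (Fin 3) ℝ)
    (f : ℝ → ℝ) (l : ℕ) (v : G → ℝ → ℝ) (τ : ℝ) (x : G) : ℝ :=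
  ∑ K : MultiIndexLE l, waveDens e A f (derivK e K.2 v) x τ

theorem derivK_vanish (hJ : IsOpen J) (hv : SmoothOn J v) {U : Set G} (hU : IsOpen U) {τ : ℝ}
    (hτ : τ ∈ J) (h : ∀ x ∈ U, v x τ = 0 ∧ deriv (v x) τ = 0) {n : ℕ} (K : MultiIndex n) {x : G}
    (hx : x ∈ U) : deriv (derivK e K v x) τ = 0 ∧ derivK e K v x τ = 0
      ∧ ∀ i, grad e (derivK e K v) x τ i = 0 := by
  have h1 := (isTimeCompatible_frameDK (e := e) K).map_zero hU fun x hx => (h x hx).1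
  refine ⟨?_, h1 x hx, fun i => (isTimeCompatible_frameD i).map_zero hU h1 x hx⟩
  rw [hv.deriv_derivK hJ K x hτ]
  exact (isTimeCompatible_frameDK K).map_zero hU (fun x hx => (h x hx).2) x hx

theorem WaveCoeff.continuous_waveDensLE (hW : WaveCoeff A A' b φ γ f f') (hJ : IsOpen J)
    (hJ0 : Iic 0 ⊆ J) (hv : SmoothOn J v) (l : ℕ) {τ : ℝ} (hτ : τ ≤ 0) :
    Continuous (waveDensLE e A f l v τ) := by
  refine continuous_finsetSum _ fun K _ => ?_
  exact ContinuousOn.comp_continuous (f := fun x : G => (x, τ))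
    (hW.continuousOn_waveDens hJ hJ0 (hv.derivK hJ K.2)) (by fun_prop) fun x => ⟨mem_univ _, hτ⟩

variable [T2Space G]

theorem hasCompactSupport_waveDensLE (hJ : IsOpen J) (hv : SmoothOn J v) (l : ℕ) {τ : ℝ}
    (hτ : τ ∈ J) {K : Set G} (hK : IsCompact K) (h : ∀ x ∉ K, v x τ = 0 ∧ deriv (v x) τ = 0) :
    HasCompactSupport (waveDensLE e A f l v τ) := by
  refine HasCompactSupport.intro hK fun x hx => Finset.sum_eq_zero fun L _ => ?_
  obtain ⟨h1, h2, h3⟩ := derivK_vanish (e := e) hJ hv hK.isClosed.isOpen_compl hτ h L.2 hx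
  have : grad e (derivK e L.2 v) x τ = fun _ => 0 := funext h3
  simp [waveDens, dens, bil, h1, h2, this]

variable [MeasurableSpace G] [BorelSpace G]

/-- The energy estimate of order `l` for the wave equation. -/
theorem exists_energy_le (e : Basis (Fin 3) ℝ (GroupLieAlgebra (𝓡 3) G)) (κ ν : Fin 3 → ℝ) (l : ℕ) :
    ∃ M, 0 ≤ M ∧ ∀ {A A' : ℝ → Matrix (Fin 3) (Fin 3) ℝ} {b φ γ f f' : ℝ → ℝ} {J : Set ℝ}
      {v : G → ℝ → ℝ} (_ : WaveCoeff A A' b φ γ f f') (_ : IsOpen J) (_ : Iic 0 ⊆ J)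
      {μ : Measure G} [IsFiniteMeasureOnCompacts μ]
      (_ : ∀ i, ∀ F : G → ℝ, ContMDiff (𝓡 3) 𝓘(ℝ, ℝ) ∞ F → HasCompactSupport F →
        ∫ x, frameD e i F x ∂μ = κ i * ∫ x, F x ∂μ)
      (_ : SmoothOn J v) (_ : IsWave e A b φ ν v fun _ _ => 0) {τ : ℝ} (_ : τ ≤ 0) {K : Set G}
      (_ : IsCompact K) (_ : ∀ x ∉ K, ∀ s ∈ Icc τ 0, v x s = 0 ∧ deriv (v x) s = 0),
      ∫ x, waveDensLE e A f l v τ x ∂μ ≤ (∫ x, waveDensLE e A f l v 0 x ∂μ)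
        * Real.exp (∫ s in τ..0, (2 * b s + 6 * γ s + M * f s)) := by
  obtain ⟨C, hC, hCb⟩ := exists_residual_bound e ν l
  refine ⟨√(∑ i, (κ i - ν i) ^ 2) + 2 + 3 * Fintype.card (MultiIndexLE l) * C, by positivity, ?_⟩
  intro A A' b φ γ f f' J v hW hJ hJ0 μ _ hκ hv hpde τ hτ K hK hsupp
  have h1 : SmoothOn univ fun (_ : G) (_ : ℝ) => (1 : ℝ) := SmoothOn.of_space contMDiff_const
  have key := weighted_energy_le (ι := MultiIndexLE l) hW hJ hJ0 hκ
    (w := fun K => derivK e K.2 v)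
    -- The source is defined as the defect in the equation, so the equation for e_K v is trivial and
    -- the content moves to the bound on the source.
    (R := fun K x τ => deriv (deriv (derivK e K.2 v x)) τ - (-b τ * deriv (derivK e K.2 v x) τ
      + (∑ i, ∑ j, A τ i j * frameD e i (frameD e j fun y => derivK e K.2 v y τ) x)
      - bil (A τ) ν (grad e (derivK e K.2 v) x τ) + φ τ * derivK e K.2 v x τ))
    (fun K => hv.derivK hJ K.2) (fun K x τ _ => by ring) hC
    (fun L x s hs => by
      have h := hCb hW hJ0 hv L x s hs
      rw [hpde.deriv_deriv_derivK hJ hJ0 hv L.2 hs x]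
      refine le_trans (le_of_eq ?_) h
      congr 1
      ring) h1 (fun _ _ => zero_le_one) hτ le_rfl
    (fun L x s _ => by
      have hg : grad e (fun (_ : G) (_ : ℝ) => (1 : ℝ)) x s = fun _ => 0 :=
        funext fun i => frameD_const i 1 x
      simp [hg, bil])
    hK (fun x hx s hs => Or.inr fun L => derivK_vanish hJ hv hK.isClosed.isOpen_compl
      (hJ0 hs.2) (fun y hy => hsupp y hy s hs) L.2 hx)
  simpa only [one_mul, waveDensLE] using key

end HigherOrder

end Bianchi

namespace Bianchi

/-! ### An eigenvalue bound from the trace of the square. -/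

section TraceInequality

open Matrix

variable {P a k N : Matrix (Fin 3) (Fin 3) ℝ}

theorem bil_eq_dotProduct (A : Matrix (Fin 3) (Fin 3) ℝ) (η ξ : Fin 3 → ℝ) :
    bil A η ξ = η ⬝ᵥ A *ᵥ ξ := by
  simp only [bil, dotProduct, mulVec, Finset.mul_sum]
  exact Finset.sum_congr rfl fun i _ => Finset.sum_congr rfl fun j _ => by ring

theorem trace_mul_vecMulVec (A : Matrix (Fin 3) (Fin 3) ℝ) (ξ η : Fin 3 → ℝ) :
    (A * vecMulVec ξ η).trace = bil A η ξ := by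
  rw [mul_vecMulVec, trace_vecMulVec, bil_eq_dotProduct, dotProduct_comm]

/-- Writing P = QᴴQ turns the trace into the squared Hilbert–Schmidt norm of the symmetric matrix Q
N Qᴴ. -/
theorem trace_sq_nonneg (hP : P.PosSemidef) (hN : Nᵀ = N) : 0 ≤ (P * N * (P * N)).trace := by
  obtain ⟨m, v, hv⟩ := posSemidef_iff_eq_sum_vecMulVec.1 hP
  obtain ⟨Q, rfl⟩ : ∃ Q : Matrix (Fin m) (Fin 3) ℝ, P = Qᴴ * Q := by
    refine ⟨Matrix.of v, ?_⟩
    rw [hv]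
    ext i j
    simp [Matrix.sum_apply, Matrix.mul_apply, vecMulVec_apply]
  clear hv
  have h1 : (Qᴴ * Q * N * (Qᴴ * Q * N)).trace = ((Q * N * Qᴴ)ᴴ * (Q * N * Qᴴ)).trace := by
    have h2 : (Q * N * Qᴴ)ᴴ = Q * N * Qᴴ := by
      simp [conjTranspose_eq_transpose_of_trivial, hN, Matrix.mul_assoc]
    rw [h2, show Qᴴ * Q * N * (Qᴴ * Q * N) = Qᴴ * (Q * N * Qᴴ * Q * N) by
      simp only [Matrix.mul_assoc], trace_mul_comm]
    simp only [Matrix.mul_assoc]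
  rw [h1]
  exact (posSemidef_conjTranspose_mul_self _).trace_nonneg

/-- Subtract from k its orthogonal projection αa + β ξ⊗ξ onto the span of a and ξ⊗ξ; the remainder
has nonnegative square trace. The projection has eigenvalues M, α, α with α = (θ - M)/2, so its
square trace is the left side. -/
theorem le_trace_sq (hP : P.PosSemidef) (hPa : P * a = 1) (ha : aᵀ = a) (hk : kᵀ = k)
    {ξ : Fin 3 → ℝ} (hξ : bil P ξ ξ = 1) :
    bil (P * k * P) ξ ξ ^ 2 + ((P * k).trace - bil (P * k * P) ξ ξ) ^ 2 / 2
      ≤ (P * k * (P * k)).trace := by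
  set M := bil (P * k * P) ξ ξ with hM
  set θ := (P * k).trace with hθ
  set α := (θ - M) / 2 with hα
  set β := M - α with hβ
  set V := vecMulVec ξ ξ with hV
  have hVt : Vᵀ = V := by ext i j; simp [hV, vecMulVec_apply, mul_comm]
  have h := trace_sq_nonneg (N := k - α • a - β • V) hP (by
    simp [transpose_sub, transpose_smul, ha, hk, hVt])
  have e1 : P * (k - α • a - β • V) = P * k - α • 1 - β • (P * V) := by
    simp [mul_sub, hPa]
  have t1 : (P * V).trace = 1 := by rw [hV, trace_mul_vecMulVec, hξ]
  have t2 : (P * k * (P * V)).trace = M := by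
    rw [hV, ← Matrix.mul_assoc, trace_mul_vecMulVec]
  have t3 : (P * V * (P * k)).trace = M := by rw [trace_mul_comm, t2]
  have t4 : (P * V * (P * V)).trace = 1 := by
    have : V * P * V = V := by
      rw [hV, vecMulVec_mul, vecMulVec_mul_vecMulVec]
      have : (ξ ᵥ* P) ⬝ᵥ ξ = 1 := by rw [← dotProduct_mulVec, ← bil_eq_dotProduct, hξ]
      rw [this, one_smul]
    rw [show P * V * (P * V) = P * (V * P * V) by simp only [Matrix.mul_assoc], this, t1]
  have t5 : (1 : Matrix (Fin 3) (Fin 3) ℝ).trace = 3 := by simp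
  rw [e1] at h
  have e2 : ((P * k - α • 1 - β • (P * V)) * (P * k - α • 1 - β • (P * V))).trace
      = (P * k * (P * k)).trace - 2 * α * θ - 2 * β * M + 3 * α ^ 2 + 2 * α * β + β ^ 2 := by
    simp only [sub_mul, mul_sub, Matrix.smul_mul, Matrix.mul_smul, trace_sub, trace_smul, mul_one,
      one_mul, t1, t2, t3, t4, t5, smul_eq_mul, ← hθ]
    ring
  rw [e2] at h
  rw [hβ, hα] at h
  nlinarith

/-- If `tr (k♯)² ≤ θ² (1 + γ)` with `θ = tr k♯ > 0`, then no eigenvalue of `k♯` exceeds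
`θ (1 + γ / 2)`. -/
theorem bil_sharp_le (hP : P.PosDef) (hPa : P * a = 1) (ha : aᵀ = a) (hk : kᵀ = k) {γ : ℝ}
    (hγ : 0 ≤ γ) (hθ : 0 < (P * k).trace)
    (h : (P * k * (P * k)).trace ≤ (P * k).trace ^ 2 * (1 + γ)) (ξ : Fin 3 → ℝ) :
    bil (P * k * P) ξ ξ ≤ (P * k).trace * (1 + γ / 2) * bil P ξ ξ := by
  set θ := (P * k).trace
  have hunit : ∀ η : Fin 3 → ℝ, bil P η η = 1 → bil (P * k * P) η η ≤ θ * (1 + γ / 2) := by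
    intro η hη
    have h1 := (le_trace_sq hP.posSemidef hPa ha hk hη).trans h
    change bil (P * k * P) η η ^ 2 + (θ - bil (P * k * P) η η) ^ 2 / 2 ≤ _ at h1
    set M := bil (P * k * P) η η
    -- With M = θ(1 + δ) the inequality `h1` says 2δ + (3/2)δ² ≤ γ, which excludes δ > γ/2.
    by_contra! hlt
    have h2 : 0 < M - θ * (1 + γ / 2) := by linarith
    have h3 : 0 < θ * (1 + γ / 2) := by positivity
    have h4 : 0 ≤ θ ^ 2 * γ := by positivity
    have h5 : 0 ≤ θ ^ 2 * γ ^ 2 := by positivity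
    nlinarith [mul_pos h2 hθ, mul_pos h2 h3, mul_pos h2 h2]
  by_cases hξ : ξ = 0
  · simp [hξ, bil]
  have hX : 0 < bil P ξ ξ := by
    rw [bil_eq_dotProduct]
    simpa using hP.dotProduct_mulVec_pos hξ
  have hs : 0 < √(bil P ξ ξ) := Real.sqrt_pos.2 hX
  have hscale : ∀ A : Matrix (Fin 3) (Fin 3) ℝ,
      bil A (fun i => ξ i / √(bil P ξ ξ)) (fun i => ξ i / √(bil P ξ ξ)) = bil A ξ ξ / bil P ξ ξ := by
    intro A
    conv_rhs => rw [← Real.sq_sqrt hX.le]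
    simp only [bil, Finset.sum_div]
    refine Finset.sum_congr rfl fun i _ => Finset.sum_congr rfl fun j _ => ?_
    field_simp
  have h1 := hunit _ ((hscale P).trans (div_self hX.ne'))
  rwa [hscale, div_le_iff₀ hX] at h1

end TraceInequality

end Bianchi

namespace Bianchi

/-! ### Derivatives of inverses, traces and determinants. -/

section MatrixCalculus

open Matrix

variable {n : Type*} [Fintype n] [DecidableEq n] {M : ℝ → Matrix n n ℝ} {J : Set ℝ}

theorem contDiffOn_det (h : ∀ i j, ContDiffOn ℝ ∞ (fun s => M s i j) J) :
    ContDiffOn ℝ ∞ (fun s => (M s).det) J := by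
  simp only [det_apply]
  exact ContDiffOn.sum fun σ _ => (contDiffOn_prod fun i _ => h _ _).const_smul _

theorem contDiffOn_adjugate (h : ∀ i j, ContDiffOn ℝ ∞ (fun s => M s i j) J) (i j : n) :
    ContDiffOn ℝ ∞ (fun s => (M s).adjugate i j) J := by
  simp only [adjugate_apply]
  refine contDiffOn_det fun k l => ?_
  simp only [updateRow_apply]
  split_ifs
  · exact contDiffOn_const
  · exact h k l

theorem contDiffOn_matrix_inv (h : ∀ i j, ContDiffOn ℝ ∞ (fun s => M s i j) J)
    (hd : ∀ s ∈ J, (M s).det ≠ 0) (i j : n) : ContDiffOn ℝ ∞ (fun s => (M s)⁻¹ i j) J := by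
  simp only [inv_def, Matrix.smul_apply, smul_eq_mul, Ring.inverse_eq_inv']
  exact ((contDiffOn_det h).inv hd).mul (contDiffOn_adjugate h i j)

variable {t : ℝ} {M' N' : Matrix n n ℝ} {N : ℝ → Matrix n n ℝ}

theorem hasDerivAt_matrix_mul (hM : ∀ i j, HasDerivAt (fun s => M s i j) (M' i j) t)
    (hN : ∀ i j, HasDerivAt (fun s => N s i j) (N' i j) t) (i j : n) :
    HasDerivAt (fun s => (M s * N s) i j) ((M' * N t + M t * N') i j) t := by
  simp only [Matrix.add_apply, Matrix.mul_apply, ← Finset.sum_add_distrib]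
  exact HasDerivAt.fun_sum fun k _ => (hM i k).mul (hN k j)

theorem hasDerivAt_trace (hM : ∀ i j, HasDerivAt (fun s => M s i j) (M' i j) t) :
    HasDerivAt (fun s => (M s).trace) M'.trace t := by
  simp only [Matrix.trace, Matrix.diag_apply]
  exact HasDerivAt.fun_sum fun i _ => hM i i

theorem hasDerivAt_matrix_inv (hM : ∀ i j, HasDerivAt (fun s => M s i j) (M' i j) t)
    (hd : ∀ᶠ s in 𝓝 t, (M s).det ≠ 0)
    (hinv : ∀ i j, DifferentiableAt ℝ (fun s => (M s)⁻¹ i j) t) (i j : n) :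
    HasDerivAt (fun s => (M s)⁻¹ i j) ((-((M t)⁻¹ * M' * (M t)⁻¹)) i j) t := by
  set Q : Matrix n n ℝ := Matrix.of fun i j => deriv (fun s => (M s)⁻¹ i j) t with hQ
  have h1 : ∀ i j, HasDerivAt (fun s => (M s)⁻¹ i j) (Q i j) t := fun i j => (hinv i j).hasDerivAt
  have h2 : Q * M t + (M t)⁻¹ * M' = 0 := by
    ext i j
    refine (hasDerivAt_matrix_mul h1 hM i j).unique ?_
    refine (hasDerivAt_const t ((1 : Matrix n n ℝ) i j)).congr_of_eventuallyEq ?_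
    filter_upwards [hd] with s hs
    rw [Matrix.nonsing_inv_mul _ (isUnit_iff_ne_zero.2 hs)]
  have h3 : Q = -((M t)⁻¹ * M' * (M t)⁻¹) := by
    have h4 : Q * M t = -((M t)⁻¹ * M') := eq_neg_of_add_eq_zero_left h2
    have h5 : Q = Q * M t * (M t)⁻¹ := by
      rw [Matrix.mul_assoc, Matrix.mul_nonsing_inv _ (isUnit_iff_ne_zero.2 hd.self_of_nhds), mul_one]
    rw [h5, h4, Matrix.neg_mul]
  rw [← h3]
  exact h1 i j

theorem hasDerivAt_det_fin_three {M : ℝ → Matrix (Fin 3) (Fin 3) ℝ} {M' : Matrix (Fin 3) (Fin 3) ℝ}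
    (hM : ∀ i j, HasDerivAt (fun s => M s i j) (M' i j) t) :
    HasDerivAt (fun s => (M s).det) ((M t).adjugate * M').trace t := by
  simp only [det_fin_three]
  have h := fun i j k l m n => ((hM i j).mul (hM k l)).mul (hM m n)
  refine ((((((h 0 0 1 1 2 2).sub (h 0 0 1 2 2 1)).sub (h 0 1 1 0 2 2)).add
    (h 0 1 1 2 2 0)).add (h 0 2 1 0 2 1)).sub (h 0 2 1 1 2 0)).congr_deriv ?_
  simp only [adjugate_fin_three, Matrix.trace, Matrix.diag_apply, Matrix.mul_apply,
    Fin.sum_univ_three, Matrix.of_apply, Matrix.cons_val, Pi.mul_apply]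
  ring

end MatrixCalculus

end Bianchi

/-! ### Second fundamental form, mean curvature and volume. -/

namespace BianchiSpacetime

variable {G : Type*} [TopologicalSpace G] [ChartedSpace (EuclideanSpace ℝ (Fin 3)) G] [Group G]
  (B : BianchiSpacetime G) {t : ℝ}

theorem isOpen_I : IsOpen B.I :=
  (isOpen_Ioi.preimage continuous_coe_real_ereal).inter
    (isOpen_Iio.preimage continuous_coe_real_ereal)

theorem posDef (ht : t ∈ B.I) : (B.a t).PosDef := B.posDef_a t ht.1 ht.2

theorem det_pos (ht : t ∈ B.I) : 0 < (B.a t).det := (B.posDef ht).det_pos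

theorem isUnit_det (ht : t ∈ B.I) : IsUnit (B.a t).det := isUnit_iff_ne_zero.2 (B.det_pos ht).ne'

theorem transpose_a (ht : t ∈ B.I) : (B.a t).transpose = B.a t := by
  have h := (B.posDef ht).isHermitian
  rwa [Matrix.IsHermitian, Matrix.conjTranspose_eq_transpose_of_trivial] at h

theorem metric_inv (h : IsUnit (B.a t).det) :
    (B.metric t)⁻¹ = Matrix.fromBlocks (-1) 0 0 (B.a t)⁻¹ := by
  refine Matrix.inv_eq_right_inv ?_
  rw [metric, Matrix.fromBlocks_multiply]
  simp [Matrix.mul_nonsing_inv _ h, Matrix.fromBlocks_one]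

theorem kBar_apply (i j : Fin 3) : B.kBar t i j = 1 / 2 * deriv (fun s => B.a s j i) t := by
  simp [kBar, Bianchi.koszul, metric, stD, stConst]

theorem kBar_symm (ht : t ∈ B.I) (i j : Fin 3) : B.kBar t i j = B.kBar t j i := by
  have h : (fun s => B.a s j i) =ᶠ[𝓝 t] fun s => B.a s i j := by
    filter_upwards [B.isOpen_I.mem_nhds ht] with s hs
    exact congrFun (congrFun (B.transpose_a hs) i) j
  rw [kBar_apply, kBar_apply, h.deriv_eq]

theorem kBar_transpose (ht : t ∈ B.I) : (B.kBar t).transpose = B.kBar t := by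
  ext i j
  exact B.kBar_symm ht j i

theorem contDiffOn_kBar (i j : Fin 3) : ContDiffOn ℝ ∞ (fun s => B.kBar s i j) B.I := by
  simp only [kBar_apply]
  exact contDiffOn_const.mul ((B.smooth_a j i).deriv_of_isOpen B.isOpen_I (by simp))

theorem contDiffOn_inv (i j : Fin 3) : ContDiffOn ℝ ∞ (fun s => (B.a s)⁻¹ i j) B.I :=
  Bianchi.contDiffOn_matrix_inv B.smooth_a (fun _ hs => (B.det_pos hs).ne') i j

theorem contDiffOn_theta : ContDiffOn ℝ ∞ B.theta B.I :=
  ContDiffOn.sum fun i _ => ContDiffOn.sum fun j _ => (B.contDiffOn_inv i j).mul (B.contDiffOn_kBar i j)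

theorem hasDerivAt_of_contDiffOn {c : ℝ → ℝ} (hc : ContDiffOn ℝ ∞ c B.I) (ht : t ∈ B.I) :
    HasDerivAt c (deriv c t) t :=
  ((hc.contDiffAt (B.isOpen_I.mem_nhds ht)).differentiableAt (by simp)).hasDerivAt

theorem hasDerivAt_a (ht : t ∈ B.I) (i j : Fin 3) :
    HasDerivAt (fun s => B.a s i j) (((2 : ℝ) • B.kBar t) i j) t := by
  have h := B.hasDerivAt_of_contDiffOn (B.smooth_a i j) ht
  refine h.congr_deriv ?_
  rw [Matrix.smul_apply, B.kBar_symm ht, kBar_apply, smul_eq_mul]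
  ring

theorem hasDerivAt_inv (ht : t ∈ B.I) (i j : Fin 3) :
    HasDerivAt (fun s => (B.a s)⁻¹ i j)
      (((-2 : ℝ) • ((B.a t)⁻¹ * B.kBar t * (B.a t)⁻¹)) i j) t := by
  have h := Bianchi.hasDerivAt_matrix_inv (B.hasDerivAt_a ht)
    (by filter_upwards [B.isOpen_I.mem_nhds ht] with s hs using (B.det_pos hs).ne')
    (fun i j => (B.hasDerivAt_of_contDiffOn (B.contDiffOn_inv i j) ht).differentiableAt) i j
  refine h.congr_deriv ?_
  simp

theorem theta_eq_trace (ht : t ∈ B.I) : B.theta t = ((B.a t)⁻¹ * B.kBar t).trace := by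
  simp only [theta, Matrix.trace, Matrix.diag_apply, Matrix.mul_apply]
  exact Finset.sum_congr rfl fun i _ => Finset.sum_congr rfl fun j _ => by rw [B.kBar_symm ht]

/-- Jacobi's formula with ∂_t a = 2k̄: the logarithmic derivative of det a is 2θ. -/
theorem hasDerivAt_tau (ht : t ∈ B.I) : HasDerivAt B.tau (B.theta t / 3) t := by
  have hd := B.det_pos ht
  have h1 := Bianchi.hasDerivAt_det_fin_three (B.hasDerivAt_a ht)
  have h2 := ((h1.sqrt hd.ne').log (Real.sqrt_pos.2 hd).ne').const_mul (1 / 3)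
  refine h2.congr_deriv ?_
  have h3 : (B.a t).adjugate = (B.a t).det • (B.a t)⁻¹ := by
    rw [Matrix.inv_def, smul_smul, Ring.inverse_eq_inv', mul_inv_cancel₀ hd.ne', one_smul]
  rw [h3, theta_eq_trace B ht]
  simp only [Matrix.smul_mul, Matrix.mul_smul, Matrix.trace_smul, smul_eq_mul]
  have h4 : √(B.a t).det ≠ 0 := (Real.sqrt_pos.2 hd).ne'
  have h5 : (B.a t).det = √(B.a t).det * √(B.a t).det := (Real.mul_self_sqrt hd.le).symm
  set r := √(B.a t).det
  rw [h5]
  field_simp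

end BianchiSpacetime

/-! ### Ricci curvature, Raychaudhuri's equation and the Hamiltonian constraint. -/

namespace BianchiSpacetime

variable {G : Type*} [TopologicalSpace G] [ChartedSpace (EuclideanSpace ℝ (Fin 3)) G] [Group G]
  (B : BianchiSpacetime G) {t : ℝ}

/-- The connection coefficients of the spacetime metric. -/
abbrev conn (γ α β : Idx) (t : ℝ) : ℝ := Bianchi.christoffel stD B.stConst B.metric γ α β t

/-- The connection coefficients of the metric of `G × {t}`. -/
abbrev spatialConn (k i j : Fin 3) (t : ℝ) : ℝ :=
  Bianchi.christoffel (fun _ _ _ => 0) (Bianchi.structConst B.e) B.a k i j t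

/-- The mixed components `k̄^i_j` of the second fundamental form. -/
def weingarten (t : ℝ) : Matrix (Fin 3) (Fin 3) ℝ := (B.a t)⁻¹ * B.kBar t

theorem conn_time (ht : t ∈ B.I) (i j : Fin 3) :
    B.conn (.inl ()) (.inr i) (.inr j) t = B.kBar t i j := by
  rw [B.kBar_symm ht, kBar_apply]
  simp only [conn, Bianchi.christoffel, metric_inv B (B.isUnit_det ht)]
  simp [Bianchi.koszul, metric, stD, stConst]

theorem conn_time_left (ht : t ∈ B.I) (α : Idx) : B.conn (.inl ()) (.inl ()) α t = 0 := by
  simp only [conn, Bianchi.christoffel, metric_inv B (B.isUnit_det ht)]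
  rcases α with _ | i <;> simp [Bianchi.koszul, metric, stD, stConst]

theorem conn_time_right (ht : t ∈ B.I) (α : Idx) : B.conn (.inl ()) α (.inl ()) t = 0 := by
  simp only [conn, Bianchi.christoffel, metric_inv B (B.isUnit_det ht)]
  rcases α with _ | i <;> simp [Bianchi.koszul, metric, stD, stConst]

theorem conn_space_zero (ht : t ∈ B.I) (i : Fin 3) : B.conn (.inr i) (.inl ()) (.inl ()) t = 0 := by
  simp only [conn, Bianchi.christoffel, metric_inv B (B.isUnit_det ht)]
  simp [Bianchi.koszul, metric, stD, stConst]

theorem conn_mixed_right (ht : t ∈ B.I) (k i : Fin 3) :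
    B.conn (.inr k) (.inr i) (.inl ()) t = B.weingarten t k i := by
  have h : B.weingarten t k i = ∑ m, (B.a t)⁻¹ k m * B.kBar t i m := by
    simp only [weingarten, Matrix.mul_apply]
    exact Finset.sum_congr rfl fun m _ => by rw [B.kBar_symm ht]
  rw [h]
  simp only [conn, Bianchi.christoffel, metric_inv B (B.isUnit_det ht)]
  simp [Bianchi.koszul, metric, stD, stConst, kBar_apply]

theorem conn_mixed_left (ht : t ∈ B.I) (k i : Fin 3) :
    B.conn (.inr k) (.inl ()) (.inr i) t = B.weingarten t k i := by
  simp only [conn, Bianchi.christoffel, metric_inv B (B.isUnit_det ht), weingarten, Matrix.mul_apply]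
  simp [Bianchi.koszul, metric, stD, stConst, kBar_apply]

theorem conn_space (ht : t ∈ B.I) (k i j : Fin 3) :
    B.conn (.inr k) (.inr i) (.inr j) t = B.spatialConn k i j t := by
  simp only [conn, Bianchi.christoffel, metric_inv B (B.isUnit_det ht)]
  simp [Bianchi.koszul, metric, stD, stConst]

theorem theta_eq_trace_weingarten (ht : t ∈ B.I) : B.theta t = (B.weingarten t).trace :=
  B.theta_eq_trace ht

theorem contDiffOn_weingarten (i j : Fin 3) : ContDiffOn ℝ ∞ (fun s => B.weingarten s i j) B.I := by
  simp only [weingarten, Matrix.mul_apply]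
  exact ContDiffOn.sum fun m _ => (B.contDiffOn_inv i m).mul (B.contDiffOn_kBar m j)

theorem deriv_theta (ht : t ∈ B.I) :
    deriv B.theta t = ∑ i, deriv (fun s => B.weingarten s i i) t := by
  have h : B.theta =ᶠ[𝓝 t] fun s => ∑ i, B.weingarten s i i := by
    filter_upwards [B.isOpen_I.mem_nhds ht] with s hs using B.theta_eq_trace_weingarten hs
  rw [h.deriv_eq]
  exact (HasDerivAt.fun_sum fun i _ =>
    B.hasDerivAt_of_contDiffOn (B.contDiffOn_weingarten i i) ht).deriv

theorem deriv_theta_eq_trace (ht : t ∈ B.I) :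
    deriv B.theta t = -2 * (B.weingarten t * B.weingarten t).trace
      + ((B.a t)⁻¹ * Matrix.of fun i j => deriv (fun s => B.kBar s i j) t).trace := by
  have h : B.theta =ᶠ[𝓝 t] fun s => ((B.a s)⁻¹ * B.kBar s).trace := by
    filter_upwards [B.isOpen_I.mem_nhds ht] with s hs using B.theta_eq_trace hs
  have h1 := Bianchi.hasDerivAt_trace (Bianchi.hasDerivAt_matrix_mul (B.hasDerivAt_inv ht)
    (N' := Matrix.of fun i j => deriv (fun s => B.kBar s i j) t)
    (fun i j => B.hasDerivAt_of_contDiffOn (B.contDiffOn_kBar i j) ht))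
  rw [h.deriv_eq, h1.deriv, Matrix.trace_add]
  simp [weingarten, Matrix.mul_assoc]

theorem ric_time (ht : t ∈ B.I) : B.ric (.inl ()) (.inl ()) t
    = -deriv B.theta t - (B.weingarten t * B.weingarten t).trace := by
  have hev : ∀ i, (fun s => B.conn (.inr i) (.inr i) (.inl ()) s) =ᶠ[𝓝 t]
      fun s => B.weingarten s i i := fun i => by
    filter_upwards [B.isOpen_I.mem_nhds ht] with s hs using B.conn_mixed_right hs i i
  have hd := fun i => (hev i).deriv_eq
  simp only [conn] at hd
  simp only [ric, Bianchi.ricci, Bianchi.riemann, Fintype.sum_sum_type, stD, Finset.univ_unique,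
    Finset.sum_singleton, PUnit.default_eq_unit, stConst, hd]
  have h1 := B.conn_mixed_left ht
  have h2 := B.conn_mixed_right ht
  have h3 := B.conn_space_zero ht
  have h4 := B.conn_time_right ht
  have h5 := B.conn_time_left ht
  simp only [conn] at h1 h2 h3 h4 h5
  simp only [h1, h2, h3, h4, h5, B.deriv_theta ht, Matrix.trace, Matrix.diag_apply, Matrix.mul_apply]
  have e1 : ∑ i, ∑ m, B.weingarten t m i * B.weingarten t i m
      = ∑ i, ∑ m, B.weingarten t i m * B.weingarten t m i :=
    Finset.sum_congr rfl fun i _ => Finset.sum_congr rfl fun j _ => mul_comm _ _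
  simp only [Finset.sum_add_distrib, zero_mul, mul_zero, sub_zero, zero_sub,
    add_zero, sub_self, zero_add, Finset.sum_const_zero, Finset.sum_neg_distrib, e1]
  ring

theorem ric_space (ht : t ∈ B.I) (j k : Fin 3) : B.ric (.inr j) (.inr k) t
    = Bianchi.ricci (fun _ _ _ => 0) (Bianchi.structConst B.e) B.a j k t
      + deriv (fun s => B.kBar s j k) t + B.theta t * B.kBar t j k
      - 2 * (B.kBar t * B.weingarten t) j k := by
  have hev : (fun s => B.conn (.inl ()) (.inr j) (.inr k) s) =ᶠ[𝓝 t] fun s => B.kBar s j k := by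
    filter_upwards [B.isOpen_I.mem_nhds ht] with s hs using B.conn_time hs j k
  have hd := hev.deriv_eq
  simp only [conn] at hd
  simp only [ric, Bianchi.ricci, Bianchi.riemann, Fintype.sum_sum_type, stD, Finset.univ_unique,
    Finset.sum_singleton, PUnit.default_eq_unit, stConst, hd]
  have h1 := B.conn_mixed_left ht
  have h2 := B.conn_mixed_right ht
  have h4 := B.conn_time_right ht
  have h5 := B.conn_time_left ht
  have h6 := B.conn_time ht
  have h7 := B.conn_space ht
  simp only [conn] at h1 h2 h4 h5 h6 h7
  simp only [h1, h2, h4, h5, h6, h7, B.theta_eq_trace_weingarten ht, Matrix.trace,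
    Matrix.diag_apply, Matrix.mul_apply]
  have e1 : ∑ m, B.weingarten t m k * B.kBar t j m = ∑ m, B.kBar t j m * B.weingarten t m k :=
    Finset.sum_congr rfl fun i _ => mul_comm _ _
  have e2 : ∑ m, B.kBar t m k * B.weingarten t m j = ∑ m, B.kBar t j m * B.weingarten t m k := by
    have h8 : B.kBar t * (B.a t)⁻¹ * B.kBar t = B.kBar t * B.weingarten t := by
      rw [weingarten, Matrix.mul_assoc]
    have h9 : ∀ i l, B.weingarten t i l = (B.kBar t * (B.a t)⁻¹) l i := by
      intro i l
      have : (B.weingarten t).transpose = B.kBar t * (B.a t)⁻¹ := by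
        rw [weingarten, Matrix.transpose_mul, B.kBar_transpose ht, Matrix.transpose_nonsing_inv,
          B.transpose_a ht]
      rw [← this]
      rfl
    have h10 := congrFun (congrFun h8 j) k
    rw [Matrix.mul_apply, Matrix.mul_apply] at h10
    rw [← h10]
    exact Finset.sum_congr rfl fun m _ => by rw [h9, mul_comm]
  simp only [Finset.sum_add_distrib, Finset.sum_sub_distrib, zero_mul, mul_zero, sub_zero, zero_sub,
    sub_self, zero_add, Finset.sum_neg_distrib, e1, e2,
    ← Finset.mul_sum]
  ring

/-- Contracting ∂_t k̄ with a^{-1} gives θ' + 2 tr K², because a^{-1} also varies; this removes the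
quadratic term -2 tr K² of the spatial Ricci curvature. -/
theorem trace_ric_space (ht : t ∈ B.I) :
    ∑ j, ∑ k, (B.a t)⁻¹ j k * B.ric (.inr j) (.inr k) t
      = B.spatialScal t + deriv B.theta t + B.theta t ^ 2 := by
  have hsymm : ∀ j k, (B.a t)⁻¹ j k = (B.a t)⁻¹ k j := by
    intro j k
    have : ((B.a t)⁻¹).transpose = (B.a t)⁻¹ := by
      rw [Matrix.transpose_nonsing_inv, B.transpose_a ht]
    exact congrFun (congrFun this.symm j) k
  have e1 : ∀ N : Matrix (Fin 3) (Fin 3) ℝ,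
      ∑ j, ∑ k, (B.a t)⁻¹ j k * N j k = ((B.a t)⁻¹ * N).trace := by
    intro N
    simp only [Matrix.trace, Matrix.diag_apply, Matrix.mul_apply]
    rw [Finset.sum_comm]
    exact Finset.sum_congr rfl fun i _ => Finset.sum_congr rfl fun j _ => by rw [hsymm]
  have e2 : ∑ j, ∑ k, (B.a t)⁻¹ j k * B.ric (.inr j) (.inr k) t
      = B.spatialScal t + (∑ j, ∑ k, (B.a t)⁻¹ j k * deriv (fun s => B.kBar s j k) t)
        + B.theta t * B.theta t - 2 * ∑ j, ∑ k, (B.a t)⁻¹ j k * (B.kBar t * B.weingarten t) j k := by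
    nth_rewrite 2 [theta]
    simp only [B.ric_space ht, spatialScal, Bianchi.scalarCurv, Finset.mul_sum,
      ← Finset.sum_add_distrib, ← Finset.sum_sub_distrib]
    exact Finset.sum_congr rfl fun i _ => Finset.sum_congr rfl fun j _ => by ring
  rw [e2, e1 (B.kBar t * B.weingarten t), B.deriv_theta_eq_trace ht,
    ← e1 (Matrix.of fun i j => deriv (fun s => B.kBar s i j) t)]
  have e3 : ((B.a t)⁻¹ * (B.kBar t * B.weingarten t)).trace
      = (B.weingarten t * B.weingarten t).trace := by
    conv_rhs => rw [weingarten]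
    rw [Matrix.mul_assoc, weingarten]
  rw [e3]
  simp only [Matrix.of_apply]
  ring

theorem scal_eq (ht : t ∈ B.I) : B.scal t = -B.ric (.inl ()) (.inl ()) t
    + ∑ j, ∑ k, (B.a t)⁻¹ j k * B.ric (.inr j) (.inr k) t := by
  simp only [scal, Bianchi.scalarCurv, metric_inv B (B.isUnit_det ht)]
  simp [ric]

variable {Λ : ℝ} {T : ℝ → Matrix Idx Idx ℝ}

theorem inv_contract_a (ht : t ∈ B.I) : ∑ i, ∑ j, (B.a t)⁻¹ i j * B.a t i j = 3 := by
  have h : ((B.a t)⁻¹ * B.a t).trace = 3 := by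
    rw [Matrix.nonsing_inv_mul _ (B.isUnit_det ht)]
    simp
  rw [← h]
  simp only [Matrix.trace, Matrix.diag_apply, Matrix.mul_apply]
  refine Finset.sum_congr rfl fun i _ => Finset.sum_congr rfl fun j _ => ?_
  rw [← congrFun (congrFun (B.transpose_a ht) j) i]
  rfl

/-- Raychaudhuri's equation. -/
theorem raychaudhuri (hE : B.SolvesEinstein Λ T) (ht : t ∈ B.I) :
    deriv B.theta t = -(B.weingarten t * B.weingarten t).trace
      - (rho T t + 3 * B.pBar T t) / 2 + Λ ∧
    B.spatialScal t + B.theta t ^ 2 - (B.weingarten t * B.weingarten t).trace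
      = 2 * rho T t + 2 * Λ := by
  -- The 00 component and the spatial trace of Einstein's equations. After insertion of the scalar
  -- curvature the former is the Hamiltonian constraint, and together they determine θ'.
  have h0 : B.ric (.inl ()) (.inl ()) t + 1 / 2 * B.scal t - Λ = rho T t := by
    have := hE t ht (.inl ()) (.inl ())
    simp only [metric, Matrix.fromBlocks_apply₁₁, Matrix.neg_apply, Matrix.one_apply_eq] at this
    rw [rho, ← this]
    ring
  have h3 : ∑ j, ∑ k, (B.a t)⁻¹ j k * B.ric (.inr j) (.inr k) t - 3 / 2 * B.scal t + 3 * Λ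
      = 3 * B.pBar T t := by
    have h4 : ∀ i j, T t (.inr i) (.inr j) = B.ric (.inr i) (.inr j) t
        + (Λ - 1 / 2 * B.scal t) * B.a t i j := by
      intro i j
      rw [← hE t ht (.inr i) (.inr j)]
      simp only [metric, Matrix.fromBlocks_apply₂₂]
      ring
    have h5 : 3 * B.pBar T t = ∑ i, ∑ j, ((B.a t)⁻¹ i j * B.ric (.inr i) (.inr j) t
        + (Λ - 1 / 2 * B.scal t) * ((B.a t)⁻¹ i j * B.a t i j)) := by
      rw [pBar, ← mul_assoc, show (3 : ℝ) * (1 / 3) = 1 by norm_num, one_mul]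
      refine Finset.sum_congr rfl fun i _ => Finset.sum_congr rfl fun j _ => ?_
      rw [h4]
      ring
    rw [h5]
    simp only [Finset.sum_add_distrib, ← Finset.mul_sum, B.inv_contract_a ht]
    ring
  rw [B.scal_eq ht, B.ric_time ht, B.trace_ric_space ht] at *
  constructor <;> linarith

theorem shearSq_eq (ht : t ∈ B.I) (hθ : B.theta t ≠ 0) :
    B.shearSq t = (B.weingarten t * B.weingarten t).trace / B.theta t ^ 2 - 1 / 3 := by
  have hs : (B.shear t) = (B.theta t)⁻¹ • (B.kBar t - (1 / 3 * B.theta t) • B.a t) := by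
    ext i j
    simp [shear, div_eq_inv_mul]
  have hst : ((B.a t)⁻¹).transpose = (B.a t)⁻¹ := by
    rw [Matrix.transpose_nonsing_inv, B.transpose_a ht]
  have hsy : ∀ i j, (B.a t)⁻¹ i j = (B.a t)⁻¹ j i := fun i j =>
    congrFun (congrFun hst.symm i) j
  have h1 : B.shearSq t = ((B.a t)⁻¹ * B.shear t * ((B.a t)⁻¹ * B.shear t)).trace := by
    have hsh : ∀ i j, B.shear t i j = B.shear t j i := by
      intro i j
      simp only [shear, Matrix.of_apply]
      rw [B.kBar_symm ht, ← congrFun (congrFun (B.transpose_a ht) i) j]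
      rfl
    simp only [shearSq, Matrix.trace, Matrix.diag_apply, Matrix.mul_apply, Finset.sum_mul,
      Finset.mul_sum]
    refine Finset.sum_congr rfl fun i _ => ?_
    refine ((Finset.sum_congr rfl fun j _ => Finset.sum_comm).trans Finset.sum_comm).trans ?_
    refine Finset.sum_congr rfl fun l _ => Finset.sum_congr rfl fun j _ =>
      Finset.sum_congr rfl fun k _ => ?_
    rw [hsh i j, hsy j l]
    ring
  have h2 : (B.a t)⁻¹ * B.shear t
      = (B.theta t)⁻¹ • (B.weingarten t - (1 / 3 * B.theta t) • 1) := by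
    rw [hs, Matrix.mul_smul, mul_sub, Matrix.mul_smul, Matrix.nonsing_inv_mul _ (B.isUnit_det ht)]
    rfl
  rw [h1, h2]
  simp only [Matrix.smul_mul, Matrix.mul_smul, sub_mul, mul_sub, mul_one, one_mul,
    Matrix.trace_smul, Matrix.trace_sub, ← B.theta_eq_trace_weingarten ht, smul_eq_mul]
  simp
  field_simp
  ring

/-- The shear part of q equals 3 tr K²/θ² - 1, and the matter terms in q are -3/θ² times those in
Raychaudhuri's equation, so q = -1 - 3θ'/θ². -/
theorem two_sub_q_eq (hE : B.SolvesEinstein Λ T) (ht : t ∈ B.I) (hθ : B.theta t ≠ 0) :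
    2 - B.q Λ T t = 3 + 3 * deriv B.theta t / B.theta t ^ 2 := by
  rw [q, B.shearSq_eq ht hθ, omegaTot, (B.raychaudhuri hE ht).1]
  field_simp
  ring

end BianchiSpacetime

/-! ### The wave operator in the frame. -/

namespace Bianchi

variable {G : Type*} [TopologicalSpace G] [ChartedSpace (EuclideanSpace ℝ (Fin 3)) G] [Group G]

theorem structConst_antisymm [LieGroup (𝓡 3) ∞ G] (e : Basis (Fin 3) ℝ (GroupLieAlgebra (𝓡 3) G))
    (i j k : Fin 3) : structConst e i j k = -structConst e j i k := by
  have : LieGroup (𝓡 3) (minSmoothness ℝ 3) G := LieGroup.of_le (n := ∞) (by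
    simpa using WithTop.coe_le_coe.2 (le_top : (3 : ℕ∞) ≤ ⊤))
  have h : ⁅e i, e j⁆ = -⁅e j, e i⁆ := (lie_skew (e i) (e j)).symm
  rw [structConst, structConst, h, map_neg]
  rfl

/-- The covector `ν_m = (γ^i_{mi} - γ^i_{im}) / 2`. -/
def traceCovector (e : Basis (Fin 3) ℝ (GroupLieAlgebra (𝓡 3) G)) (m : Fin 3) : ℝ :=
  1 / 2 * ∑ i, (structConst e m i i - structConst e i m i)

end Bianchi

namespace BianchiSpacetime

variable {G : Type*} [TopologicalSpace G] [ChartedSpace (EuclideanSpace ℝ (Fin 3)) G] [Group G]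
  (B : BianchiSpacetime G) {t : ℝ}

theorem inv_symm (ht : t ∈ B.I) (i j : Fin 3) : (B.a t)⁻¹ i j = (B.a t)⁻¹ j i := by
  have : ((B.a t)⁻¹).transpose = (B.a t)⁻¹ := by
    rw [Matrix.transpose_nonsing_inv, B.transpose_a ht]
  exact congrFun (congrFun this.symm i) j

theorem inv_mul_apply (ht : t ∈ B.I) (i j : Fin 3) :
    ∑ m, (B.a t)⁻¹ i m * B.a t m j = if i = j then 1 else 0 := by
  rw [← Matrix.mul_apply, Matrix.nonsing_inv_mul _ (B.isUnit_det ht), Matrix.one_apply]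

/-- Of the three structure constant terms in Koszul's formula, one is antisymmetric in i, j and dies
against a^{ij}. In the other two the metric cancels its inverse and traces of structure constants
remain. Hence the covector ν in the first order part of the wave operator does not depend on time.
-/
theorem trace_spatialConn [LieGroup (𝓡 3) ∞ G] (ht : t ∈ B.I) (k : Fin 3) :
    ∑ i, ∑ j, (B.a t)⁻¹ i j * B.spatialConn k i j t
      = ∑ m, (B.a t)⁻¹ k m * Bianchi.traceCovector B.e m := by
  have hkos : ∀ m, ∑ i, ∑ j, (B.a t)⁻¹ i j * Bianchi.koszul (fun _ _ _ => 0)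
      (Bianchi.structConst B.e) B.a i j m t = Bianchi.traceCovector B.e m := by
    intro m
    set c := Bianchi.structConst B.e with hc
    have e1 : ∑ i, ∑ j, ∑ n, (B.a t)⁻¹ i j * (c i j n * B.a t n m) = 0 := by
      have h : ∑ i, ∑ j, ∑ n, (B.a t)⁻¹ i j * (c i j n * B.a t n m)
          = -∑ i, ∑ j, ∑ n, (B.a t)⁻¹ i j * (c i j n * B.a t n m) := by
        conv_lhs => rw [Finset.sum_comm]
        simp only [← Finset.sum_neg_distrib]
        refine Finset.sum_congr rfl fun i _ => Finset.sum_congr rfl fun j _ =>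
          Finset.sum_congr rfl fun n _ => ?_
        rw [B.inv_symm ht j i, hc, Bianchi.structConst_antisymm B.e j i n]
        ring
      linarith
    have e2 : ∑ i, ∑ j, ∑ n, (B.a t)⁻¹ i j * (c j m n * B.a t n i) = ∑ j, c j m j := by
      rw [Finset.sum_comm]
      refine Finset.sum_congr rfl fun j _ => ?_
      rw [Finset.sum_comm]
      have : ∀ n, ∑ i, (B.a t)⁻¹ i j * (c j m n * B.a t n i) = c j m n * if j = n then 1 else 0 := by
        intro n
        rw [← B.inv_mul_apply ht, Finset.mul_sum]
        refine Finset.sum_congr rfl fun i _ => ?_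
        rw [B.inv_symm ht, ← congrFun (congrFun (B.transpose_a ht) n) i, Matrix.transpose_apply]
        ring
      simp [this]
    have e3 : ∑ i, ∑ j, ∑ n, (B.a t)⁻¹ i j * (c m i n * B.a t n j) = ∑ i, c m i i := by
      refine Finset.sum_congr rfl fun j _ => ?_
      rw [Finset.sum_comm]
      have : ∀ n, ∑ i, (B.a t)⁻¹ j i * (c m j n * B.a t n i) = c m j n * if j = n then 1 else 0 := by
        intro n
        rw [← B.inv_mul_apply ht, Finset.mul_sum]
        refine Finset.sum_congr rfl fun i _ => ?_
        rw [← congrFun (congrFun (B.transpose_a ht) n) i, Matrix.transpose_apply]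
        ring
      simp [this]
    have e4 : ∑ i, ∑ j, (B.a t)⁻¹ i j * Bianchi.koszul (fun _ _ _ => 0) c B.a i j m t
        = 1 / 2 * ((∑ i, ∑ j, ∑ n, (B.a t)⁻¹ i j * (c i j n * B.a t n m))
          - (∑ i, ∑ j, ∑ n, (B.a t)⁻¹ i j * (c j m n * B.a t n i))
          + ∑ i, ∑ j, ∑ n, (B.a t)⁻¹ i j * (c m i n * B.a t n j)) := by
      simp only [Bianchi.koszul, Finset.mul_sum, ← Finset.sum_add_distrib, ← Finset.sum_sub_distrib,
        add_zero, sub_zero, zero_add]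
      refine Finset.sum_congr rfl fun i _ => Finset.sum_congr rfl fun j _ =>
          Finset.sum_congr rfl fun n _ => ?_
      ring
    rw [e4, e1, e2, e3, Bianchi.traceCovector, Finset.sum_sub_distrib]
    ring
  simp only [← hkos, spatialConn, Bianchi.christoffel, Finset.mul_sum]
  rw [show ∑ m, ∑ i, ∑ j, (B.a t)⁻¹ k m * ((B.a t)⁻¹ i j * Bianchi.koszul (fun _ _ _ => 0)
      (Bianchi.structConst B.e) B.a i j m t) = ∑ i, ∑ j, ∑ m, (B.a t)⁻¹ k m * ((B.a t)⁻¹ i j *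
      Bianchi.koszul (fun _ _ _ => 0) (Bianchi.structConst B.e) B.a i j m t) from
    Finset.sum_comm.trans (Finset.sum_congr rfl fun i _ => Finset.sum_comm)]
  refine Finset.sum_congr rfl fun i _ => Finset.sum_congr rfl fun j _ =>
          Finset.sum_congr rfl fun n _ => ?_
  ring

/-- The wave operator in the frame. -/
theorem box_eq [LieGroup (𝓡 3) ∞ G] (ht : t ∈ B.I) (u : G → ℝ → ℝ) (x : G) :
    B.box u x t = -deriv (deriv (u x)) t - B.theta t * deriv (u x) t
      + (∑ i, ∑ j, (B.a t)⁻¹ i j * Bianchi.frameD B.e i (Bianchi.frameD B.e j fun y => u y t) x)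
      - Bianchi.bil (B.a t)⁻¹ (Bianchi.traceCovector B.e) (Bianchi.grad B.e u x t) := by
  have h3 := B.conn_space_zero ht
  have h4 := B.conn_time_left ht
  have h6 := B.conn_time ht
  have h7 := B.conn_space ht
  simp only [conn] at h3 h4 h6 h7
  have e1 : B.theta t * deriv (u x) t
      = ∑ i, ∑ j, (B.a t)⁻¹ i j * (B.kBar t i j * deriv (u x) t) := by
    simp only [theta, Finset.sum_mul, mul_assoc]
  have e2 : Bianchi.bil (B.a t)⁻¹ (Bianchi.traceCovector B.e) (Bianchi.grad B.e u x t)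
      = ∑ i, ∑ j, (B.a t)⁻¹ i j * ∑ k, B.spatialConn k i j t * Bianchi.grad B.e u x t k := by
    have h : ∑ i, ∑ j, (B.a t)⁻¹ i j * ∑ k, B.spatialConn k i j t * Bianchi.grad B.e u x t k
        = ∑ k, (∑ i, ∑ j, (B.a t)⁻¹ i j * B.spatialConn k i j t) * Bianchi.grad B.e u x t k := by
      simp only [Finset.mul_sum, Finset.sum_mul]
      rw [show ∑ k, ∑ i, ∑ j, (B.a t)⁻¹ i j * B.spatialConn k i j t * Bianchi.grad B.e u x t k
        = ∑ i, ∑ j, ∑ k, (B.a t)⁻¹ i j * B.spatialConn k i j t * Bianchi.grad B.e u x t k from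
        Finset.sum_comm.trans (Finset.sum_congr rfl fun i _ => Finset.sum_comm)]
      exact Finset.sum_congr rfl fun i _ => Finset.sum_congr rfl fun j _ =>
          Finset.sum_congr rfl fun n _ => by ring
    rw [h]
    simp only [B.trace_spatialConn ht, Bianchi.bil, Finset.sum_mul]
    rw [Finset.sum_comm]
    exact Finset.sum_congr rfl fun i _ => Finset.sum_congr rfl fun j _ => by rw [B.inv_symm ht]
  have e3 : B.box u x t = -deriv (deriv (u x)) t + ∑ i, ∑ j, (B.a t)⁻¹ i j *
      (Bianchi.frameD B.e i (Bianchi.frameD B.e j fun y => u y t) x - (B.kBar t i j * deriv (u x) t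
        + ∑ k, B.spatialConn k i j t * Bianchi.grad B.e u x t k)) := by
    simp only [box, metric_inv B (B.isUnit_det ht), Fintype.sum_sum_type, Finset.univ_unique,
      Finset.sum_singleton, PUnit.default_eq_unit, h3, h4, h6, h7, Matrix.fromBlocks_apply₁₁,
      Matrix.fromBlocks_apply₁₂, Matrix.fromBlocks_apply₂₁, Matrix.fromBlocks_apply₂₂,
      Matrix.zero_apply, Matrix.neg_apply, Matrix.one_apply_eq, zero_mul, Finset.sum_const_zero,
      add_zero, zero_add, sub_zero, spD]
    rw [neg_one_mul]
    rfl
  rw [e3, e1, e2]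
  simp only [mul_sub, mul_add, Finset.sum_sub_distrib, Finset.sum_add_distrib]
  ring

end BianchiSpacetime

namespace Bianchi

/-! ### Smooth inverses of increasing functions. -/

section SmoothInverse

variable {h h' : ℝ → ℝ} {S : Set ℝ}

theorem strictMonoOn_of_hasDerivAt_pos (hS : S.OrdConnected) (hd : ∀ t ∈ S, HasDerivAt h (h' t) t)
    (hpos : ∀ t ∈ S, 0 < h' t) : StrictMonoOn h S :=
  strictMonoOn_of_deriv_pos hS.convex (fun t ht => (hd t ht).continuousAt.continuousWithinAt)
    fun t ht => by
      rw [(hd t (interior_subset ht)).deriv]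
      exact hpos t (interior_subset ht)

/-- Near a point of its image, a smooth function with positive derivative has a smooth inverse,
which is the inverse on the whole domain. -/
theorem exists_local_inverse (hSo : IsOpen S) (hS : S.OrdConnected) (hc : ContDiffOn ℝ ∞ h S)
    (hd : ∀ t ∈ S, HasDerivAt h (h' t) t) (hpos : ∀ t ∈ S, 0 < h' t) {t : ℝ} (ht : t ∈ S) :
    ContDiffAt ℝ ∞ (Function.invFunOn h S) (h t) ∧ h '' S ∈ 𝓝 (h t) := by
  have hct : ContDiffAt ℝ ∞ h t := hc.contDiffAt (hSo.mem_nhds ht)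
  let f' : ℝ ≃L[ℝ] ℝ := ContinuousLinearEquiv.unitsEquivAut ℝ (Units.mk0 (h' t) (hpos t ht).ne')
  have hf : HasFDerivAt h (f' : ℝ →L[ℝ] ℝ) t := by
    have hf' : (f' : ℝ →L[ℝ] ℝ) = ContinuousLinearMap.toSpanSingleton ℝ (h' t) := by
      ext
      simp [f']
    rw [hf']
    exact (hd t ht).hasFDerivAt
  set g := hct.localInverse hf (by simp) with hg
  have hgt : g (h t) = t := hct.localInverse_apply_image hf (by simp)
  have hgc : ContDiffAt ℝ ∞ g (h t) := hct.to_localInverse hf (by simp)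
  have hgS : ∀ᶠ y in 𝓝 (h t), g y ∈ S :=
    hgc.continuousAt.eventually (by rw [hgt]; exact hSo.mem_nhds ht)
  have hinv : ∀ᶠ y in 𝓝 (h t), h (g y) = y :=
    (hct.hasStrictFDerivAt' hf (by simp)).eventually_right_inverse
  have hinj := (strictMonoOn_of_hasDerivAt_pos hS hd hpos).injOn
  -- Near h(t) the local inverse takes values in S, where h is injective, so it coincides with the
  -- chosen inverse on S.
  constructor
  · refine hgc.congr_of_eventuallyEq ?_
    filter_upwards [hgS, hinv] with y hy hy'
    have hex : ∃ s ∈ S, h s = y := ⟨g y, hy, hy'⟩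
    exact hinj (Function.invFunOn_mem hex) hy ((Function.invFunOn_eq hex).trans hy'.symm)
  · filter_upwards [hgS, hinv] with y hy hy' using ⟨g y, hy, hy'⟩

theorem contDiffOn_invFunOn (hSo : IsOpen S) (hS : S.OrdConnected) (hc : ContDiffOn ℝ ∞ h S)
    (hd : ∀ t ∈ S, HasDerivAt h (h' t) t) (hpos : ∀ t ∈ S, 0 < h' t) :
    ContDiffOn ℝ ∞ (Function.invFunOn h S) (h '' S) := by
  rintro y ⟨t, ht, rfl⟩
  exact (exists_local_inverse hSo hS hc hd hpos ht).1.contDiffWithinAt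

theorem isOpen_image_of_hasDerivAt_pos (hSo : IsOpen S) (hS : S.OrdConnected)
    (hc : ContDiffOn ℝ ∞ h S) (hd : ∀ t ∈ S, HasDerivAt h (h' t) t) (hpos : ∀ t ∈ S, 0 < h' t) :
    IsOpen (h '' S) := by
  rw [isOpen_iff_mem_nhds]
  rintro y ⟨t, ht, rfl⟩
  exact (exists_local_inverse hSo hS hc hd hpos ht).2

theorem hasDerivAt_invFunOn (hSo : IsOpen S) (hS : S.OrdConnected) (hc : ContDiffOn ℝ ∞ h S)
    (hd : ∀ t ∈ S, HasDerivAt h (h' t) t) (hpos : ∀ t ∈ S, 0 < h' t) {y : ℝ} (hy : y ∈ h '' S) :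
    HasDerivAt (Function.invFunOn h S) (h' (Function.invFunOn h S y))⁻¹ y := by
  have hmem : ∀ z ∈ h '' S, Function.invFunOn h S z ∈ S := fun z hz => Function.invFunOn_mem hz
  have ho := isOpen_image_of_hasDerivAt_pos hSo hS hc hd hpos
  have hcont := ((contDiffOn_invFunOn hSo hS hc hd hpos).contDiffAt (ho.mem_nhds hy)).continuousAt
  refine HasDerivAt.of_local_left_inverse hcont (hd _ (hmem y hy)) (hpos _ (hmem y hy)).ne' ?_
  filter_upwards [ho.mem_nhds hy] with z hz using Function.invFunOn_eq hz

end SmoothInverse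

end Bianchi

/-! ### The time coordinate `τ`. -/

namespace BianchiSpacetime

variable {G : Type*} [TopologicalSpace G] [ChartedSpace (EuclideanSpace ℝ (Fin 3)) G] [Group G]
  {B : BianchiSpacetime G} {t t₀ τ : ℝ}

theorem ordConnected_I : B.I.OrdConnected :=
  ⟨fun _ hx _ hy _ hz => ⟨hx.1.trans_le (EReal.coe_le_coe_iff.2 hz.1),
    (EReal.coe_le_coe_iff.2 hz.2).trans_lt hy.2⟩⟩

theorem isOpen_I₀ : IsOpen (B.I₀ t₀) := B.isOpen_I.inter isOpen_Iio

theorem ordConnected_I₀ : (B.I₀ t₀).OrdConnected := ordConnected_I.inter ordConnected_Iio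

theorem contDiffOn_tau : ContDiffOn ℝ ∞ B.tau B.I := by
  unfold tau
  refine contDiffOn_const.mul (ContDiffOn.log (ContDiffOn.sqrt (Bianchi.contDiffOn_det B.smooth_a)
    fun t ht => (B.det_pos ht).ne') fun t ht => (Real.sqrt_pos.2 (B.det_pos ht)).ne')

namespace IsMonotoneVolumeSingularity

variable (hB : B.IsMonotoneVolumeSingularity t₀)
include hB

theorem theta_pos_of_mem (ht : t ∈ B.I₀ t₀) : 0 < B.theta t := hB.theta_pos t ht.1 ht.2

theorem tau_deriv_pos : ∀ t ∈ B.I₀ t₀, 0 < B.theta t / 3 := fun _ ht => by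
  have := hB.theta_pos_of_mem ht
  positivity

theorem exists_tau_lt (y : ℝ) : ∃ t ∈ B.I₀ t₀, B.tau t < y := by
  have h := hB.tendsto_tau.eventually (eventually_lt_atBot y)
  rw [eventually_comap] at h
  obtain ⟨c, hc, hcs⟩ := (mem_nhdsGT_iff_exists_Ioo_subset' hB.mem.1).1 h
  obtain ⟨t, ht1, ht2⟩ := EReal.lt_iff_exists_real_btwn.1
    (lt_min (show B.tMinus < c from hc) hB.mem.1)
  have ht3 := lt_min_iff.1 ht2
  exact ⟨t, ⟨⟨ht1, ht3.2.trans hB.mem.2⟩, EReal.coe_lt_coe_iff.1 ht3.2⟩, hcs ⟨ht1, ht3.1⟩ t rfl⟩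

theorem image_tau : B.tau '' B.I₀ t₀ = Iio (B.tau t₀) := by
  -- Monotonicity is needed up to t₀ itself, to see that τ(t₀) strictly exceeds the image; a
  -- positive derivative in the interior suffices for this.
  have hmono : StrictMonoOn B.tau (B.I ∩ Iic t₀) := by
    refine strictMonoOn_of_deriv_pos (ordConnected_I.inter ordConnected_Iic).convex
      (fun t ht => (B.hasDerivAt_tau ht.1).continuousAt.continuousWithinAt) fun t ht => ?_
    rw [interior_inter, interior_Iic, B.isOpen_I.interior_eq] at ht
    rw [(B.hasDerivAt_tau ht.1).deriv]
    exact hB.tau_deriv_pos t ht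
  refine Subset.antisymm ?_ fun y hy => ?_
  · rintro _ ⟨t, ht, rfl⟩
    exact hmono ⟨ht.1, ht.2.le⟩ ⟨hB.mem, self_mem_Iic⟩ ht.2
  · obtain ⟨t, ht, hty⟩ := hB.exists_tau_lt y
    have hsub : Icc t t₀ ⊆ B.I := ordConnected_I.out ht.1 hB.mem
    obtain ⟨s, hs, hsy⟩ := intermediate_value_Icc ht.2.le
      (fun r hr => (B.hasDerivAt_tau (hsub hr)).continuousAt.continuousWithinAt)
      (⟨hty.le, (show y < B.tau t₀ from hy).le⟩ : y ∈ Icc (B.tau t) (B.tau t₀))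
    refine ⟨s, ⟨hsub hs, lt_of_le_of_ne hs.2 ?_⟩, hsy⟩
    rintro rfl
    exact (ne_of_lt hy) hsy.symm

theorem timeOfTau_mem (hτ : τ < B.tau t₀) : B.timeOfTau t₀ τ ∈ B.I₀ t₀ :=
  Function.invFunOn_mem (show τ ∈ B.tau '' B.I₀ t₀ by rw [hB.image_tau]; exact hτ)

theorem tau_timeOfTau (hτ : τ < B.tau t₀) : B.tau (B.timeOfTau t₀ τ) = τ :=
  Function.invFunOn_eq (show τ ∈ B.tau '' B.I₀ t₀ by rw [hB.image_tau]; exact hτ)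

theorem contDiffOn_timeOfTau : ContDiffOn ℝ ∞ (B.timeOfTau t₀) (Iio (B.tau t₀)) := by
  have := Bianchi.contDiffOn_invFunOn isOpen_I₀ ordConnected_I₀
    (contDiffOn_tau.mono (inter_subset_left : B.I₀ t₀ ⊆ _)) (fun _ ht => B.hasDerivAt_tau ht.1) hB.tau_deriv_pos
  rwa [hB.image_tau] at this

theorem hasDerivAt_timeOfTau (hτ : τ < B.tau t₀) :
    HasDerivAt (B.timeOfTau t₀) (3 / B.theta (B.timeOfTau t₀ τ)) τ := by
  have := Bianchi.hasDerivAt_invFunOn isOpen_I₀ ordConnected_I₀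
    (contDiffOn_tau.mono (inter_subset_left : B.I₀ t₀ ⊆ _)) (fun _ ht => B.hasDerivAt_tau ht.1) hB.tau_deriv_pos
    (y := τ) (by rw [hB.image_tau]; exact hτ)
  rwa [inv_div] at this

end IsMonotoneVolumeSingularity

end BianchiSpacetime

/-! ### Bounds on the coefficients from Einstein's equations. -/

namespace BianchiSpacetime

variable {G : Type*} [TopologicalSpace G] [ChartedSpace (EuclideanSpace ℝ (Fin 3)) G] [Group G]
  {B : BianchiSpacetime G} {t t₀ τ : ℝ}

theorem continuousOn_spatialScal : ContinuousOn B.spatialScal B.I := by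
  have hP := fun i j => (B.contDiffOn_inv i j).continuousOn
  have ha := fun i j => (B.smooth_a i j).continuousOn
  have hk : ∀ i j k, ContinuousOn (fun t => Bianchi.koszul (fun _ _ _ => 0)
      (Bianchi.structConst B.e) B.a i j k t) B.I := fun i j k =>
    continuousOn_const.mul (continuousOn_const.add (continuousOn_finsetSum _ fun m _ =>
      ((continuousOn_const.mul (ha m k)).sub (continuousOn_const.mul (ha m i))).add
        (continuousOn_const.mul (ha m j))))
  have hc : ∀ i j k, ContinuousOn (fun t => B.spatialConn i j k t) B.I := fun i j k =>
    continuousOn_finsetSum _ fun m _ => (hP i m).mul (hk j k m)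
  have hr : ∀ j k, ContinuousOn (fun t => Bianchi.ricci (fun _ _ _ => 0)
      (Bianchi.structConst B.e) B.a j k t) B.I := fun j k =>
    continuousOn_finsetSum _ fun i _ => continuousOn_const.add (continuousOn_finsetSum _ fun m _ =>
      (((hc m j k).mul (hc i i m)).sub ((hc m i k).mul (hc i j m))).sub
        (continuousOn_const.mul (hc i m k)))
  unfold spatialScal Bianchi.scalarCurv
  exact continuousOn_finsetSum _ fun j _ => continuousOn_finsetSum _ fun k _ => (hP j k).mul (hr j k)

theorem sqrt_det_eq (ht : t ∈ B.I) : √(B.a t).det = Real.exp (3 * B.tau t) := by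
  have h : 3 * B.tau t = Real.log √(B.a t).det := by rw [tau]; ring
  rw [h, Real.exp_log (Real.sqrt_pos.2 (B.det_pos ht))]

theorem gammaS_nonneg (τ : ℝ) : 0 ≤ B.gammaS t₀ τ := by
  unfold gammaS
  positivity

theorem posDef_inv (ht : t ∈ B.I) : ((B.a t)⁻¹).PosDef := (B.posDef ht).inv

/-- The derivative of `9 θ⁻² a^{ij}` with respect to proper time. -/
def aHatInvDeriv (B : BianchiSpacetime G) (t : ℝ) : Matrix (Fin 3) (Fin 3) ℝ :=
  (-18 * deriv B.theta t / B.theta t ^ 3) • (B.a t)⁻¹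
    + (-18 / B.theta t ^ 2) • ((B.a t)⁻¹ * B.kBar t * (B.a t)⁻¹)

theorem hasDerivAt_aHatInv (ht : t ∈ B.I) (hθ : B.theta t ≠ 0) (i j : Fin 3) :
    HasDerivAt (fun s => 9 / B.theta s ^ 2 * (B.a s)⁻¹ i j) (B.aHatInvDeriv t i j) t := by
  have h1 := B.hasDerivAt_of_contDiffOn B.contDiffOn_theta ht
  have h2 := ((hasDerivAt_const t (9 : ℝ)).div (h1.pow 2) (pow_ne_zero 2 hθ)).mul
    (B.hasDerivAt_inv ht i j)
  refine h2.congr_deriv ?_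
  simp only [aHatInvDeriv, Matrix.add_apply, Matrix.smul_apply, smul_eq_mul, Pi.div_apply,
    Pi.pow_apply]
  field_simp
  ring

namespace IsMonotoneVolumeSingularity

variable (hB : B.IsMonotoneVolumeSingularity t₀)
include hB

theorem theta_timeOfTau_pos (hτ : τ < B.tau t₀) : 0 < B.theta (B.timeOfTau t₀ τ) :=
  hB.theta_pos_of_mem (hB.timeOfTau_mem hτ)

theorem timeOfTau_mem_I (hτ : τ < B.tau t₀) : B.timeOfTau t₀ τ ∈ B.I := (hB.timeOfTau_mem hτ).1

theorem mapsTo_timeOfTau : MapsTo (B.timeOfTau t₀) (Iio (B.tau t₀)) B.I :=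
  fun _ hτ => hB.timeOfTau_mem_I hτ

theorem contDiffOn_comp {c : ℝ → ℝ} (hc : ContDiffOn ℝ ∞ c B.I) :
    ContDiffOn ℝ ∞ (fun τ => c (B.timeOfTau t₀ τ)) (Iio (B.tau t₀)) :=
  hc.comp hB.contDiffOn_timeOfTau hB.mapsTo_timeOfTau

theorem continuousOn_comp {c : ℝ → ℝ} (hc : ContinuousOn c B.I) :
    ContinuousOn (fun τ => c (B.timeOfTau t₀ τ)) (Iio (B.tau t₀)) :=
  hc.comp hB.contDiffOn_timeOfTau.continuousOn hB.mapsTo_timeOfTau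

theorem aHat_inv_eq (hτ : τ < B.tau t₀) : (B.aHat t₀ τ)⁻¹
    = (9 / B.theta (B.timeOfTau t₀ τ) ^ 2) • (B.a (B.timeOfTau t₀ τ))⁻¹ := by
  have hθ := (hB.theta_timeOfTau_pos hτ).ne'
  refine Matrix.inv_eq_right_inv ?_
  rw [aHat, Matrix.smul_mul, Matrix.mul_smul, smul_smul,
    Matrix.mul_nonsing_inv _ (B.isUnit_det (hB.timeOfTau_mem_I hτ))]
  have : B.theta (B.timeOfTau t₀ τ) ^ 2 / 9 * (9 / B.theta (B.timeOfTau t₀ τ) ^ 2) = 1 := by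
    field_simp
  rw [this, one_smul]

theorem hasDerivAt_aHat_inv (hτ : τ < B.tau t₀) (i j : Fin 3) :
    HasDerivAt (fun s => (B.aHat t₀ s)⁻¹ i j)
      (((3 / B.theta (B.timeOfTau t₀ τ)) • B.aHatInvDeriv (B.timeOfTau t₀ τ)) i j) τ := by
  have h1 := (hasDerivAt_aHatInv (hB.timeOfTau_mem_I hτ) (hB.theta_timeOfTau_pos hτ).ne' i j).comp τ
    (hB.hasDerivAt_timeOfTau hτ)
  have h2 : (fun s => (B.aHat t₀ s)⁻¹ i j) =ᶠ[𝓝 τ] (fun s => 9 / B.theta s ^ 2 * (B.a s)⁻¹ i j)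
      ∘ B.timeOfTau t₀ := by
    filter_upwards [isOpen_Iio.mem_nhds hτ] with s hs
    rw [hB.aHat_inv_eq hs]
    rfl
  refine (h1.congr_of_eventuallyEq h2).congr_deriv ?_
  rw [Matrix.smul_apply, smul_eq_mul, mul_comm]

theorem contDiffOn_aHat_inv (i j : Fin 3) :
    ContDiffOn ℝ ∞ (fun s => (B.aHat t₀ s)⁻¹ i j) (Iio (B.tau t₀)) := by
  have h1 := hB.contDiffOn_comp B.contDiffOn_theta
  have h2 := hB.contDiffOn_comp (B.contDiffOn_inv i j)
  refine ((contDiffOn_const.div (h1.pow 2) fun s hs =>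
    pow_ne_zero 2 (hB.theta_timeOfTau_pos hs).ne').mul h2).congr (f₁ := _)
      (f := fun s => 9 / B.theta (B.timeOfTau t₀ s) ^ 2 * (B.a (B.timeOfTau t₀ s))⁻¹ i j) ?_
  intro s hs
  rw [hB.aHat_inv_eq hs]
  rfl

theorem continuousOn_gammaS : ContinuousOn (B.gammaS t₀) (Iio (B.tau t₀)) := by
  unfold gammaS
  have h1 := (hB.contDiffOn_comp B.contDiffOn_theta).continuousOn
  have h2 := hB.continuousOn_comp continuousOn_spatialScal
  exact (ContinuousOn.sup continuousOn_const h2).div (h1.pow 2) fun s hs =>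
    pow_ne_zero 2 (hB.theta_timeOfTau_pos hs).ne'

theorem spatialScal_le (hτ : τ < B.tau t₀) : B.spatialScal (B.timeOfTau t₀ τ)
    ≤ B.gammaS t₀ τ * B.theta (B.timeOfTau t₀ τ) ^ 2 := by
  have hθ := hB.theta_timeOfTau_pos hτ
  rw [gammaS, div_mul_cancel₀ _ (pow_ne_zero 2 hθ.ne')]
  exact le_max_right _ _

variable {Λ : ℝ} {T : ℝ → Matrix Idx Idx ℝ} (hE : B.SolvesEinstein Λ T)

section Einstein

include hE

theorem two_sub_q (hτ : τ < B.tau t₀) : 2 - B.q Λ T (B.timeOfTau t₀ τ)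
    = 3 + 3 * deriv B.theta (B.timeOfTau t₀ τ) / B.theta (B.timeOfTau t₀ τ) ^ 2 :=
  B.two_sub_q_eq hE (hB.timeOfTau_mem_I hτ) (hB.theta_timeOfTau_pos hτ).ne'

theorem continuousOn_two_sub_q :
    ContinuousOn (fun τ => 2 - B.q Λ T (B.timeOfTau t₀ τ)) (Iio (B.tau t₀)) := by
  have h1 := (hB.contDiffOn_comp B.contDiffOn_theta).continuousOn
  have h2 := (hB.contDiffOn_comp
    (B.contDiffOn_theta.deriv_of_isOpen (m := ∞) B.isOpen_I (by simp))).continuousOn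
  refine ContinuousOn.congr (f := fun τ => 3 + 3 * deriv B.theta (B.timeOfTau t₀ τ)
    / B.theta (B.timeOfTau t₀ τ) ^ 2) ?_ fun τ hτ => hB.two_sub_q hE hτ
  exact continuousOn_const.add ((continuousOn_const.mul h2).div (h1.pow 2) fun s hs =>
    pow_ne_zero 2 (hB.theta_timeOfTau_pos hs).ne')

/-- Eliminating tr K² between Raychaudhuri's equation and the constraint gives θ' = -θ² - S̄ +
(3/2)(ρ - p̄) + 3Λ, whose last two terms are nonnegative. -/
theorem two_sub_q_ge (hρp : ∀ t ∈ B.I, B.pBar T t ≤ rho T t) (hΛ : 0 ≤ Λ) (hτ : τ < B.tau t₀) :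
    -(3 * B.gammaS t₀ τ) ≤ 2 - B.q Λ T (B.timeOfTau t₀ τ) := by
  have hθ := hB.theta_timeOfTau_pos hτ
  have ht := hB.timeOfTau_mem_I hτ
  have hS := hB.spatialScal_le hτ
  obtain ⟨h1, h2⟩ := B.raychaudhuri hE ht
  have h3 := hρp _ ht
  rw [hB.two_sub_q hE hτ]
  have h4 : -(1 + B.gammaS t₀ τ) ≤ deriv B.theta (B.timeOfTau t₀ τ)
      / B.theta (B.timeOfTau t₀ τ) ^ 2 := by
    rw [le_div_iff₀ (by positivity)]
    linarith
  rw [mul_div_assoc]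
  linarith

/-- The terms with θ' from differentiating θ⁻² and from 2-q cancel, leaving 27θ⁻³(θ a^{-1} - a^{-1}
k̄ a^{-1}). By the constraint with ρ, Λ ≥ 0, tr K² ≤ θ² + S̄ ≤ θ²(1 + γ_S̄), so `bil_sharp_le`
bounds k̄ from above. -/
theorem aHat_inv_deriv_ge (hρ : ∀ t ∈ B.I, 0 ≤ rho T t) (hΛ : 0 ≤ Λ) (hτ : τ < B.tau t₀)
    (ξ : Fin 3 → ℝ) :
    -(3 / 2 * B.gammaS t₀ τ * Bianchi.bil (B.aHat t₀ τ)⁻¹ ξ ξ)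
      ≤ 1 / 2 * Bianchi.bil ((3 / B.theta (B.timeOfTau t₀ τ)) • B.aHatInvDeriv (B.timeOfTau t₀ τ)) ξ ξ
        + (2 - B.q Λ T (B.timeOfTau t₀ τ)) * Bianchi.bil (B.aHat t₀ τ)⁻¹ ξ ξ := by
  have hθ := hB.theta_timeOfTau_pos hτ
  have ht := hB.timeOfTau_mem_I hτ
  have hS := hB.spatialScal_le hτ
  have hγ : 0 ≤ B.gammaS t₀ τ := gammaS_nonneg τ
  obtain ⟨h1, h2⟩ := B.raychaudhuri hE ht
  have hr := hρ _ ht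
  rw [hB.two_sub_q hE hτ, hB.aHat_inv_eq hτ]
  set s := B.timeOfTau t₀ τ with hs
  set γ := B.gammaS t₀ τ
  have key := Bianchi.bil_sharp_le (posDef_inv ht) (Matrix.nonsing_inv_mul _ (B.isUnit_det ht))
    (B.transpose_a ht) (B.kBar_transpose ht) hγ (by rwa [← B.theta_eq_trace ht]) (by
      rw [← B.theta_eq_trace ht]
      change (B.weingarten s * B.weingarten s).trace ≤ _
      linarith) ξ
  rw [← B.theta_eq_trace ht] at key
  have hsm : ∀ (c : ℝ) (N : Matrix (Fin 3) (Fin 3) ℝ), Bianchi.bil (c • N) ξ ξ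
      = c * Bianchi.bil N ξ ξ := by
    intro c N
    simp [Bianchi.bil, Finset.mul_sum, mul_assoc]
  have had : ∀ (M N : Matrix (Fin 3) (Fin 3) ℝ), Bianchi.bil (M + N) ξ ξ
      = Bianchi.bil M ξ ξ + Bianchi.bil N ξ ξ := by
    intro M N
    simp [Bianchi.bil, add_mul, Finset.sum_add_distrib]
  rw [aHatInvDeriv]
  simp only [hsm, had]
  set X := Bianchi.bil (B.a s)⁻¹ ξ ξ
  set Y := Bianchi.bil ((B.a s)⁻¹ * B.kBar s * (B.a s)⁻¹) ξ ξ
  set θ := B.theta s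
  have h3 : 1 / 2 * (3 / θ * (-18 * deriv B.theta s / θ ^ 3 * X + -18 / θ ^ 2 * Y))
      + (3 + 3 * deriv B.theta s / θ ^ 2) * (9 / θ ^ 2 * X) = 27 / θ ^ 3 * (θ * X - Y) := by
    field_simp
    ring
  have h4 : -(3 / 2 * γ * (9 / θ ^ 2 * X)) = 27 / θ ^ 3 * (-(θ * (γ / 2) * X)) := by
    field_simp
    ring
  rw [h3, h4]
  refine mul_le_mul_of_nonneg_left ?_ (by positivity)
  linarith

end Einstein

theorem formBound {f : ℝ → ℝ} (hτ : τ < B.tau t₀) (hf : 0 < f τ)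
    (h : ‖Matrix.toEuclideanCLM (n := Fin 3) (𝕜 := ℝ) (B.aHat t₀ τ)⁻¹‖ ≤ f τ ^ 2) :
    Bianchi.FormBound (B.aHat t₀ τ)⁻¹ (f τ) where
  symm i j := by
    rw [hB.aHat_inv_eq hτ, Matrix.smul_apply, Matrix.smul_apply,
      B.inv_symm (hB.timeOfTau_mem_I hτ)]
  nonneg ξ := by
    have hθ := hB.theta_timeOfTau_pos hτ
    have h1 : 0 ≤ Bianchi.bil (B.a (B.timeOfTau t₀ τ))⁻¹ ξ ξ := by
      rw [Bianchi.bil_eq_dotProduct]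
      simpa using (posDef_inv (hB.timeOfTau_mem_I hτ)).posSemidef.dotProduct_mulVec_nonneg ξ
    have h2 : Bianchi.bil (B.aHat t₀ τ)⁻¹ ξ ξ = 9 / B.theta (B.timeOfTau t₀ τ) ^ 2
        * Bianchi.bil (B.a (B.timeOfTau t₀ τ))⁻¹ ξ ξ := by
      rw [hB.aHat_inv_eq hτ]
      simp [Bianchi.bil, Finset.mul_sum, mul_assoc]
    rw [h2]
    positivity
  le ξ := by
    set M := (B.aHat t₀ τ)⁻¹
    have h1 : Bianchi.bil M ξ ξ = inner ℝ (WithLp.toLp 2 ξ)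
        (Matrix.toEuclideanCLM (n := Fin 3) (𝕜 := ℝ) M (WithLp.toLp 2 ξ)) := by
      rw [Bianchi.bil_eq_dotProduct, Matrix.toEuclideanCLM_toLp, EuclideanSpace.inner_toLp_toLp]
      simp [dotProduct_comm]
    have h2 : ∑ i, ξ i ^ 2 = ‖WithLp.toLp 2 ξ‖ ^ 2 := by
      rw [EuclideanSpace.norm_sq_eq]
      simp
    rw [h1, h2]
    refine (real_inner_le_norm _ _).trans ?_
    have h3 := (Matrix.toEuclideanCLM (n := Fin 3) (𝕜 := ℝ) M).le_opNorm (WithLp.toLp 2 ξ)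
    calc ‖WithLp.toLp 2 ξ‖ * ‖Matrix.toEuclideanCLM (n := Fin 3) (𝕜 := ℝ) M (WithLp.toLp 2 ξ)‖
        ≤ ‖WithLp.toLp 2 ξ‖ * (f τ ^ 2 * ‖WithLp.toLp 2 ξ‖) := by
          gcongr
          exact h3.trans (by gcongr)
      _ = _ := by ring
  bound_nonneg := hf.le

/-- The equation in the time coordinate `τ` satisfies the assumptions of the energy estimate. -/
theorem waveCoeff (hτ₀ : 0 < B.tau t₀) (hE : B.SolvesEinstein Λ T)
    (hρp : ∀ t ∈ B.I, B.pBar T t ≤ rho T t) (hρ : ∀ t ∈ B.I, 0 ≤ rho T t) (hΛ : 0 ≤ Λ)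
    {φ₀ f : ℝ → ℝ} (hf : AdmissibleWeight f)
    (hsilent : ∀ τ ≤ 0, |B.phiHat φ₀ t₀ τ|
      + ‖Matrix.toEuclideanCLM (n := Fin 3) (𝕜 := ℝ) (B.aHat t₀ τ)⁻¹‖ ≤ f τ ^ 2) :
    Bianchi.WaveCoeff (fun τ => (B.aHat t₀ τ)⁻¹)
      (fun τ => (3 / B.theta (B.timeOfTau t₀ τ)) • B.aHatInvDeriv (B.timeOfTau t₀ τ))
      (fun τ => 2 - B.q Λ T (B.timeOfTau t₀ τ)) (B.phiHat φ₀ t₀) (B.gammaS t₀) f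
      (derivWithin f (Iic 0)) := by
  have hlt : ∀ τ ≤ 0, τ < B.tau t₀ := fun τ hτ => hτ.trans_lt hτ₀
  have hsub : Iic 0 ⊆ Iio (B.tau t₀) := hlt
  refine
  { form := fun τ hτ => hB.formBound (hlt τ hτ) (hf.pos τ hτ)
      (by linarith [hsilent τ hτ, abs_nonneg (B.phiHat φ₀ t₀ τ)])
    hasDerivAt_A := fun τ hτ => hB.hasDerivAt_aHat_inv (hlt τ hτ)
    continuousOn_A' := fun i j => ?_
    hasDerivAt_f := fun τ hτ => ?_
    continuousOn_f := hf.contDiff.continuousOn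
    continuousOn_f' := (hf.contDiff.continuousOn_derivWithin (uniqueDiffOn_Iic 0) le_rfl).mono
      Iio_subset_Iic_self
    f'_nonneg := fun τ hτ => hf.deriv_nonneg τ (le_of_lt hτ)
    continuousOn_b := (hB.continuousOn_two_sub_q hE).mono hsub
    continuousOn_γ := hB.continuousOn_gammaS.mono hsub
    γ_nonneg := fun τ _ => gammaS_nonneg τ
    b_ge := fun τ hτ => hB.two_sub_q_ge hE hρp hΛ (hlt τ hτ)
    A'_ge := fun τ hτ => hB.aHat_inv_deriv_ge hE hρ hΛ (hlt τ hτ)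
    abs_φ_le := fun τ hτ => ?_ }
  · refine ((((hB.contDiffOn_aHat_inv i j).deriv_of_isOpen (m := ∞) isOpen_Iio (by simp)).continuousOn).mono
      hsub).congr fun τ hτ => ((hB.hasDerivAt_aHat_inv (hlt τ hτ) i j).deriv).symm
  · exact ((hf.contDiff.differentiableOn (by simp) τ (le_of_lt hτ)).hasDerivWithinAt).hasDerivAt
      (Iic_mem_nhds hτ)
  · have := norm_nonneg (Matrix.toEuclideanCLM (n := Fin 3) (𝕜 := ℝ) (B.aHat t₀ τ)⁻¹)
    linarith [hsilent τ hτ]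

end IsMonotoneVolumeSingularity

end BianchiSpacetime

/-! ### The equation in the time `τ`, and the passage to `σ`. -/

namespace BianchiSpacetime

variable {G : Type*} [TopologicalSpace G] [ChartedSpace (EuclideanSpace ℝ (Fin 3)) G] [Group G]
  {B : BianchiSpacetime G} {t t₀ τ : ℝ} {Λ : ℝ} {T : ℝ → Matrix Idx Idx ℝ} {φ₀ : ℝ → ℝ}
  {u : G → ℝ → ℝ}

/-- A function on the spacetime, in the time coordinate `τ`. -/
def inTau (B : BianchiSpacetime G) (t₀ : ℝ) (u : G → ℝ → ℝ) (x : G) (τ : ℝ) : ℝ :=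
  u x (B.timeOfTau t₀ τ)

/-- The function `θ √(det a)`, in the time coordinate `τ`. -/
def thetaVol (B : BianchiSpacetime G) (t₀ τ : ℝ) : ℝ :=
  B.theta (B.timeOfTau t₀ τ) * Real.exp (3 * τ)

theorem sigma_deriv_pos : ∀ t ∈ B.I₀ t₀, 0 < 1 / 3 * (√(B.a t).det)⁻¹ := fun t ht => by
  have := Real.sqrt_pos.2 (B.det_pos ht.1)
  positivity

namespace IsMonotoneVolumeSingularity

variable (hB : B.IsMonotoneVolumeSingularity t₀)
include hB

theorem smoothOn_inTau (hu : B.IsSolution φ₀ t₀ u) :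
    Bianchi.SmoothOn (Iio (B.tau t₀)) (B.inTau t₀ u) :=
  Bianchi.SmoothOn.comp_time (J := B.I₀ t₀) hu.smooth hB.contDiffOn_timeOfTau
    fun _ hτ => hB.timeOfTau_mem hτ

theorem hasDerivAt_inTau {w : G → ℝ → ℝ} (hw : Bianchi.SmoothOn (B.I₀ t₀) w) (x : G)
    (hτ : τ < B.tau t₀) : HasDerivAt (B.inTau t₀ w x)
      (deriv (w x) (B.timeOfTau t₀ τ) * (3 / B.theta (B.timeOfTau t₀ τ))) τ :=
  (hw.hasDerivAt isOpen_I₀ x (hB.timeOfTau_mem hτ)).comp τ (hB.hasDerivAt_timeOfTau hτ)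

/-- Multiply the equation by 9/θ² and use dt/dτ = 3/θ. The friction θ u_t and the derivative of 3/θ
combine to (3 + 3θ'/θ²) u_τ, which is (2-q) u_τ. -/
theorem isWave_inTau [LieGroup (𝓡 3) ∞ G] (hE : B.SolvesEinstein Λ T) (hτ₀ : 0 < B.tau t₀)
    (hu : B.IsSolution φ₀ t₀ u) :
    Bianchi.IsWave B.e (fun τ => (B.aHat t₀ τ)⁻¹) (fun τ => 2 - B.q Λ T (B.timeOfTau t₀ τ))
      (B.phiHat φ₀ t₀) (Bianchi.traceCovector B.e) (B.inTau t₀ u) fun _ _ => 0 := by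
  intro x τ hτ0
  have hτ := hτ0.trans_lt hτ₀
  have hus : Bianchi.SmoothOn (B.I₀ t₀) u := hu.smooth
  have ht := hB.timeOfTau_mem hτ
  have hθ := hB.theta_timeOfTau_pos hτ
  have h1 := (hB.hasDerivAt_inTau hus x hτ).deriv
  have h2 : deriv (deriv (B.inTau t₀ u x)) τ = deriv (deriv (u x)) (B.timeOfTau t₀ τ)
      * (3 / B.theta (B.timeOfTau t₀ τ)) * (3 / B.theta (B.timeOfTau t₀ τ))
      + deriv (u x) (B.timeOfTau t₀ τ) * (-3 * deriv B.theta (B.timeOfTau t₀ τ)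
        / B.theta (B.timeOfTau t₀ τ) ^ 2 * (3 / B.theta (B.timeOfTau t₀ τ))) := by
    have hev : deriv (B.inTau t₀ u x) =ᶠ[𝓝 τ] fun s => B.inTau t₀ (fun y => deriv (u y)) x s
        * (3 / B.theta (B.timeOfTau t₀ s)) := by
      filter_upwards [isOpen_Iio.mem_nhds hτ] with s hs using (hB.hasDerivAt_inTau hus x hs).deriv
    have h3 := hB.hasDerivAt_inTau (hus.deriv isOpen_I₀) x hτ
    have h4 := (hasDerivAt_const τ (3 : ℝ)).div
      ((B.hasDerivAt_of_contDiffOn B.contDiffOn_theta ht.1).comp τ (hB.hasDerivAt_timeOfTau hτ)) hθ.ne'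
    rw [hev.deriv_eq]
    refine (h3.mul h4).deriv.trans ?_
    simp only [inTau, Function.comp, Pi.div_apply]
    field_simp
    ring
  have h5 := hu.eqn x _ ht
  rw [B.box_eq ht.1] at h5
  have e1 : ∑ i, ∑ j, (B.aHat t₀ τ)⁻¹ i j
        * Bianchi.frameD B.e i (Bianchi.frameD B.e j fun y => B.inTau t₀ u y τ) x
      = 9 / B.theta (B.timeOfTau t₀ τ) ^ 2 * ∑ i, ∑ j, (B.a (B.timeOfTau t₀ τ))⁻¹ i j
        * Bianchi.frameD B.e i (Bianchi.frameD B.e j fun y => u y (B.timeOfTau t₀ τ)) x := by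
    rw [hB.aHat_inv_eq hτ]
    simp only [Matrix.smul_apply, smul_eq_mul, Finset.mul_sum, mul_assoc]
    rfl
  have e2 : Bianchi.bil (B.aHat t₀ τ)⁻¹ (Bianchi.traceCovector B.e)
        (Bianchi.grad B.e (B.inTau t₀ u) x τ)
      = 9 / B.theta (B.timeOfTau t₀ τ) ^ 2 * Bianchi.bil (B.a (B.timeOfTau t₀ τ))⁻¹
        (Bianchi.traceCovector B.e) (Bianchi.grad B.e u x (B.timeOfTau t₀ τ)) := by
    rw [hB.aHat_inv_eq hτ]
    simp only [Bianchi.bil, Matrix.smul_apply, smul_eq_mul, Finset.mul_sum, mul_assoc]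
    rfl
  have e3 : B.phiHat φ₀ t₀ τ * B.inTau t₀ u x τ = 9 / B.theta (B.timeOfTau t₀ τ) ^ 2
      * (φ₀ (B.timeOfTau t₀ τ) * u x (B.timeOfTau t₀ τ)) := by
    simp only [phiHat, inTau]
    ring
  simp only
  rw [e1, e2, e3, h2, h1, hB.two_sub_q hE hτ]
  set X := ∑ i, ∑ j, (B.a (B.timeOfTau t₀ τ))⁻¹ i j
        * Bianchi.frameD B.e i (Bianchi.frameD B.e j fun y => u y (B.timeOfTau t₀ τ)) x
  set Y := Bianchi.bil (B.a (B.timeOfTau t₀ τ))⁻¹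
        (Bianchi.traceCovector B.e) (Bianchi.grad B.e u x (B.timeOfTau t₀ τ))
  have h6 : deriv (deriv (u x)) (B.timeOfTau t₀ τ) = -(B.theta (B.timeOfTau t₀ τ)
      * deriv (u x) (B.timeOfTau t₀ τ)) + X - Y
      + φ₀ (B.timeOfTau t₀ τ) * u x (B.timeOfTau t₀ τ) := by linarith
  rw [h6]
  field_simp
  ring

theorem thetaVol_pos (hτ : τ < B.tau t₀) : 0 < B.thetaVol t₀ τ :=
  mul_pos (hB.theta_timeOfTau_pos hτ) (Real.exp_pos _)

theorem hasDerivAt_thetaVol (hE : B.SolvesEinstein Λ T) (hτ : τ < B.tau t₀) :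
    HasDerivAt (B.thetaVol t₀) ((2 - B.q Λ T (B.timeOfTau t₀ τ)) * B.thetaVol t₀ τ) τ := by
  have hθ := hB.theta_timeOfTau_pos hτ
  have h1 := (B.hasDerivAt_of_contDiffOn B.contDiffOn_theta (hB.timeOfTau_mem_I hτ)).comp τ
    (hB.hasDerivAt_timeOfTau hτ)
  have h2 : HasDerivAt (fun s : ℝ => Real.exp (3 * s)) (Real.exp (3 * τ) * 3) τ := by
    have := ((hasDerivAt_id τ).const_mul (3 : ℝ)).exp
    simpa using this
  refine (h1.mul h2).congr_deriv ?_
  rw [hB.two_sub_q hE hτ, thetaVol]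
  simp only [Function.comp]
  field_simp
  ring

/-- V = θ √(det a) solves V_τ = (2-q)V, so Grönwall applies with rate -(2-q). Its square later
offsets the growth factor of the energy. -/
theorem thetaVol_le (hE : B.SolvesEinstein Λ T) (hτ₀ : 0 < B.tau t₀) (hτ : τ ≤ 0) :
    B.thetaVol t₀ τ ≤ B.thetaVol t₀ 0
      * Real.exp (∫ s in τ..0, -(2 - B.q Λ T (B.timeOfTau t₀ s))) := by
  have hlt : ∀ τ ≤ 0, τ < B.tau t₀ := fun τ hτ => hτ.trans_lt hτ₀
  refine Bianchi.monotoneOn_gronwall (E' := fun τ => (2 - B.q Λ T (B.timeOfTau t₀ τ))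
    * B.thetaVol t₀ τ) hτ le_rfl
    (fun s hs => (hB.hasDerivAt_thetaVol hE (hlt s hs.2)).continuousAt.continuousWithinAt)
    (fun s hs => hB.hasDerivAt_thetaVol hE (hlt s hs.2.le))
    (((hB.continuousOn_two_sub_q hE).mono hlt).neg) fun s _ => le_of_eq ?_
  ring

/-- Follows from 2-q ≥ -3γ_S̄ with γ_S̄ integrable. The bound keeps dσ/dτ = 1/V away from zero, so
that `σ` is unbounded below. -/
theorem exists_thetaVol_le (hE : B.SolvesEinstein Λ T) (hτ₀ : 0 < B.tau t₀)
    (hρp : ∀ t ∈ B.I, B.pBar T t ≤ rho T t) (hΛ : 0 ≤ Λ)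
    (hγ : IntegrableOn (B.gammaS t₀) (Iic 0)) :
    ∃ c, 0 < c ∧ ∀ τ ≤ 0, B.thetaVol t₀ τ ≤ c := by
  have hlt : ∀ τ ≤ 0, τ < B.tau t₀ := fun τ hτ => hτ.trans_lt hτ₀
  have hV := hB.thetaVol_pos (hlt 0 le_rfl)
  refine ⟨B.thetaVol t₀ 0 * Real.exp (3 * ∫ s in Iic 0, B.gammaS t₀ s), by positivity, ?_⟩
  intro τ hτ
  have h1 := Bianchi.monotoneOn_gronwall (E := B.thetaVol t₀)
    (E' := fun τ => (2 - B.q Λ T (B.timeOfTau t₀ τ))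
    * B.thetaVol t₀ τ) hτ le_rfl
    (fun s hs => (hB.hasDerivAt_thetaVol hE (hlt s hs.2)).continuousAt.continuousWithinAt)
    (fun s hs => hB.hasDerivAt_thetaVol hE (hlt s hs.2.le))
    (k := fun s => 3 * B.gammaS t₀ s) (continuousOn_const.mul (hB.continuousOn_gammaS.mono hlt))
    fun s hs => by
      have h2 := hB.two_sub_q_ge hE hρp hΛ (hlt s hs.2.le)
      have h3 := mul_le_mul_of_nonneg_right h2 (hB.thetaVol_pos (hlt s hs.2.le)).le
      linarith
  refine h1.trans ?_
  rw [intervalIntegral.integral_const_mul]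
  gcongr
  rw [intervalIntegral.integral_of_le hτ]
  exact setIntegral_mono_set hγ (Eventually.of_forall fun s => gammaS_nonneg s)
    (Ioc_subset_Iic_self.eventuallyLE)

theorem hasDerivAt_sigma (hτ₀ : 0 < B.tau t₀) (ht : t ∈ B.I₀ t₀) :
    HasDerivAt (B.sigma t₀) (1 / 3 * (√(B.a t).det)⁻¹) t := by
  have h0 := hB.timeOfTau_mem hτ₀
  have hc : ContinuousOn (fun s => 1 / 3 * (√(B.a s).det)⁻¹) B.I :=
    continuousOn_const.mul (((Bianchi.contDiffOn_det B.smooth_a).continuousOn.sqrt).inv₀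
      fun s hs => (Real.sqrt_pos.2 (B.det_pos hs)).ne')
  have hsub : uIcc (B.timeOfTau t₀ 0) t ⊆ B.I := ordConnected_I.uIcc_subset h0.1 ht.1
  exact intervalIntegral.integral_hasDerivAt_right (hc.mono hsub).intervalIntegrable
    (hc.stronglyMeasurableAtFilter B.isOpen_I t ht.1) (hc.continuousAt (B.isOpen_I.mem_nhds ht.1))

theorem contDiffOn_sigma (hτ₀ : 0 < B.tau t₀) : ContDiffOn ℝ ∞ (B.sigma t₀) (B.I₀ t₀) := by
  rw [contDiffOn_infty_iff_deriv_of_isOpen isOpen_I₀]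
  refine ⟨fun t ht => (hB.hasDerivAt_sigma hτ₀ ht).differentiableAt.differentiableWithinAt, ?_⟩
  have hc : ContDiffOn ℝ ∞ (fun s => 1 / 3 * (√(B.a s).det)⁻¹) (B.I₀ t₀) :=
    (contDiffOn_const.mul (((Bianchi.contDiffOn_det B.smooth_a).sqrt
      fun s hs => (B.det_pos hs).ne').inv fun s hs => (Real.sqrt_pos.2 (B.det_pos hs)).ne')).mono
      (inter_subset_left : B.I₀ t₀ ⊆ B.I)
  exact hc.congr fun t ht => (hB.hasDerivAt_sigma hτ₀ ht).deriv

theorem exists_tau_of_sigma (hτ₀ : 0 < B.tau t₀) (hE : B.SolvesEinstein Λ T)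
    (hρp : ∀ t ∈ B.I, B.pBar T t ≤ rho T t) (hΛ : 0 ≤ Λ)
    (hγ : IntegrableOn (B.gammaS t₀) (Iic 0)) {σ : ℝ} (hσ : σ ≤ 0) :
    ∃ τ ≤ 0, B.sigma t₀ (B.timeOfTau t₀ τ) = σ := by
  have hlt : ∀ τ ≤ 0, τ < B.tau t₀ := fun τ hτ => hτ.trans_lt hτ₀
  obtain ⟨c, hc, hcV⟩ := hB.exists_thetaVol_le hE hτ₀ hρp hΛ hγ
  have hd : ∀ τ ≤ 0, HasDerivAt (fun τ => B.sigma t₀ (B.timeOfTau t₀ τ)) (B.thetaVol t₀ τ)⁻¹ τ := by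
    intro τ hτ
    have ht := hB.timeOfTau_mem (hlt τ hτ)
    refine ((hB.hasDerivAt_sigma hτ₀ ht).comp τ (hB.hasDerivAt_timeOfTau (hlt τ hτ))).congr_deriv ?_
    rw [sqrt_det_eq ht.1, hB.tau_timeOfTau (hlt τ hτ), thetaVol]
    have := hB.theta_timeOfTau_pos (hlt τ hτ)
    field_simp
  have hcont : ContinuousOn (fun τ => B.sigma t₀ (B.timeOfTau t₀ τ)) (Iic 0) := fun τ hτ =>
    (hd τ hτ).continuousAt.continuousWithinAt
  have hmono : MonotoneOn (fun τ => B.sigma t₀ (B.timeOfTau t₀ τ) - c⁻¹ * τ) (Iic 0) := by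
    have hd' : ∀ τ ≤ 0, HasDerivAt (fun τ => B.sigma t₀ (B.timeOfTau t₀ τ) - c⁻¹ * τ)
        ((B.thetaVol t₀ τ)⁻¹ - c⁻¹) τ := fun τ hτ => by
      exact ((hd τ hτ).sub ((hasDerivAt_id τ).const_mul c⁻¹)).congr_deriv (by simp)
    have hint : ∀ τ ∈ interior (Iic (0 : ℝ)), τ ≤ 0 := fun τ hτ => mem_Iic.1 (interior_subset hτ)
    refine monotoneOn_of_deriv_nonneg (convex_Iic 0)
      (fun τ hτ => (hd' τ hτ).continuousAt.continuousWithinAt)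
      (fun τ hτ => (hd' τ (hint τ hτ)).differentiableAt.differentiableWithinAt)
      fun τ hτ => ?_
    rw [(hd' τ (hint τ hτ)).deriv, sub_nonneg]
    exact inv_anti₀ (hB.thetaVol_pos (hlt τ (hint τ hτ))) (hcV τ (hint τ hτ))
  have h0 : B.sigma t₀ (B.timeOfTau t₀ 0) = 0 := by simp [sigma]
  -- As dσ/dτ ≥ 1/c, the function σ(τ) is already at most σ at τ = cσ, and it vanishes at τ = 0; the
  -- value σ is taken in between.
  have hcσ : c * σ ≤ 0 := mul_nonpos_of_nonneg_of_nonpos hc.le hσ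
  have h1 := hmono (show c * σ ∈ Iic 0 from hcσ) self_mem_Iic hcσ
  simp only [h0, mul_zero, sub_zero] at h1
  have h2 : c⁻¹ * (c * σ) = σ := by field_simp
  rw [h2] at h1
  obtain ⟨τ, hτ, hτσ⟩ := intermediate_value_Icc hcσ (hcont.mono Icc_subset_Iic_self)
    (show σ ∈ Icc _ _ from ⟨by linarith, by rw [h0]; exact hσ⟩)
  exact ⟨τ, hτ.2, hτσ⟩

theorem deriv_comp_timeOfSigma (hτ₀ : 0 < B.tau t₀) (hu : B.IsSolution φ₀ t₀ u) (hτ : τ ≤ 0)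
    (x : G) :
    deriv (fun s => u x (B.timeOfSigma t₀ s)) (B.sigma t₀ (B.timeOfTau t₀ τ))
      = B.thetaVol t₀ τ * deriv (B.inTau t₀ u x) τ := by
  have hus : Bianchi.SmoothOn (B.I₀ t₀) u := hu.smooth
  have hτt := hτ.trans_lt hτ₀
  have ht := hB.timeOfTau_mem hτt
  have hθ := hB.theta_timeOfTau_pos hτt
  have hd := fun t (ht : t ∈ B.I₀ t₀) => hB.hasDerivAt_sigma hτ₀ ht
  have hinv : B.timeOfSigma t₀ (B.sigma t₀ (B.timeOfTau t₀ τ)) = B.timeOfTau t₀ τ :=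
    (Bianchi.strictMonoOn_of_hasDerivAt_pos ordConnected_I₀ hd
      sigma_deriv_pos).injOn.leftInvOn_invFunOn ht
  have h1 : HasDerivAt (B.timeOfSigma t₀) _ (B.sigma t₀ (B.timeOfTau t₀ τ)) :=
    Bianchi.hasDerivAt_invFunOn isOpen_I₀ ordConnected_I₀ (hB.contDiffOn_sigma hτ₀)
    hd sigma_deriv_pos (mem_image_of_mem _ ht)
  change HasDerivAt (B.timeOfSigma t₀) (1 / 3 * (√(B.a (B.timeOfSigma t₀
    (B.sigma t₀ (B.timeOfTau t₀ τ)))).det)⁻¹)⁻¹ _ at h1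
  rw [hinv, sqrt_det_eq ht.1, hB.tau_timeOfTau hτt] at h1
  have h2 := (hus.hasDerivAt isOpen_I₀ x ht)
  rw [← hinv] at h2
  have h3 := (h2.comp _ h1).deriv
  rw [hinv] at h3
  refine h3.trans ?_
  rw [(hB.hasDerivAt_inTau hus x hτt).deriv, thetaVol]
  field_simp

end IsMonotoneVolumeSingularity

end BianchiSpacetime

namespace Bianchi

/-! ### The volume measure as a multiple of Haar measure. -/

section FrameVolume

variable {G : Type*} [TopologicalSpace G] [T2Space G] [ChartedSpace (EuclideanSpace ℝ (Fin 3)) G]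
  [Group G] [LieGroup (𝓡 3) ∞ G] [MeasurableSpace G] [BorelSpace G]
  (e : Basis (Fin 3) ℝ (GroupLieAlgebra (𝓡 3) G))

theorem exists_haar_smul : ∃ (μ : Measure G) (c : ENNReal), c ≠ ⊤ ∧ μ.IsHaarMeasure ∧
    frameVolume e = c • μ := by
  have : IsTopologicalGroup G := topologicalGroup_of_lieGroup (𝓡 3) ∞
  exact ⟨Measure.haarMeasure (refCompact G), _, (lintegral_frameDensity_lt_top (e := e)).ne,
    inferInstance, rfl⟩

/-- The identity scales with the measure, so both measures share the constants κ_i. The Haar measure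
is kept as well because finite propagation needs positivity on open sets, whereas of the factor in
`frameVolume` only finiteness is established. -/
theorem exists_divergence_constants : ∃ (μ : Measure G) (κ : Fin 3 → ℝ), μ.IsHaarMeasure ∧
    IsFiniteMeasureOnCompacts (frameVolume e) ∧
    (∀ i, ∀ F : G → ℝ, ContMDiff (𝓡 3) 𝓘(ℝ, ℝ) ∞ F → HasCompactSupport F →
      ∫ x, frameD e i F x ∂μ = κ i * ∫ x, F x ∂μ) ∧
    ∀ i, ∀ F : G → ℝ, ContMDiff (𝓡 3) 𝓘(ℝ, ℝ) ∞ F → HasCompactSupport F →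
      ∫ x, frameD e i F x ∂(frameVolume e) = κ i * ∫ x, F x ∂(frameVolume e) := by
  have : IsTopologicalGroup G := topologicalGroup_of_lieGroup (𝓡 3) ∞
  obtain ⟨μ, c, hc, hμ, he⟩ := exists_haar_smul e
  choose κ hκ using exists_integral_frameD μ e
  refine ⟨μ, κ, hμ, ?_, hκ, ?_⟩
  · refine ⟨fun K hK => ?_⟩
    rw [he, Measure.smul_apply, smul_eq_mul]
    exact ENNReal.mul_lt_top hc.lt_top hK.measure_lt_top
  · intro i F hF hFc
    rw [he, integral_smul_measure, integral_smul_measure, hκ i F hF hFc]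
    simp only [smul_eq_mul]
    ring

end FrameVolume

section

variable {G : Type*} [TopologicalSpace G] [ChartedSpace (EuclideanSpace ℝ (Fin 3)) G]
  [Group G] [LieGroup (𝓡 3) ∞ G] {e : Basis (Fin 3) ℝ (GroupLieAlgebra (𝓡 3) G)}

theorem frameDK_const_mul {F : G → ℝ} (hF : ContMDiff (𝓡 3) 𝓘(ℝ, ℝ) ∞ F) {n : ℕ}
    (K : MultiIndex n) (c : ℝ) (x : G) :
    frameDK e K (fun y => c * F y) x = c * frameDK e K F x := by
  set H : C^∞⟮𝓡 3, G; 𝓘(ℝ, ℝ), ℝ⟯ := ⟨F, hF⟩ with hH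
  have h1 : frameOpK e K (c • H) x = c * frameOpK e K H x := by
    rw [_root_.map_smul]
    rfl
  rw [frameOpK_apply, frameOpK_apply] at h1
  exact h1

end

end Bianchi

/-! ### The energies in terms of the abstract wave energies. -/

namespace BianchiSpacetime

variable {G : Type*} [TopologicalSpace G] [ChartedSpace (EuclideanSpace ℝ (Fin 3)) G]
  [Group G] {B : BianchiSpacetime G} {t₀ τ : ℝ} {u : G → ℝ → ℝ}

theorem energyDensity_eq (f : ℝ → ℝ) (l : ℕ) (x : G) : B.energyDensity f t₀ l u τ x
    = 2 * Bianchi.waveDensLE B.e (fun τ => (B.aHat t₀ τ)⁻¹) f l (B.inTau t₀ u) τ x := by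
  rw [energyDensity, Bianchi.waveDensLE, Bianchi.sum_multiIndexLE fun n K =>
    Bianchi.waveDens B.e (fun τ => (B.aHat t₀ τ)⁻¹) f (Bianchi.derivK B.e K (B.inTau t₀ u)) x τ]
  simp only [Finset.mul_sum]
  refine Finset.sum_congr rfl fun n _ => Finset.sum_congr rfl fun K _ => ?_
  rw [Bianchi.waveDens, Bianchi.dens, ← mul_assoc]
  norm_num
  rfl

theorem energy_eq [LieGroup (𝓡 3) ∞ G] [MeasurableSpace G] [BorelSpace G] (f : ℝ → ℝ) (l : ℕ) :
    B.energy f t₀ l u τ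
      = ∫ x, Bianchi.waveDensLE B.e (fun τ => (B.aHat t₀ τ)⁻¹) f l (B.inTau t₀ u) τ x
        ∂(Bianchi.frameVolume B.e) := by
  simp only [energy, energyDensity_eq, integral_const_mul]
  ring

theorem IsMonotoneVolumeSingularity.sigmaDensity_eq [LieGroup (𝓡 3) ∞ G]
    (hB : B.IsMonotoneVolumeSingularity t₀) (hτ₀ : 0 < B.tau t₀) {φ₀ : ℝ → ℝ}
    (hu : B.IsSolution φ₀ t₀ u) (hτ : τ ≤ 0) (l : ℕ) (x : G) :
    B.sigmaDensity t₀ l u (B.sigma t₀ (B.timeOfTau t₀ τ)) x = B.thetaVol t₀ τ ^ 2 *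
      ∑ K : Bianchi.MultiIndexLE l, deriv (Bianchi.derivK B.e K.2 (B.inTau t₀ u) x) τ ^ 2 := by
  have hv := hB.smoothOn_inTau hu
  have hτJ : τ ∈ Iio (B.tau t₀) := hτ.trans_lt hτ₀
  rw [sigmaDensity, Bianchi.sum_multiIndexLE fun n K =>
    deriv (Bianchi.derivK B.e K (B.inTau t₀ u) x) τ ^ 2]
  simp only [Finset.mul_sum, hB.deriv_comp_timeOfSigma hτ₀ hu hτ]
  refine Finset.sum_congr rfl fun n _ => Finset.sum_congr rfl fun K _ => ?_
  rw [hv.deriv_derivK isOpen_Iio K x hτJ,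
    Bianchi.frameDK_const_mul ((hv.deriv isOpen_Iio).space hτJ), mul_pow]
  rfl

end BianchiSpacetime

end

/-! ### The main theorem. -/

theorem theorem1 {G : Type*} [TopologicalSpace G] [T2Space G] [SecondCountableTopology G]
    [ConnectedSpace G] [ChartedSpace (EuclideanSpace ℝ (Fin 3)) G] [Group G]
    [LieGroup (𝓡 3) ∞ G] [MeasurableSpace G] [BorelSpace G]
    (B : BianchiSpacetime G) (t₀ : ℝ) (hB : B.IsMonotoneVolumeSingularity t₀)
    (hτ₀ : 0 < B.tau t₀)
    (Λ : ℝ) (T : ℝ → Matrix BianchiSpacetime.Idx BianchiSpacetime.Idx ℝ)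
    (hE : B.SolvesEinstein Λ T)
    (hρp : ∀ t ∈ B.I, B.pBar T t ≤ BianchiSpacetime.rho T t)
    (hρ : ∀ t ∈ B.I, 0 ≤ BianchiSpacetime.rho T t) (hΛ : 0 ≤ Λ)
    (φ₀ : ℝ → ℝ) (hφ₀ : ContDiffOn ℝ ∞ φ₀ B.I)
    (hγ : IntegrableOn (B.gammaS t₀) (Iic 0))
    (f : ℝ → ℝ) (hf : AdmissibleWeight f)
    (hsilent : ∀ τ ≤ 0, |B.phiHat φ₀ t₀ τ|
      + ‖Matrix.toEuclideanCLM (n := Fin 3) (𝕜 := ℝ) (B.aHat t₀ τ)⁻¹‖ ≤ f τ ^ 2)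
    (l : ℕ) :
    ∃ C : ℝ, ∀ u : G → ℝ → ℝ, B.IsSolution φ₀ t₀ u → B.HasCompactData t₀ u →
      (∀ τ ≤ 0, Integrable (B.energyDensity f t₀ l u τ) (Bianchi.frameVolume B.e) ∧
        B.energy f t₀ l u τ ≤ C * B.energy f t₀ l u 0
          * Real.exp (2 * ∫ s in τ..0, (2 - B.q Λ T (B.timeOfTau t₀ s)))) ∧
      (∀ σ ≤ 0, Integrable (B.sigmaDensity t₀ l u σ) (Bianchi.frameVolume B.e) ∧
        ∫ x, B.sigmaDensity t₀ l u σ x ∂(Bianchi.frameVolume B.e)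
          ≤ C * B.energy f t₀ l u 0) := by
  have hlt : ∀ τ ≤ 0, τ < B.tau t₀ := fun τ hτ => hτ.trans_lt hτ₀
  have hJ0 : Iic 0 ⊆ Iio (B.tau t₀) := hlt
  have hW := hB.waveCoeff hτ₀ hE hρp hρ hΛ hf hsilent
  obtain ⟨μ, κ, hμ, hfin, hκμ, hκ⟩ := Bianchi.exists_divergence_constants B.e
  obtain ⟨M, hM, hMe⟩ := Bianchi.exists_energy_le B.e κ (Bianchi.traceCovector B.e) l
  set A := fun τ => (B.aHat t₀ τ)⁻¹ with hA
  set b := fun τ => 2 - B.q Λ T (B.timeOfTau t₀ τ) with hb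
  -- The total cost over (-∞, 0] of the integrable part 6γ_S̄ + M𝔣 of the growth rate.
  set C₁ := Real.exp (6 * (∫ s in Iic 0, B.gammaS t₀ s) + M * ∫ s in Iic 0, f s) with hC₁
  -- The first summand serves the `τ` estimate, the second the `σ` estimate; the sum serves both
  -- because the initial energy is nonnegative.
  refine ⟨C₁ + 2 * B.thetaVol t₀ 0 ^ 2 * C₁, fun u hu hud => ?_⟩
  have hv := hB.smoothOn_inTau hu
  have hpde := hB.isWave_inTau hE hτ₀ hu
  have hsupp : ∀ τ, ∃ K : Set G, IsCompact K ∧ ∀ x ∉ K, ∀ s ∈ Icc τ 0,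
      B.inTau t₀ u x s = 0 ∧ deriv (B.inTau t₀ u x) s = 0 := by
    refine Bianchi.exists_compact_support hW hf.pos isOpen_Iio hJ0 hκμ hv hpde
      (K₀ := _ ∪ _) (hud.1.isCompact.union hud.2.isCompact) fun x hx => ?_
    rw [mem_union, not_or] at hx
    exact ⟨image_eq_zero_of_notMem_tsupport (f := fun x => u x (B.timeOfTau t₀ 0)) hx.1,
      image_eq_zero_of_notMem_tsupport
        (f := fun x => deriv (fun τ => u x (B.timeOfTau t₀ τ)) 0) hx.2⟩
  set E := fun τ => ∫ x, Bianchi.waveDensLE B.e A f l (B.inTau t₀ u) τ x ∂(Bianchi.frameVolume B.e)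
    with hEdef
  have hEeq : ∀ τ, B.energy f t₀ l u τ = E τ := fun τ => BianchiSpacetime.energy_eq f l
  have hdn : ∀ τ ≤ 0, ∀ x, 0 ≤ Bianchi.waveDensLE B.e A f l (B.inTau t₀ u) τ x := fun τ hτ x =>
    Finset.sum_nonneg fun K _ => (hW.form τ hτ).dens_nonneg _ _ _
  have hE0 : 0 ≤ E 0 := integral_nonneg (hdn 0 le_rfl)
  have hint : ∀ τ ≤ 0, Integrable (Bianchi.waveDensLE B.e A f l (B.inTau t₀ u) τ)
      (Bianchi.frameVolume B.e) := by
    intro τ hτ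
    obtain ⟨K, hK, hKv⟩ := hsupp τ
    exact (hW.continuous_waveDensLE isOpen_Iio hJ0 hv l hτ).integrable_of_hasCompactSupport
      (Bianchi.hasCompactSupport_waveDensLE isOpen_Iio hv l (hlt τ hτ) hK
        fun x hx => hKv x hx τ ⟨le_rfl, hτ⟩)
  have hbound : ∀ τ ≤ 0, E τ ≤ C₁ * E 0 * Real.exp (2 * ∫ s in τ..0, b s) := by
    intro τ hτ
    obtain ⟨K, hK, hKv⟩ := hsupp τ
    refine (hMe hW isOpen_Iio hJ0 hκ hv hpde hτ hK hKv).trans ?_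
    have hsub : uIcc τ 0 ⊆ Iic 0 := by
      rw [uIcc_of_le hτ]
      exact Icc_subset_Iic_self
    have i1 : IntervalIntegrable b volume τ 0 := (hW.continuousOn_b.mono hsub).intervalIntegrable
    have i2 : IntervalIntegrable (B.gammaS t₀) volume τ 0 :=
      (hW.continuousOn_γ.mono hsub).intervalIntegrable
    have i3 : IntervalIntegrable f volume τ 0 := (hW.continuousOn_f.mono hsub).intervalIntegrable
    have e1 : ∫ s in τ..0, (2 * b s + 6 * B.gammaS t₀ s + M * f s)
        = 2 * (∫ s in τ..0, b s) + 6 * (∫ s in τ..0, B.gammaS t₀ s) + M * ∫ s in τ..0, f s := by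
      rw [intervalIntegral.integral_add ((i1.const_mul 2).add (i2.const_mul 6)) (i3.const_mul M),
        intervalIntegral.integral_add (i1.const_mul 2) (i2.const_mul 6)]
      simp only [intervalIntegral.integral_const_mul]
    have h1 : ∫ s in τ..0, B.gammaS t₀ s ≤ ∫ s in Iic 0, B.gammaS t₀ s := by
      rw [intervalIntegral.integral_of_le hτ]
      exact setIntegral_mono_set hγ
        (Eventually.of_forall fun s => BianchiSpacetime.gammaS_nonneg s)
        Ioc_subset_Iic_self.eventuallyLE
    have h2 : ∫ s in τ..0, f s ≤ ∫ s in Iic 0, f s := by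
      rw [intervalIntegral.integral_of_le hτ]
      exact setIntegral_mono_set hf.integrable
        (ae_restrict_of_forall_mem measurableSet_Iic fun s hs => (hf.pos s hs).le)
        Ioc_subset_Iic_self.eventuallyLE
    have h3 : M * ∫ s in τ..0, f s ≤ M * ∫ s in Iic 0, f s := mul_le_mul_of_nonneg_left h2 hM
    calc E 0 * Real.exp (∫ s in τ..0, (2 * b s + 6 * B.gammaS t₀ s + M * f s))
        ≤ E 0 * (C₁ * Real.exp (2 * ∫ s in τ..0, b s)) := by
          refine mul_le_mul_of_nonneg_left ?_ hE0
          rw [e1, hC₁, ← Real.exp_add]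
          exact Real.exp_le_exp.2 (by linarith)
      _ = _ := by ring
  have hC₁0 : 0 < C₁ := Real.exp_pos _
  constructor
  · intro τ hτ
    constructor
    · have : B.energyDensity f t₀ l u τ
          = fun x => 2 * Bianchi.waveDensLE B.e A f l (B.inTau t₀ u) τ x :=
        funext fun x => BianchiSpacetime.energyDensity_eq f l x
      rw [this]
      exact (hint τ hτ).const_mul 2
    · rw [hEeq, hEeq]
      refine (hbound τ hτ).trans ?_
      gcongr
      have : 0 ≤ 2 * B.thetaVol t₀ 0 ^ 2 * C₁ := by positivity
      linarith
  · intro σ hσ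
    obtain ⟨τ, hτ, rfl⟩ := hB.exists_tau_of_sigma hτ₀ hE hρp hΛ hγ hσ
    have hs : B.sigmaDensity t₀ l u (B.sigma t₀ (B.timeOfTau t₀ τ)) = fun x => B.thetaVol t₀ τ ^ 2 *
        ∑ K : Bianchi.MultiIndexLE l, deriv (Bianchi.derivK B.e K.2 (B.inTau t₀ u) x) τ ^ 2 :=
      funext fun x => hB.sigmaDensity_eq hτ₀ hu hτ l x
    have hsi : Integrable (fun x => B.thetaVol t₀ τ ^ 2 * ∑ K : Bianchi.MultiIndexLE l,
        deriv (Bianchi.derivK B.e K.2 (B.inTau t₀ u) x) τ ^ 2) (Bianchi.frameVolume B.e) := by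
      refine Integrable.const_mul (integrable_finsetSum _ fun L _ => ?_) _
      obtain ⟨K, hK, hKv⟩ := hsupp τ
      refine Continuous.integrable_of_hasCompactSupport ?_ (HasCompactSupport.intro hK fun x hx => ?_)
      · exact ((((hv.derivK isOpen_Iio L.2).deriv isOpen_Iio).space (hlt τ hτ)).continuous).pow 2
      · rw [(Bianchi.derivK_vanish isOpen_Iio hv hK.isClosed.isOpen_compl (hlt τ hτ)
          (fun y hy => hKv y hy τ ⟨le_rfl, hτ⟩) L.2 hx).1]
        ring
    rw [hs]
    refine ⟨hsi, ?_⟩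
    rw [hEeq]
    have hle : ∀ x, B.thetaVol t₀ τ ^ 2 * ∑ K : Bianchi.MultiIndexLE l,
          deriv (Bianchi.derivK B.e K.2 (B.inTau t₀ u) x) τ ^ 2
        ≤ B.thetaVol t₀ τ ^ 2 * (2 * Bianchi.waveDensLE B.e A f l (B.inTau t₀ u) τ x) := by
      intro x
      refine mul_le_mul_of_nonneg_left ?_ (sq_nonneg _)
      rw [Bianchi.waveDensLE, Finset.mul_sum]
      refine Finset.sum_le_sum fun K _ => ?_
      have h1 := (hW.form τ hτ).nonneg (Bianchi.grad B.e (Bianchi.derivK B.e K.2 (B.inTau t₀ u)) x τ)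
      have h2 : 0 ≤ f τ ^ 2 * Bianchi.derivK B.e K.2 (B.inTau t₀ u) x τ ^ 2 := by positivity
      rw [Bianchi.waveDens, Bianchi.dens]
      linarith
    have hV := hB.thetaVol_le hE hτ₀ hτ
    rw [intervalIntegral.integral_neg] at hV
    have hV0 := (hB.thetaVol_pos (hlt τ hτ)).le
    calc _ ≤ ∫ x, B.thetaVol t₀ τ ^ 2 * (2 * Bianchi.waveDensLE B.e A f l (B.inTau t₀ u) τ x)
          ∂(Bianchi.frameVolume B.e) :=
          integral_mono hsi (((hint τ hτ).const_mul 2).const_mul _) hle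
      _ = 2 * B.thetaVol t₀ τ ^ 2 * E τ := by
          rw [integral_const_mul, integral_const_mul]
          ring
      -- V² supplies the factor exp(-2∫(2-q)), which cancels the growth of the energy exactly.
      _ ≤ 2 * (B.thetaVol t₀ 0 * Real.exp (-∫ s in τ..0, b s)) ^ 2
          * (C₁ * E 0 * Real.exp (2 * ∫ s in τ..0, b s)) := by
          have := hbound τ hτ
          have : 0 ≤ E τ := integral_nonneg (hdn τ hτ)
          gcongr
      _ = 2 * B.thetaVol t₀ 0 ^ 2 * C₁ * E 0 := by
          have h1 : Real.exp (-∫ s in τ..0, b s) ^ 2 * Real.exp (2 * ∫ s in τ..0, b s) = 1 := by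
            rw [← Real.exp_nat_mul, ← Real.exp_add]
            simp
          calc _ = 2 * B.thetaVol t₀ 0 ^ 2 * C₁ * E 0 * (Real.exp (-∫ s in τ..0, b s) ^ 2
                * Real.exp (2 * ∫ s in τ..0, b s)) := by ring
            _ = _ := by rw [h1, mul_one]
      _ ≤ _ := by
          have : 0 ≤ C₁ * E 0 := by positivity
          linarith
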